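/- **Setting.** Let $X$ be a set with at least two points and let $\rho\colon X\times X\to[0,\infty)$ be a quasi-metric: $\rho(x,y)=0$ iff $x=y$, and there are positive constants $C_0,C_1$ with $\rho(y,x)\le C_0\,\rho(x,y)$ and $\rho(x,y)\le C_1\max\{\rho(x,z),\rho(z,y)\}$ for all $x,y,z\in X$. Put $B_\rho(x,r):=\{y\in X:\rho(x,y)<r\}$, $\operatorname{diam}_\rho(X):=\sup_{x,y\in X}\rho(x,y)$, and, for $B=B_\rho(x,r)$, $\sigma B:=B_\rho(x,\sigma r)$. Let $$C_\rho:=\sup_{x,y,z\in X\text{ not all equal}}\frac{\rho(x,y)}{\max\{\rho(x,z),\rho(z,y)\}}\in[1,\infty),\qquad \operatorname{ind}(X,\rho):=\sup_{\varrho\approx\rho}(\log_2C_\varrho)^{-1}\in(0,\infty],$$ where the second supremum is over all quasi-metrics $\varrho$ on $X$ with $c^{-1}\varrho\le\rho\le c\,\varrho$ for some constant $c\in(0,\infty)$, and $0^{-1}:=\infty$. For $s\in(0,\infty)$ and $q\in(0,\infty]$, $s\preceq_q\operatorname{ind}(X,\rho)$ means that $s\le\operatorname{ind}(X,\rho)$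 and that $s=\operatorname{ind}(X,\rho)$ is allowed only when $q=\infty$ and the supremum defining $\operatorname{ind}(X,\rho)$ is attained. Let $\mu$ be a nonnegative Borel measure (with respect to the topology whose open sets are the sets that contain a $\rho$-ball around each of their points) such that all $\rho$-balls are $\mu$-measurable with $0<\mu(B_\rho(x,r))<\infty$ for all $x\in X$, $r\in(0,\infty)$. Assume that $(X,\rho)$ is uniformly perfect: there is a $\lambda\in(0,1)$ such that, for all $x\in X$ and $r\in(0,\infty)$, $B_\rho(x,r)\setminus B_\rho(x,\lambda r)\ne\emptyset$ whenever $X\setminus B_\rho(x,r)\neq\emptyset$. **Function spaces.** Let $E\subset X$ be $\mu$-measurable, $s,p\in(0,\infty)$ and $q\in(0,\infty]$. A sequence $\vec g=\{g_k\}_{k\in\mathbb Z}$ of $\mu$-measurable functions $g_k\colon E\to[0,\infty]$ is a fractional $s$-gradient of a $\mu$-measurable $u\colon E\to\mathbb R$ if there is a $\mu$-null set $N$ such that $|u(x)-u(y)|\le[\rho(x,y)]^s[g_k(x)+g_k(y)]$ for all $k\in\mathbb Z$ and all $x,y\in E\setminus N$ with $2^{-k-1}\le\rho(x,y)<2^{-k}$.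 Let $$\|u\|_{\dot M^s_{p,q}(E)}:=\inf_{\vec g}\Big\|\,\|\{g_k\}_k\|_{\ell^q}\Big\|_{L^p(E,\mu)},\qquad \|u\|_{\dot N^s_{p,q}(E)}:=\inf_{\vec g}\Big\|\big\{\|g_k\|_{L^p(E,\mu)}\big\}_k\Big\|_{\ell^q},$$ with infima over all fractional $s$-gradients $\vec g$ of $u$ on $E$ ($\inf\emptyset:=\infty$); $\dot M^s_{p,q}(E)$ and $\dot N^s_{p,q}(E)$ are the sets of all $\mu$-measurable $u\colon E\to\mathbb R$ for which the respective quantity is finite. **Theorem.** In this setting, let $q\in(0,\infty]$, $Q\in(0,\infty)$, $\sigma\in[C_\rho,\infty)$, and let $s\in(0,\infty)$ satisfy $s\preceq_q\operatorname{ind}(X,\rho)$. Below, $B$ ranges over all balls $B_\rho(x,r)$ with $x\in X$ and finite $r\in(0,\operatorname{diam}_\rho(X)]$, $p^*:=Qp/(Q-sp)$, and $u_B:=\frac1{\mu(B)}\int_B u\,d\mu$. The following statements are equivalent. (a) $\mu$ is lower $Q$-Ahlfors-regular: there is a $\kappa\in(0,\infty)$ with $\kappa r^Q\le\mu(B_\rho(x,r))$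 for all $x\in X$ and all finite $r\in(0,\operatorname{diam}_\rho(X)]$. (b) There exist $p\in(0,Q/s)$ and $C_S\in(0,\infty)$ such that, for every $B=B_\rho(x,r)$ and every $u\in\dot M^s_{p,q}(\sigma B)$, $$\Big(\frac1{\mu(B)}\int_B|u|^{p^*}d\mu\Big)^{1/p^*}\le C_S\,r^{-Q/p}\Big[r^s\|u\|_{\dot M^s_{p,q}(\sigma B)}+\|u\|_{L^p(\sigma B)}\Big].$$ (c) There exist $p\in(0,Q/s)$ and $C_P\in(0,\infty)$ such that, for every $B=B_\rho(x,r)$ and every $u\in\dot M^s_{p,q}(\sigma B)$, $$\inf_{\gamma\in\mathbb R}\Big(\frac1{\mu(B)}\int_B|u-\gamma|^{p^*}d\mu\Big)^{1/p^*}\le C_P\,r^{s-Q/p}\|u\|_{\dot M^s_{p,q}(\sigma B)}.$$ (d) There exist $c_1,c_2,\omega\in(0,\infty)$ such that, for every $B$ and every $u\in\dot M^s_{Q/s,q}(\sigma B)$ with $\|u\|_{\dot M^s_{Q/s,q}(\sigma B)}>0$, $u$ is integrable on $B$ and $$\frac1{\mu(B)}\int_B\exp\left[\left(c_1\frac{|u-u_B|}{\|u\|_{\dot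 M^s_{Q/s,q}(\sigma B)}}\right)^{\omega}\right]d\mu\le c_2.$$ (e) There exist $p\in(Q/s,\infty)$ and $C_H\in(0,\infty)$ such that every $u\in\dot M^s_{p,q}(X)$ agrees $\mu$-almost everywhere with a function $v\colon X\to\mathbb R$ satisfying $$|v(x)-v(y)|\le C_H[\rho(x,y)]^{s-Q/p}\|u\|_{\dot M^s_{p,q}(X)}\qquad\text{for all }x,y\in X.$$ Moreover, let (b'), (c'), (d'), (e') be the statements (b)–(e) with $\dot M$ replaced by $\dot N$ throughout, where in (b'), (c'), (e') the exponent $p$ is additionally required to satisfy $q\le p$. Then: if $q<Q/s$, the statements (a), (b'), (c'), (d'), (e') are equivalent; if $q\le Q/s$, the statements (a), (d'), (e') are equivalent; and if $q<\infty$, the statements (a) and (e') are equivalent. -/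

import Mathlib

open MeasureTheory Set
open scoped ENNReal

noncomputable section

namespace Hajlasz

variable {X : Type*}

/-! ### Quasi-metric spaces -/

/-- `ρ` is a quasi-metric on `X`: nonnegative, nondegenerate, quasi-symmetric and quasi-subadditive. -/
structure IsQuasiMetric (ρ : X → X → ℝ) : Prop where
  nonneg : ∀ x y, 0 ≤ ρ x y
  eq_zero_iff : ∀ x y, ρ x y = 0 ↔ x = y
  quasi_symm : ∃ C₀ : ℝ, 0 < C₀ ∧ ∀ x y, ρ y x ≤ C₀ * ρ x y
  quasi_subadd : ∃ C₁ : ℝ, 0 < C₁ ∧ ∀ x y z, ρ x y ≤ C₁ * max (ρ x z) (ρ z y)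

/-- The `ρ`-ball with centre `x` and radius `r`. -/
def qball (ρ : X → X → ℝ) (x : X) (r : ℝ) : Set X := {y | ρ x y < r}

/-- The `ρ`-diameter of `X`, with values in `[0, ∞]`. -/
def qdiam (ρ : X → X → ℝ) : ℝ≥0∞ := ⨆ (x : X) (y : X), ENNReal.ofReal (ρ x y)

/-- The constant `C_ρ`: the supremum of `ρ(x,y) / max {ρ(x,z), ρ(z,y)}` over all `x, y, z` that are
not all equal. For a quasi-metric on a space with at least two points this is the supremum of a
nonempty bounded set of reals, and the denominators are positive. -/
def quasiConst (ρ : X → X → ℝ) : ℝ :=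
  sSup {t : ℝ | ∃ x y z : X, ¬(x = y ∧ y = z) ∧ t = ρ x y / max (ρ x z) (ρ z y)}

/-- Bi-Lipschitz equivalence of quasi-metrics. -/
def QEquiv (ϱ ρ : X → X → ℝ) : Prop :=
  ∃ c : ℝ, 0 < c ∧ ∀ x y, c⁻¹ * ϱ x y ≤ ρ x y ∧ ρ x y ≤ c * ϱ x y

/-- `(log₂ C_ϱ)⁻¹ ∈ (0, ∞]`, equal to `∞` when `C_ϱ = 1`. -/
def smoothExp (ϱ : X → X → ℝ) : ℝ≥0∞ := (ENNReal.ofReal (Real.logb 2 (quasiConst ϱ)))⁻¹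

/-- The lower smoothness index `ind (X, ρ)`. -/
def lowerIndex (ρ : X → X → ℝ) : ℝ≥0∞ :=
  ⨆ (ϱ : X → X → ℝ) (_ : IsQuasiMetric ϱ ∧ QEquiv ϱ ρ), smoothExp ϱ

/-- `s ⪯_q ind (X, ρ)`: `s ≤ ind (X, ρ)`, where equality is allowed only if `q = ∞` and the
supremum that defines the index is attained. -/
def PrecIndex (ρ : X → X → ℝ) (q : ℝ≥0∞) (s : ℝ) : Prop :=
  ENNReal.ofReal s ≤ lowerIndex ρ ∧
    (ENNReal.ofReal s = lowerIndex ρ →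
      q = ∞ ∧ ∃ ϱ : X → X → ℝ, IsQuasiMetric ϱ ∧ QEquiv ϱ ρ ∧ smoothExp ϱ = lowerIndex ρ)

/-- Uniform perfectness. -/
def UniformlyPerfect (ρ : X → X → ℝ) : Prop :=
  ∃ lam : ℝ, 0 < lam ∧ lam < 1 ∧ ∀ (x : X) (r : ℝ), 0 < r →
    (univ \ qball ρ x r).Nonempty → (qball ρ x r \ qball ρ x (lam * r)).Nonempty

/-- The topology generated by `ρ`: a set is open if it contains a ball around each of its points. -/
@[reducible] def qtopology (ρ : X → X → ℝ) : TopologicalSpace X where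
  IsOpen U := ∀ x ∈ U, ∃ r : ℝ, 0 < r ∧ qball ρ x r ⊆ U
  isOpen_univ := fun _ _ => ⟨1, one_pos, subset_univ _⟩
  isOpen_inter := by
    rintro U V hU hV x ⟨hxU, hxV⟩
    obtain ⟨r, hr, hrU⟩ := hU x hxU
    obtain ⟨t, ht, htV⟩ := hV x hxV
    refine ⟨min r t, lt_min hr ht, fun y hy => ⟨hrU ?_, htV ?_⟩⟩
    · exact lt_of_lt_of_le (show ρ x y < min r t from hy) (min_le_left _ _)
    · exact lt_of_lt_of_le (show ρ x y < min r t from hy) (min_le_right _ _)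
  isOpen_sUnion := by
    rintro S hS x ⟨U, hUS, hxU⟩
    obtain ⟨r, hr, hrU⟩ := hS U hUS x hxU
    exact ⟨r, hr, hrU.trans (subset_sUnion_of_mem hUS)⟩

/-- `(X, ρ, μ)` is a quasi-metric measure space (that `X` has at least two points is asked for by
`[Nontrivial X]` where it is used): `μ` is a Borel measure, that is, its σ-algebra contains the
Borel sets of the topology of `ρ`, all balls are `μ`-measurable (they need not be Borel sets), and
all balls have positive and finite measure. -/
structure IsQuasiMetricMeasureSpace [MeasurableSpace X] (ρ : X → X → ℝ) (μ : Measure X) :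
    Prop where
  quasiMetric : IsQuasiMetric ρ
  borel_le : @borel X (qtopology ρ) ≤ ‹MeasurableSpace X›
  ball_measurable : ∀ (x : X) (r : ℝ), 0 < r → NullMeasurableSet (qball ρ x r) μ
  ball_pos : ∀ (x : X) (r : ℝ), 0 < r → 0 < μ (qball ρ x r)
  ball_lt_top : ∀ (x : X) (r : ℝ), 0 < r → μ (qball ρ x r) < ∞

/-! ### Hajłasz–Triebel–Lizorkin and Hajłasz–Besov spaces

For a `μ`-measurable set `E ⊆ X`, a function on `E` is represented by a function on `X` whose
values off `E` play no role: all notions below only see `μ.restrict E` and points of `E`. -/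

/-- The (quasi-)norm of `ℓ^q(ℤ)`, `q ∈ (0, ∞]`. -/
def lqNorm (q : ℝ≥0∞) (a : ℤ → ℝ≥0∞) : ℝ≥0∞ :=
  if q = ∞ then ⨆ k, a k else (∑' k, a k ^ q.toReal) ^ (1 / q.toReal)

variable [MeasurableSpace X]

/-- The (quasi-)norm of `L^p(E, μ)`, `p ∈ (0, ∞)`, for a `[0, ∞]`-valued function. -/
def lebNorm (μ : Measure X) (p : ℝ) (E : Set X) (f : X → ℝ≥0∞) : ℝ≥0∞ :=
  (∫⁻ x in E, f x ^ p ∂μ) ^ (1 / p)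

/-- The set of fractional `s`-gradients of `u` on `E`. -/
def fracGrad (ρ : X → X → ℝ) (μ : Measure X) (s : ℝ) (E : Set X) (u : X → ℝ) :
    Set (ℤ → X → ℝ≥0∞) :=
  {g | (∀ k, AEMeasurable (g k) (μ.restrict E)) ∧
    ∃ N : Set X, μ N = 0 ∧ ∀ k : ℤ, ∀ x ∈ E \ N, ∀ y ∈ E \ N,
      (2 : ℝ) ^ (-k - 1) ≤ ρ x y → ρ x y < (2 : ℝ) ^ (-k) →
        ENNReal.ofReal |u x - u y| ≤ ENNReal.ofReal (ρ x y ^ s) * (g k x + g k y)}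

/-- The homogeneous Hajłasz–Triebel–Lizorkin (quasi-)seminorm `‖u‖_{Ṁ^s_{p,q}(E)}`; it is `∞` if
there is no fractional gradient of finite norm. -/
def mNorm (ρ : X → X → ℝ) (μ : Measure X) (s p : ℝ) (q : ℝ≥0∞) (E : Set X) (u : X → ℝ) : ℝ≥0∞ :=
  ⨅ g ∈ fracGrad ρ μ s E u, lebNorm μ p E (fun x => lqNorm q (fun k => g k x))

/-- The homogeneous Hajłasz–Besov (quasi-)seminorm `‖u‖_{Ṅ^s_{p,q}(E)}`; it is `∞` if there is no
fractional gradient of finite norm. -/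
def nNorm (ρ : X → X → ℝ) (μ : Measure X) (s p : ℝ) (q : ℝ≥0∞) (E : Set X) (u : X → ℝ) : ℝ≥0∞ :=
  ⨅ g ∈ fracGrad ρ μ s E u, lqNorm q (fun k => lebNorm μ p E (g k))

/-- Membership of `u` in the function space on `E` with the seminorm `F`: `u` is `μ`-measurable
on `E` and `F E u` is finite. With `F = mNorm ρ μ s p q` this is `u ∈ Ṁ^s_{p,q}(E, ρ, μ)`, and with
`F = nNorm ρ μ s p q` it is `u ∈ Ṅ^s_{p,q}(E, ρ, μ)`. -/
def MemSpace (μ : Measure X) (F : Set X → (X → ℝ) → ℝ≥0∞) (E : Set X) (u : X → ℝ) : Prop :=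
  AEMeasurable u (μ.restrict E) ∧ F E u < ∞

/-! ### The measure condition and the embeddings

In the following, `F` is one of the seminorms `mNorm ρ μ s p q`, `nNorm ρ μ s p q`. -/

/-- `μ` is lower `Q`-Ahlfors-regular. -/
def LowerAhlforsRegular (ρ : X → X → ℝ) (μ : Measure X) (Q : ℝ) : Prop :=
  ∃ κ : ℝ, 0 < κ ∧ ∀ (x : X) (r : ℝ), 0 < r → ENNReal.ofReal r ≤ qdiam ρ →
    ENNReal.ofReal (κ * r ^ Q) ≤ μ (qball ρ x r)

/-- The Sobolev inequality on balls, with `p^* = Qp/(Q - sp)`. -/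
def SobolevIneq (ρ : X → X → ℝ) (μ : Measure X) (Q σ s p : ℝ)
    (F : Set X → (X → ℝ) → ℝ≥0∞) : Prop :=
  ∃ C : ℝ, 0 < C ∧ ∀ (x : X) (r : ℝ), 0 < r → ENNReal.ofReal r ≤ qdiam ρ →
    ∀ u : X → ℝ, MemSpace μ F (qball ρ x (σ * r)) u →
      (⨍⁻ y in qball ρ x r, ENNReal.ofReal |u y| ^ (Q * p / (Q - s * p)) ∂μ)
          ^ (1 / (Q * p / (Q - s * p))) ≤
        ENNReal.ofReal (C * r ^ (-(Q / p))) *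
          (ENNReal.ofReal (r ^ s) * F (qball ρ x (σ * r)) u +
            lebNorm μ p (qball ρ x (σ * r)) (fun y => ENNReal.ofReal |u y|))

/-- The Sobolev–Poincaré inequality on balls, with `p^* = Qp/(Q - sp)`. -/
def SobolevPoincareIneq (ρ : X → X → ℝ) (μ : Measure X) (Q σ s p : ℝ)
    (F : Set X → (X → ℝ) → ℝ≥0∞) : Prop :=
  ∃ C : ℝ, 0 < C ∧ ∀ (x : X) (r : ℝ), 0 < r → ENNReal.ofReal r ≤ qdiam ρ →
    ∀ u : X → ℝ, MemSpace μ F (qball ρ x (σ * r)) u →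
      (⨅ γ : ℝ, (⨍⁻ y in qball ρ x r, ENNReal.ofReal |u y - γ| ^ (Q * p / (Q - s * p)) ∂μ)
          ^ (1 / (Q * p / (Q - s * p)))) ≤
        ENNReal.ofReal (C * r ^ (s - Q / p)) * F (qball ρ x (σ * r)) u

/-- The Trudinger inequality on balls; that the mean value `u_B` exists is part of the claim. -/
def TrudingerIneq (ρ : X → X → ℝ) (μ : Measure X) (σ : ℝ)
    (F : Set X → (X → ℝ) → ℝ≥0∞) : Prop :=
  ∃ c₁ c₂ ω : ℝ, 0 < c₁ ∧ 0 < c₂ ∧ 0 < ω ∧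
    ∀ (x : X) (r : ℝ), 0 < r → ENNReal.ofReal r ≤ qdiam ρ →
      ∀ u : X → ℝ, MemSpace μ F (qball ρ x (σ * r)) u → 0 < F (qball ρ x (σ * r)) u →
        IntegrableOn u (qball ρ x r) μ ∧
        ⨍⁻ y in qball ρ x r, ENNReal.ofReal (Real.exp
            ((c₁ * (|u y - ⨍ z in qball ρ x r, u z ∂μ| /
              (F (qball ρ x (σ * r)) u).toReal)) ^ ω)) ∂μ ≤ ENNReal.ofReal c₂

/-- The global Hölder estimate of order `s - Q/p`: every `u` in the space over `X` agrees
`μ`-almost everywhere with a function `v` that satisfies the estimate at all pairs of points. -/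
def HolderEst (ρ : X → X → ℝ) (μ : Measure X) (Q s p : ℝ)
    (F : Set X → (X → ℝ) → ℝ≥0∞) : Prop :=
  ∃ C : ℝ, 0 < C ∧ ∀ u : X → ℝ, MemSpace μ F univ u →
    ∃ v : X → ℝ, v =ᵐ[μ] u ∧ ∀ x y : X,
      ENNReal.ofReal |v x - v y| ≤ ENNReal.ofReal (C * ρ x y ^ (s - Q / p)) * F univ u

end Hajlasz

end

open Hajlasz

/-!
All embeddings reduce to two properties of the seminorm `F` on a scale of spaces with integrability
exponent `p`, valid for `mNorm` and, for the first one if `q ≤ p`, for `nNorm`.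

* `ControlsGradient`: a function with `F E u < G` has a Hajłasz gradient, that is, a function `g`
  with `|u x - u y| ≤ ρ x y ^ s * (g x + g y)` off a null set, of `L^p` norm at most `G`.
* `BoundsBumps`: a function of oscillation at most `1` and of `α`-Hölder constant `L` that is
  supported in `A` has seminorm at most a multiple of `L ^ (s / α) * μ A ^ (1 / p)`; here `α ≥ s`,
  and `α = s` is admitted only for `q = ∞`.

*From lower regularity to the embeddings.* If `μ (B(x, t)) ≥ κ t ^ Q`, then Chebyshev's inequality
produces in each ball `B(x, t)` a point at which `g` is at most a multiple of `G t ^ (-Q / p)`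
(`exists_good_point`). Going through such points in `B(x, 2 ^ (-j) r)`, down to the scale at which
the bound exceeds `g x`, estimates the difference of `u x` and a value of `u` at scale `r` by
`G r ^ (s - Q / p)` times a geometric sum of ratio `2 ^ (Q / p - s)`, whose number `J` of terms
satisfies `2 ^ (J Q) ≲ 1 + (g x) ^ p r ^ Q / G ^ p` (`exists_chain`). The average of the right-hand
side over a ball is bounded. The sum is at most a multiple of its last term, of `J`, or of its first
term for `p < Q / s`, `p = Q / s` and `p > Q / s`, which gives the Sobolev and Sobolev–Poincaré
inequalities, the Trudinger inequality, and Hölder continuity off a null set; the latter extends to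
all points by density.

*From the embeddings to lower regularity.* The index condition gives an equivalent quasi-metric
with a power `α` that is a quasi-ultrametric with constant `2`. Frink's chain lemma
(`frink_chain`, for which symmetry is not needed) then provides functions comparable to
`ρ(z, ·) ^ α` that are Hölder continuous of order `α` (`PrecIndex.exists_gauge`). By uniform
perfectness each ball contains two disjoint balls of comparable radius; a gauge centred in
the one of smaller measure has sublevel sets whose complement in the large ball is at least as
large (`exists_bump_gauge`). Cutoffs
of the gauge between the levels `(1 + 2 ^ (-j - 1)) / 2` and `(1 + 2 ^ (-j)) / 2` differ from every
constant by `1 / 2` on a large set, so that the Sobolev type and Trudinger inequalities turn into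
`m (j + 1) ≤ C μ(B) r ^ (-Qθ) D ^ j (m j) ^ θ` with `θ > 1` for the measures `m j` of their
supports. As the `m j` are bounded below, such a recursion forces `μ(B) ≥ ε r ^ Q`
(`exists_le_of_iteration`). For the Hölder estimate a single cutoff suffices.
-/

namespace Hajlasz

variable {X : Type*}

/-! ### Quasi-metrics and their constants -/

/-- A single constant `K ≥ 1` serves for both the quasi-symmetry and the quasi-ultrametric
inequality. -/
theorem IsQuasiMetric.exists_const {ρ : X → X → ℝ} (hρ : IsQuasiMetric ρ) :
    ∃ K : ℝ, 1 ≤ K ∧ (∀ x y, ρ y x ≤ K * ρ x y) ∧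
      ∀ x y z, ρ x y ≤ K * max (ρ x z) (ρ z y) := by
  obtain ⟨C₀, _, h0⟩ := hρ.quasi_symm
  obtain ⟨C₁, _, h1⟩ := hρ.quasi_subadd
  refine ⟨max 1 (max C₀ C₁), le_max_left _ _, fun x y => (h0 x y).trans ?_,
    fun x y z => (h1 x y z).trans ?_⟩
  · exact mul_le_mul_of_nonneg_right ((le_max_left _ _).trans (le_max_right _ _)) (hρ.nonneg _ _)
  · exact mul_le_mul_of_nonneg_right ((le_max_right _ _).trans (le_max_right _ _))
      ((hρ.nonneg _ _).trans (le_max_left _ _))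

theorem IsQuasiMetric.self {ρ : X → X → ℝ} (hρ : IsQuasiMetric ρ) (x : X) : ρ x x = 0 :=
  (hρ.eq_zero_iff x x).2 rfl

theorem IsQuasiMetric.pos {ρ : X → X → ℝ} (hρ : IsQuasiMetric ρ) {x y : X} (h : x ≠ y) :
    0 < ρ x y :=
  lt_of_le_of_ne (hρ.nonneg _ _) fun h' => h ((hρ.eq_zero_iff x y).1 h'.symm)

theorem IsQuasiMetric.max_pos {ρ : X → X → ℝ} (hρ : IsQuasiMetric ρ) {x y z : X}
    (h : ¬(x = y ∧ y = z)) : 0 < max (ρ x z) (ρ z y) := by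
  by_cases hxz : x = z
  · have : z ≠ y := fun hzy => h ⟨hxz.trans hzy, hzy.symm⟩
    exact lt_max_of_lt_right (hρ.pos this)
  · exact lt_max_of_lt_left (hρ.pos hxz)

theorem qball_subset_mul {ρ : X → X → ℝ} {σ : ℝ} (hσ : 1 ≤ σ) (x : X) {r : ℝ} (hr : 0 < r) :
    qball ρ x r ⊆ qball ρ x (σ * r) :=
  fun _ hw => lt_of_lt_of_le hw (le_mul_of_one_le_left hr.le hσ)

theorem ofReal_le_qdiam (ρ : X → X → ℝ) (x y : X) : ENNReal.ofReal (ρ x y) ≤ qdiam ρ :=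
  le_iSup₂ (f := fun (x : X) (y : X) => ENNReal.ofReal (ρ x y)) x y

theorem IsQuasiMetric.bddAbove_quasiConst {ρ : X → X → ℝ} (hρ : IsQuasiMetric ρ) :
    BddAbove {t : ℝ | ∃ x y z : X, ¬(x = y ∧ y = z) ∧ t = ρ x y / max (ρ x z) (ρ z y)} := by
  obtain ⟨K, _, _, hK⟩ := hρ.exists_const
  refine ⟨K, ?_⟩
  rintro t ⟨x, y, z, hne, rfl⟩
  exact (div_le_iff₀ (hρ.max_pos hne)).2 (hK x y z)

theorem IsQuasiMetric.le_quasiConst_mul {ρ : X → X → ℝ} (hρ : IsQuasiMetric ρ) (x y z : X) :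
    ρ x y ≤ quasiConst ρ * max (ρ x z) (ρ z y) := by
  by_cases hne : x = y ∧ y = z
  · obtain ⟨rfl, rfl⟩ := hne
    simp [hρ.self]
  · rw [← div_le_iff₀ (hρ.max_pos hne)]
    exact le_csSup hρ.bddAbove_quasiConst ⟨x, y, z, hne, rfl⟩

theorem IsQuasiMetric.one_le_quasiConst [Nontrivial X] {ρ : X → X → ℝ} (hρ : IsQuasiMetric ρ) :
    1 ≤ quasiConst ρ := by
  obtain ⟨x, y, hxy⟩ := exists_pair_ne X
  have h := hρ.le_quasiConst_mul x y y
  rw [hρ.self, max_eq_left (hρ.nonneg x y)] at h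
  exact le_of_mul_le_mul_right (by simpa using h) (hρ.pos hxy)

/-! ### Frink's chain lemma and Hölder gauges -/

/-- Frink's chain lemma: the inequality `d x y ≤ 2 * max (d x z) (d z y)` controls `d` by sums along
chains, with weight `2` on the first and the last link and weight `4` on all others. Symmetry of
`d` is not needed. -/
theorem frink_chain_aux {d : X → X → ℝ} (h0 : ∀ x y, 0 ≤ d x y)
    (h2 : ∀ x y z, d x y ≤ 2 * max (d x z) (d z y)) (f : ℕ → X) :
    ∀ l m : ℕ, d (f m) (f (m + l + 2)) + 2 * d (f m) (f (m + 1)) +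
      2 * d (f (m + l + 1)) (f (m + l + 2)) ≤
        4 * ∑ i ∈ Finset.Ico m (m + l + 2), d (f i) (f (i + 1)) := by
  intro l
  induction l using Nat.strong_induction_on with
  | _ l ih =>
  intro m
  have hsum : d (f m) (f (m + 1)) + d (f (m + l + 1)) (f (m + l + 2)) ≤
      ∑ i ∈ Finset.Ico m (m + l + 2), d (f i) (f (i + 1)) := by
    rw [Finset.sum_eq_sum_Ico_succ_bot (by omega), Finset.sum_Ico_succ_top (by omega)]
    have := Finset.sum_nonneg
      (fun i (_ : i ∈ Finset.Ico (m + 1) (m + l + 1)) => h0 (f i) (f (i + 1)))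
    linarith
  by_cases hfirst : d (f m) (f (m + l + 2)) ≤ 2 * d (f m) (f (m + 1))
  · have := h0 (f (m + l + 1)) (f (m + l + 2))
    linarith
  by_cases hlast : d (f m) (f (m + l + 2)) ≤ 2 * d (f (m + l + 1)) (f (m + l + 2))
  · have := h0 (f m) (f (m + 1))
    linarith
  have hsplit : ∀ r, d (f m) (f (m + l + 2)) ≤ 2 * d (f m) (f r) ∨
      d (f m) (f (m + l + 2)) ≤ 2 * d (f r) (f (m + l + 2)) := by
    intro r
    have := h2 (f m) (f (m + l + 2)) (f r)
    rcases le_total (d (f m) (f r)) (d (f r) (f (m + l + 2))) with h | h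
    · right; rwa [max_eq_right h] at this
    · left; rwa [max_eq_left h] at this
  -- the last index whose distance to the endpoint is still at least half of the total
  obtain ⟨i, hil, hi, hi'⟩ : ∃ i, i < l ∧
      d (f m) (f (m + l + 2)) ≤ 2 * d (f (m + 1 + i)) (f (m + l + 2)) ∧
      ¬ d (f m) (f (m + l + 2)) ≤ 2 * d (f (m + 1 + (i + 1))) (f (m + l + 2)) := by
    by_contra! hcon
    have : ∀ i ≤ l, d (f m) (f (m + l + 2)) ≤ 2 * d (f (m + 1 + i)) (f (m + l + 2)) := by
      intro i
      induction i with
      | zero => intro _; exact (hsplit (m + 1)).resolve_left hfirst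
      | succ i hi => intro hl; exact hcon i (by omega) (hi (by omega))
    apply hlast
    have := this l le_rfl
    rwa [show m + 1 + l = m + l + 1 by omega] at this
  have h3 := (hsplit (m + 1 + (i + 1))).resolve_right hi'
  have ih1 := ih i hil m
  have ih2 := ih (l - i - 1) (by omega) (m + 1 + i)
  rw [show m + 1 + i + (l - i - 1) + 2 = m + l + 2 by omega,
    show m + 1 + i + (l - i - 1) + 1 = m + l + 1 by omega] at ih2
  rw [show m + 1 + (i + 1) = m + i + 2 by omega] at h3
  rw [show m + 1 + i = m + i + 1 by omega] at ih2 hi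
  rw [show m + i + 1 + 1 = m + i + 2 by omega] at ih2
  have e1 : ∑ j ∈ Finset.Ico m (m + i + 2), d (f j) (f (j + 1)) +
      ∑ j ∈ Finset.Ico (m + i + 2) (m + l + 2), d (f j) (f (j + 1)) =
      ∑ j ∈ Finset.Ico m (m + l + 2), d (f j) (f (j + 1)) :=
    Finset.sum_Ico_consecutive _ (by omega) (by omega)
  have e2 : ∑ j ∈ Finset.Ico (m + i + 1) (m + l + 2), d (f j) (f (j + 1)) =
      d (f (m + i + 1)) (f (m + i + 2)) +
      ∑ j ∈ Finset.Ico (m + i + 2) (m + l + 2), d (f j) (f (j + 1)) :=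
    Finset.sum_eq_sum_Ico_succ_bot (by omega) _
  linarith

theorem frink_chain {d : X → X → ℝ} (h0 : ∀ x y, 0 ≤ d x y) (hself : ∀ x, d x x = 0)
    (h2 : ∀ x y z, d x y ≤ 2 * max (d x z) (d z y)) (f : ℕ → X) (n : ℕ) :
    d (f 0) (f n) ≤ 4 * ∑ i ∈ Finset.range n, d (f i) (f (i + 1)) := by
  match n with
  | 0 => simp [hself]
  | 1 =>
    have := h0 (f 0) (f 1)
    simp only [Finset.sum_range_one, zero_add]
    linarith
  | l + 2 =>
    have h := frink_chain_aux h0 h2 f l 0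
    have h3 := h0 (f 0) (f 1)
    have h4 := h0 (f (l + 1)) (f (l + 2))
    rw [Finset.range_eq_Ico]
    simp only [zero_add] at h
    linarith

/-- If `d x y ≤ 2 * max (d x z) (d z y)`, the infimum of the sums of `d` along chains starting at
`z` is a function that is comparable to `d z` and whose increments are bounded by `d`. -/
theorem exists_chain_gauge {d : X → X → ℝ} (h0 : ∀ x y, 0 ≤ d x y) (hself : ∀ x, d x x = 0)
    (h2 : ∀ x y z, d x y ≤ 2 * max (d x z) (d z y)) (z : X) :
    ∃ h : X → ℝ, (∀ y, h y ≤ d z y) ∧ (∀ y, d z y ≤ 4 * h y) ∧ ∀ y w, h y ≤ h w + d w y := by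
  let S : X → Set ℝ := fun y => {t | ∃ (n : ℕ) (f : ℕ → X), f 0 = z ∧ f n = y ∧
    t = ∑ i ∈ Finset.range n, d (f i) (f (i + 1))}
  have hmem : ∀ y, d z y ∈ S y := fun y =>
    ⟨1, fun i => if i = 0 then z else y, by simp, by simp, by simp⟩
  have hbdd : ∀ y, BddBelow (S y) := by
    intro y
    refine ⟨0, ?_⟩
    rintro t ⟨n, f, -, -, rfl⟩
    exact Finset.sum_nonneg fun i _ => h0 _ _
  refine ⟨fun y => sInf (S y), fun y => csInf_le (hbdd y) (hmem y), fun y => ?_, fun y w => ?_⟩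
  · have : d z y / 4 ≤ sInf (S y) := by
      refine le_csInf ⟨_, hmem y⟩ ?_
      rintro t ⟨n, f, rfl, rfl, rfl⟩
      have := frink_chain h0 hself h2 f n
      linarith
    linarith
  · rw [← sub_le_iff_le_add]
    refine le_csInf ⟨_, hmem w⟩ ?_
    rintro t ⟨n, f, hf0, hfn, rfl⟩
    rw [sub_le_iff_le_add]
    refine csInf_le (hbdd y) ⟨n + 1, fun i => if i ≤ n then f i else y, by simp [hf0], by simp, ?_⟩
    rw [Finset.sum_range_succ]
    congr 1
    · refine Finset.sum_congr rfl fun i hi => ?_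
      have := Finset.mem_range.1 hi
      simp [show i ≤ n by omega, show i + 1 ≤ n by omega]
    · simp [hfn]

/-- The condition `s ⪯_q ind (X, ρ)` yields an equivalent quasi-metric `ϱ` and an exponent `α ≥ s`
such that `ϱ ^ α` satisfies the quasi-ultrametric inequality with constant `2`; the exponent is
strictly above `s` unless `q = ∞`. -/
theorem PrecIndex.exists_exponent {ρ : X → X → ℝ} {q : ℝ≥0∞} {s : ℝ} (hs : 0 < s)
    (h : PrecIndex ρ q s) :
    ∃ (α : ℝ) (ϱ : X → X → ℝ), s ≤ α ∧ (s = α → q = ∞) ∧ IsQuasiMetric ϱ ∧ QEquiv ϱ ρ ∧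
      quasiConst ϱ ≤ 2 ^ (1 / α) := by
  have hs' : 0 < 1 / s := by positivity
  have hof : (ENNReal.ofReal s)⁻¹ = ENNReal.ofReal (1 / s) := by
    rw [one_div, ENNReal.ofReal_inv_of_pos hs]
  have key : ∀ (ϱ : X → X → ℝ) (t : ℝ), Real.logb 2 (quasiConst ϱ) ≤ t →
      quasiConst ϱ ≤ 2 ^ t := by
    intro ϱ t ht
    rcases le_or_gt (quasiConst ϱ) 0 with h0 | h0
    · exact h0.trans (by positivity)
    · exact (Real.logb_le_iff_le_rpow (by norm_num) h0).1 ht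
  rcases h.1.lt_or_eq with hlt | heq
  · obtain ⟨ϱ, hϱ⟩ := lt_iSup_iff.1 hlt
    obtain ⟨⟨hϱ1, hϱ2⟩, hϱ⟩ := lt_iSup_iff.1 hϱ
    have h1 : ENNReal.ofReal (Real.logb 2 (quasiConst ϱ)) < ENNReal.ofReal (1 / s) := by
      rw [← hof]
      exact ENNReal.lt_inv_iff_lt_inv.1 hϱ
    have h2 : Real.logb 2 (quasiConst ϱ) < 1 / s := (ENNReal.ofReal_lt_ofReal_iff hs').1 h1
    obtain ⟨t, ht1, ht2⟩ := exists_between (max_lt h2 hs')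
    have ht0 : 0 < t := (le_max_right _ _).trans_lt ht1
    have hst : s < 1 / t := by
      rw [lt_div_iff₀ ht0]
      rwa [lt_div_iff₀ hs, mul_comm] at ht2
    refine ⟨1 / t, ϱ, hst.le, fun h => absurd h hst.ne, hϱ1, hϱ2, ?_⟩
    rw [one_div_one_div]
    exact key ϱ t ((le_max_left _ _).trans ht1.le)
  · obtain ⟨hq, ϱ, hϱ1, hϱ2, hϱ⟩ := h.2 heq
    refine ⟨s, ϱ, le_rfl, fun _ => hq, hϱ1, hϱ2, key ϱ _ ?_⟩
    rw [← heq, smoothExp, ← inv_inj, inv_inv, hof] at hϱ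
    exact (ENNReal.ofReal_le_ofReal_iff hs'.le).1 hϱ.le

/-- Around every point there is a function comparable to a power `ρ ^ α` of the distance to that
point which is Hölder continuous of the same order `α`. -/
theorem PrecIndex.exists_gauge {ρ : X → X → ℝ} (hρ : IsQuasiMetric ρ) {q : ℝ≥0∞} {s : ℝ}
    (hs : 0 < s) (h : PrecIndex ρ q s) :
    ∃ α c : ℝ, s ≤ α ∧ (s = α → q = ∞) ∧ 1 ≤ c ∧ ∀ z, ∃ h : X → ℝ,
      (∀ y, h y ≤ c * ρ z y ^ α) ∧ (∀ y, ρ z y ^ α ≤ c * h y) ∧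
      ∀ y w, |h y - h w| ≤ c * ρ y w ^ α := by
  obtain ⟨α, ϱ, hsα, hq, hϱ, ⟨b, hb, hbϱ⟩, hC⟩ := h.exists_exponent hs
  obtain ⟨K, hK1, hK, -⟩ := hρ.exists_const
  have hα : 0 < α := hs.trans_le hsα
  have h0 : ∀ x y, 0 ≤ ϱ x y ^ α := fun x y => Real.rpow_nonneg (hϱ.nonneg _ _) _
  have h2 : ∀ x y z, ϱ x y ^ α ≤ 2 * max (ϱ x z ^ α) (ϱ z y ^ α) := by
    intro x y z
    have hm : 0 ≤ max (ϱ x z) (ϱ z y) := (hϱ.nonneg _ _).trans (le_max_left _ _)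
    have h1 : ϱ x y ≤ 2 ^ (1 / α) * max (ϱ x z) (ϱ z y) :=
      (hϱ.le_quasiConst_mul x y z).trans (mul_le_mul_of_nonneg_right hC hm)
    calc ϱ x y ^ α ≤ (2 ^ (1 / α) * max (ϱ x z) (ϱ z y)) ^ α :=
          Real.rpow_le_rpow (hϱ.nonneg _ _) h1 hα.le
      _ = 2 * max (ϱ x z) (ϱ z y) ^ α := by
          rw [Real.mul_rpow (by positivity) hm, ← Real.rpow_mul (by norm_num),
            one_div_mul_cancel hα.ne', Real.rpow_one]
      _ ≤ 2 * max (ϱ x z ^ α) (ϱ z y ^ α) := by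
          rcases le_total (ϱ x z) (ϱ z y) with h | h
          · rw [max_eq_right h]; gcongr; exact le_max_right _ _
          · rw [max_eq_left h]; gcongr; exact le_max_left _ _
  set a := max b 1 with ha
  have ha1 : 1 ≤ a := le_max_right _ _
  have ha0 : 0 < a := by positivity
  have h3 : ∀ x y, ϱ x y ≤ a * ρ x y := by
    intro x y
    have := (hbϱ x y).1
    rw [inv_mul_le_iff₀ hb] at this
    exact this.trans (mul_le_mul_of_nonneg_right (le_max_left _ _) (hρ.nonneg _ _))
  have h4 : ∀ x y, ρ x y ≤ a * ϱ x y := fun x y =>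
    (hbϱ x y).2.trans (mul_le_mul_of_nonneg_right (le_max_left _ _) (hϱ.nonneg _ _))
  have h5 : 1 ≤ a ^ α := Real.one_le_rpow ha1 hα.le
  have h6 : 1 ≤ K ^ α := Real.one_le_rpow hK1 hα.le
  have h7 : a ^ α ≤ a ^ α * K ^ α := le_mul_of_one_le_right (by positivity) h6
  have h3' : ∀ x y, ϱ x y ^ α ≤ a ^ α * ρ x y ^ α := fun x y => by
    rw [← Real.mul_rpow ha0.le (hρ.nonneg _ _)]
    exact Real.rpow_le_rpow (hϱ.nonneg _ _) (h3 x y) hα.le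
  have h4' : ∀ x y, ρ x y ^ α ≤ a ^ α * ϱ x y ^ α := fun x y => by
    rw [← Real.mul_rpow ha0.le (hϱ.nonneg _ _)]
    exact Real.rpow_le_rpow (hρ.nonneg _ _) (h4 x y) hα.le
  have hK' : ∀ x y, ρ y x ^ α ≤ K ^ α * ρ x y ^ α := fun x y => by
    rw [← Real.mul_rpow (by positivity) (hρ.nonneg _ _)]
    exact Real.rpow_le_rpow (hρ.nonneg _ _) (hK x y) hα.le
  have hρ0 : ∀ x y, 0 ≤ ρ x y ^ α := fun x y => Real.rpow_nonneg (hρ.nonneg _ _) _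
  refine ⟨α, 4 * (a ^ α * K ^ α), hsα, hq, by nlinarith, fun z => ?_⟩
  obtain ⟨h, hh1, hh2, hh3⟩ := exists_chain_gauge h0
    (fun x => by rw [hϱ.self, Real.zero_rpow hα.ne']) h2 z
  refine ⟨h, fun y => ?_, fun y => ?_, fun y w => ?_⟩
  · have := mul_le_mul_of_nonneg_right (h7.trans (by nlinarith : _ ≤ 4 * (a ^ α * K ^ α)))
      (hρ0 z y)
    exact (hh1 y).trans ((h3' z y).trans this)
  · have hy : 0 ≤ h y := by linarith [hh2 y, h0 z y]
    have h8 : a ^ α * h y ≤ a ^ α * K ^ α * h y := mul_le_mul_of_nonneg_right h7 hy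
    nlinarith [h4' z y, hh2 y, mul_le_mul_of_nonneg_left (hh2 y) (by positivity : 0 ≤ a ^ α)]
  · have h8 : ϱ y w ^ α ≤ a ^ α * K ^ α * ρ y w ^ α :=
      (h3' y w).trans (mul_le_mul_of_nonneg_right h7 (hρ0 _ _))
    have h9 : ϱ w y ^ α ≤ a ^ α * K ^ α * ρ y w ^ α := by
      calc ϱ w y ^ α ≤ a ^ α * ρ w y ^ α := h3' w y
        _ ≤ a ^ α * (K ^ α * ρ y w ^ α) := by gcongr; exact hK' y w
        _ = _ := by ring
    have h10 : 0 ≤ a ^ α * K ^ α * ρ y w ^ α := by have := hρ0 y w; positivity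
    rw [abs_le]
    constructor <;> linarith [hh3 y w, hh3 w y]

/-! ### Geometry of uniformly perfect spaces -/

/-- In a uniformly perfect space all balls of radius at most the diameter contain a point whose
distance to the centre is comparable to the radius. -/
theorem UniformlyPerfect.exists_mem_annulus {ρ : X → X → ℝ} (hρ : IsQuasiMetric ρ)
    (hup : UniformlyPerfect ρ) :
    ∃ c : ℝ, 0 < c ∧ ∀ (x : X) (r : ℝ), 0 < r → ENNReal.ofReal r ≤ qdiam ρ →
      ∃ y, c * r ≤ ρ x y ∧ ρ x y < r := by
  obtain ⟨lam, hl0, hl1, hl⟩ := hup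
  obtain ⟨K, hK1, hK, hK'⟩ := hρ.exists_const
  have hK0 : 0 < K := by positivity
  refine ⟨lam * (1 / (2 * K ^ 2)), by positivity, fun x r hr hrd => ?_⟩
  have h1 : ENNReal.ofReal (r / 2) < qdiam ρ :=
    lt_of_lt_of_le ((ENNReal.ofReal_lt_ofReal_iff hr).2 (half_lt_self hr)) hrd
  obtain ⟨y, hy⟩ := lt_iSup_iff.1 h1
  obtain ⟨z, hyz⟩ := lt_iSup_iff.1 hy
  have hyz : r / 2 < ρ y z := (ENNReal.ofReal_lt_ofReal_iff_of_nonneg (by positivity)).1 hyz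
  set t := 1 / (2 * K ^ 2) * r with ht
  have ht0 : 0 < t := by positivity
  have htr : t ≤ r := by
    rw [ht]
    refine mul_le_of_le_one_left hr.le ?_
    rw [div_le_one (by positivity)]
    nlinarith
  have hne : (univ \ qball ρ x t).Nonempty := by
    by_contra hcon
    have hall : ∀ w, ρ x w < t := by
      intro w
      by_contra hw
      exact hcon ⟨w, mem_univ _, hw⟩
    have h2 : ρ y x ≤ K * t := (hK x y).trans (mul_le_mul_of_nonneg_left (hall y).le hK0.le)
    have h3 : max (ρ y x) (ρ x z) ≤ K * t :=
      max_le h2 ((hall z).le.trans (le_mul_of_one_le_left ht0.le hK1))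
    have h4 : ρ y z ≤ K * (K * t) := (hK' y z x).trans (mul_le_mul_of_nonneg_left h3 hK0.le)
    have h5 : K * (K * t) = r / 2 := by rw [ht]; field_simp
    linarith
  obtain ⟨y, hy1, hy2⟩ := hl x t ht0 hne
  exact ⟨y, by have := not_lt.1 (show ¬ ρ x y < lam * t from hy2); rw [ht] at this; linarith,
    lt_of_lt_of_le hy1 htr⟩

theorem measurable_of_holder [MeasurableSpace X] {ρ : X → X → ℝ} (hρ : IsQuasiMetric ρ)
    (hborel : @borel X (qtopology ρ) ≤ ‹MeasurableSpace X›) {h : X → ℝ} {α c : ℝ} (hα : 0 < α)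
    (hc : 0 < c) (hh : ∀ y w, |h y - h w| ≤ c * ρ y w ^ α) : Measurable h := by
  refine measurable_of_Iio fun a => hborel _ ?_
  refine @MeasurableSpace.measurableSet_generateFrom X _ _ ?_
  intro y hy
  have hy : h y < a := hy
  have hpos : 0 < (a - h y) / c := div_pos (sub_pos.2 hy) hc
  refine ⟨((a - h y) / c) ^ (1 / α), by positivity, fun w hw => ?_⟩
  have hw : ρ y w < ((a - h y) / c) ^ (1 / α) := hw
  have h1 : ρ y w ^ α < (a - h y) / c := by
    calc ρ y w ^ α < (((a - h y) / c) ^ (1 / α)) ^ α :=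
          Real.rpow_lt_rpow (hρ.nonneg _ _) hw hα
      _ = (a - h y) / c := by
          rw [← Real.rpow_mul hpos.le, one_div_mul_cancel hα.ne', Real.rpow_one]
  have h2 : c * ρ y w ^ α < a - h y := by
    rw [lt_div_iff₀ hc] at h1; linarith
  have h3 := (abs_le.1 (hh y w)).1
  show h w < a
  linarith

/-- Every ball `B` of radius `r` at most the diameter carries a normalised Hölder gauge `h` whose
unit sublevel set lies in `B` and has at most the measure of its complement in `B`. Uniform
perfectness provides two disjoint balls in `B` of radii comparable to `r`, and `h` is centred in
the one on which the sublevel set has the smaller measure. -/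
theorem exists_bump_gauge [MeasurableSpace X] {ρ : X → X → ℝ} {μ : Measure X}
    (hX : IsQuasiMetricMeasureSpace ρ μ) (hup : UniformlyPerfect ρ) {q : ℝ≥0∞} {s : ℝ}
    (hs : 0 < s) (hind : PrecIndex ρ q s) :
    ∃ α c : ℝ, s ≤ α ∧ (s = α → q = ∞) ∧ 0 < c ∧
      ∀ (x : X) (r : ℝ), 0 < r → ENNReal.ofReal r ≤ qdiam ρ → ∃ h : X → ℝ, Measurable h ∧
        (∀ y w, |h y - h w| ≤ c * r ^ (-α) * ρ y w ^ α) ∧ {y | h y < 1} ⊆ qball ρ x r ∧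
        0 < μ {y | h y < 1 / 2} ∧ μ {y | h y < 1} ≤ μ (qball ρ x r \ {y | h y < 1}) := by
  have hρ := hX.quasiMetric
  obtain ⟨α, c, hsα, hq, hc1, hg⟩ := hind.exists_gauge hρ hs
  obtain ⟨a, ha0, ha⟩ := hup.exists_mem_annulus hρ
  obtain ⟨K, hK1, hK, hK'⟩ := hρ.exists_const
  have hK0 : 0 < K := by positivity
  have hα : 0 < α := hs.trans_le hsα
  have hc0 : 0 < c := by positivity
  -- balls of radius `ε r` around `x` and a point `y` with `a r / K ≤ ρ x y < r / K` are disjoint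
  -- and contained in `B(x, r)`
  set ε := min a 1 / K ^ 3 with hε
  have hε0 : 0 < ε := by positivity
  have hK3 : K ≤ K ^ 3 := le_self_pow₀ hK1 (by norm_num)
  have hεK : ε ≤ 1 / K := by
    rw [hε]
    exact div_le_div₀ (by norm_num) (min_le_right _ _) hK0 hK3
  have hε1 : ε ≤ 1 := hεK.trans (by rw [div_le_one hK0]; exact hK1)
  refine ⟨α, c ^ 2 * ε ^ (-α), hsα, hq, by positivity, fun x r hr hrd => ?_⟩
  have hgauge : ∀ z, ∃ h : X → ℝ, Measurable h ∧
      (∀ y w, |h y - h w| ≤ c ^ 2 * ε ^ (-α) * r ^ (-α) * ρ y w ^ α) ∧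
      {y | h y < 1} ⊆ qball ρ z (ε * r) ∧ 0 < μ {y | h y < 1 / 2} := by
    intro z
    obtain ⟨h, h1, h2, h3⟩ := hg z
    set τ := (ε * r) ^ α / c with hτ
    have hτ0 : 0 < τ := by positivity
    have hLip : ∀ y w, |h y / τ - h w / τ| ≤ c ^ 2 * ε ^ (-α) * r ^ (-α) * ρ y w ^ α := by
      intro y w
      rw [← sub_div, abs_div, abs_of_pos hτ0, div_le_iff₀ hτ0]
      refine (h3 y w).trans (le_of_eq ?_)
      rw [hτ, Real.mul_rpow hε0.le hr.le, Real.rpow_neg hε0.le, Real.rpow_neg hr.le]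
      field_simp
    refine ⟨fun y => h y / τ, measurable_of_holder hρ hX.borel_le hα
      (by positivity : 0 < c ^ 2 * ε ^ (-α) * r ^ (-α)) hLip, hLip, fun y hy => ?_, ?_⟩
    · have hy : h y < τ := by
        have : h y / τ < 1 := hy
        rwa [div_lt_one hτ0] at this
      have h4 : ρ z y ^ α < (ε * r) ^ α := by
        calc ρ z y ^ α ≤ c * h y := h2 y
          _ < c * τ := by gcongr
          _ = _ := by rw [hτ]; field_simp
      exact (Real.rpow_lt_rpow_iff (hρ.nonneg _ _) (by positivity) hα).1 h4
    · have ht : 0 < τ / (2 * c) := by positivity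
      refine (hX.ball_pos z ((τ / (2 * c)) ^ (1 / α)) (by positivity)).trans_le
        (measure_mono fun y hy => ?_)
      have h4 : ρ z y ^ α < τ / (2 * c) := by
        calc ρ z y ^ α < ((τ / (2 * c)) ^ (1 / α)) ^ α :=
              Real.rpow_lt_rpow (hρ.nonneg _ _) hy hα
          _ = τ / (2 * c) := by
              rw [← Real.rpow_mul ht.le, one_div_mul_cancel hα.ne', Real.rpow_one]
      show h y / τ < 1 / 2
      rw [div_lt_iff₀ hτ0]
      rw [lt_div_iff₀ (by positivity)] at h4
      nlinarith [h1 y]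
  have hrK : 0 < r / K := by positivity
  obtain ⟨y, hy1, hy2⟩ := ha x (r / K) hrK
    ((ENNReal.ofReal_le_ofReal (div_le_self hr.le hK1)).trans hrd)
  obtain ⟨hx, hx1, hx2, hx3, hx4⟩ := hgauge x
  obtain ⟨h', hy1', hy2', hy3', hy4'⟩ := hgauge y
  have hεr : ε * r ≤ r / K := by
    calc ε * r ≤ 1 / K * r := by gcongr
      _ = r / K := by ring
  have hsubx : {w | hx w < 1} ⊆ qball ρ x r := fun w hw =>
    lt_of_lt_of_le (hx3 hw) (mul_le_of_le_one_left hr.le hε1)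
  have hsuby : {w | h' w < 1} ⊆ qball ρ x r := fun w hw => by
    have h1 : ρ y w < r / K := (hy3' hw).trans_le hεr
    calc ρ x w ≤ K * max (ρ x y) (ρ y w) := hK' x w y
      _ < K * (r / K) := by gcongr; exact max_lt hy2 h1
      _ = r := by field_simp
  have hdisj : ∀ w, hx w < 1 → h' w < 1 → False := by
    intro w hw hw'
    have h1 : ρ x w < ε * r := hx3 hw
    have h2 : ρ y w < ε * r := hy3' hw'
    have h3 : ρ w y < K * (ε * r) := (hK y w).trans_lt (by gcongr)
    have h4 : ρ x y < K * (K * (ε * r)) := by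
      refine (hK' x y w).trans_lt ?_
      gcongr
      refine max_lt (h1.trans_le (le_mul_of_one_le_left (by positivity) hK1)) h3
    have h5 : K * (K * (ε * r)) = min a 1 * (r / K) := by rw [hε]; field_simp
    have h6 : min a 1 * (r / K) ≤ a * (r / K) := by gcongr; exact min_le_left _ _
    linarith
  rcases le_total (μ {w | hx w < 1}) (μ {w | h' w < 1}) with hle | hle
  · exact ⟨hx, hx1, hx2, hsubx, hx4, hle.trans
      (measure_mono fun w hw => ⟨hsuby hw, fun hw' => hdisj w hw' hw⟩)⟩
  · exact ⟨h', hy1', hy2', hsuby, hy4', hle.trans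
      (measure_mono fun w hw => ⟨hsubx hw, fun hw' => hdisj w hw hw'⟩)⟩

/-! ### The sequence norm -/

theorem le_lqNorm {q : ℝ≥0∞} (hq : 0 < q) (a : ℤ → ℝ≥0∞) (k : ℤ) : a k ≤ lqNorm q a := by
  unfold lqNorm
  split_ifs with h
  · exact le_iSup a k
  · have hq' : 0 < q.toReal := ENNReal.toReal_pos hq.ne' h
    rw [one_div, ENNReal.le_rpow_inv_iff hq']
    exact ENNReal.le_tsum k

theorem lqNorm_mono {q : ℝ≥0∞} {a b : ℤ → ℝ≥0∞} (h : ∀ k, a k ≤ b k) :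
    lqNorm q a ≤ lqNorm q b := by
  unfold lqNorm
  split_ifs
  · exact iSup_mono h
  · exact ENNReal.rpow_le_rpow (ENNReal.tsum_le_tsum fun k =>
      ENNReal.rpow_le_rpow (h k) ENNReal.toReal_nonneg) (by positivity)

theorem lqNorm_mul_left {q : ℝ≥0∞} (hq : 0 < q) (c : ℝ≥0∞) (a : ℤ → ℝ≥0∞) :
    lqNorm q (fun k => c * a k) = c * lqNorm q a := by
  unfold lqNorm
  split_ifs with h
  · exact (ENNReal.mul_iSup c a).symm
  · have hq' : 0 < q.toReal := ENNReal.toReal_pos hq.ne' h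
    simp_rw [ENNReal.mul_rpow_of_nonneg _ _ hq'.le]
    rw [ENNReal.tsum_mul_left, ENNReal.mul_rpow_of_nonneg _ _ (by positivity), ← ENNReal.rpow_mul,
      mul_one_div_cancel hq'.ne', ENNReal.rpow_one]

theorem lqNorm_shift {q : ℝ≥0∞} (a : ℤ → ℝ≥0∞) (m : ℤ) :
    lqNorm q (fun k => a (k - m)) = lqNorm q a := by
  unfold lqNorm
  split_ifs with h
  · exact (Equiv.subRight m).iSup_comp (g := a)
  · congr 1
    exact (Equiv.subRight m).tsum_eq (fun k => a k ^ q.toReal)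

/-- The inclusion of `ℓ^q` into `ℓ^p` for `q ≤ p`. -/
theorem tsum_rpow_le_lqNorm {q : ℝ≥0∞} (hq : 0 < q) {p : ℝ} (hqp : q ≤ ENNReal.ofReal p)
    (b : ℤ → ℝ≥0∞) : ∑' k, b k ^ p ≤ lqNorm q b ^ p := by
  have hqt : q ≠ ∞ := (hqp.trans_lt ENNReal.ofReal_lt_top).ne
  have hq' : 0 < q.toReal := ENNReal.toReal_pos hq.ne' hqt
  have hqp' : q.toReal ≤ p := by
    rcases le_or_gt p 0 with h | h
    · rw [ENNReal.ofReal_eq_zero.2 h] at hqp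
      exact absurd hqp hq.not_ge
    · exact ENNReal.toReal_le_of_le_ofReal h.le hqp
  have hterm : ∀ k, b k ^ p ≤ b k ^ q.toReal * lqNorm q b ^ (p - q.toReal) := by
    intro k
    calc b k ^ p = b k ^ q.toReal * b k ^ (p - q.toReal) := by
          rw [← ENNReal.rpow_add_of_nonneg _ _ hq'.le (sub_nonneg.2 hqp')]
          congr 1; ring
      _ ≤ _ := by gcongr; exact le_lqNorm hq b k
  refine (ENNReal.tsum_le_tsum hterm).trans (le_of_eq ?_)
  rw [ENNReal.tsum_mul_right]
  have : ∑' k, b k ^ q.toReal = lqNorm q b ^ q.toReal := by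
    rw [lqNorm, if_neg hqt, ← ENNReal.rpow_mul, one_div_mul_cancel hq'.ne', ENNReal.rpow_one]
  rw [this, ← ENNReal.rpow_add_of_nonneg _ _ hq'.le (sub_nonneg.2 hqp')]
  congr 1; ring

theorem lqNorm_geometric_lt_top {q : ℝ≥0∞} (hq : 0 < q) {m : ℝ} (hm : 0 ≤ m)
    (hmq : m = 0 → q = ∞) :
    lqNorm q (fun k : ℤ => ENNReal.ofReal (2 ^ (-(m * |(k : ℝ)|)))) < ∞ := by
  unfold lqNorm
  split_ifs with h
  · refine lt_of_le_of_lt (iSup_le fun k => ?_) ENNReal.one_lt_top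
    rw [← ENNReal.ofReal_one]
    refine ENNReal.ofReal_le_ofReal (Real.rpow_le_one_of_one_le_of_nonpos (by norm_num) ?_)
    have := abs_nonneg (k : ℝ)
    nlinarith
  · have hq' : 0 < q.toReal := ENNReal.toReal_pos hq.ne' h
    have hm' : 0 < m := lt_of_le_of_ne hm fun h0 => h (hmq h0.symm)
    refine ENNReal.rpow_lt_top_of_nonneg (by positivity) ?_
    set β : ℝ := 2 ^ (-(m * q.toReal)) with hβ
    have hβ0 : 0 ≤ β := by positivity
    have hβ1 : β < 1 := Real.rpow_lt_one_of_one_lt_of_neg (by norm_num)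
      (neg_neg_of_pos (mul_pos hm' hq'))
    have hpow : ∀ n : ℕ, (ENNReal.ofReal ((2 : ℝ) ^ (-(m * n)))) ^ q.toReal =
        ENNReal.ofReal (β ^ n) := by
      intro n
      rw [ENNReal.ofReal_rpow_of_pos (by positivity), ← Real.rpow_mul (by norm_num), hβ,
        ← Real.rpow_natCast, ← Real.rpow_mul (by norm_num)]
      congr 2; ring
    have hsum : Summable (fun k : ℤ => β ^ k.natAbs) := by
      refine Summable.of_nat_of_neg ?_ ?_
      · simpa using summable_geometric_of_lt_one hβ0 hβ1
      · simpa using summable_geometric_of_lt_one hβ0 hβ1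
    have heq : ∀ k : ℤ, (ENNReal.ofReal ((2 : ℝ) ^ (-(m * |(k : ℝ)|)))) ^ q.toReal =
        ENNReal.ofReal (β ^ k.natAbs) := by
      intro k
      rw [← hpow, Nat.cast_natAbs, Int.cast_abs]
    simp_rw [heq]
    rw [← ENNReal.ofReal_tsum_of_nonneg (fun k => by positivity) hsum]
    exact ENNReal.ofReal_ne_top

/-- The `ℓ^q` norm of the sequence `2 ^ ((k + 1) s) min {1, L 2 ^ (-kα)}`, which is a fractional
gradient of a function with oscillation at most `1` and `α`-Hölder constant `L`, up to its support.
The sequence decays geometrically away from the scale `2 ^ k = L ^ (1 / α)`. -/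
theorem exists_lqNorm_bump_le {q : ℝ≥0∞} (hq : 0 < q) {s α : ℝ} (hs : 0 < s) (hsα : s ≤ α)
    (hαq : s = α → q = ∞) :
    ∃ C : ℝ, 0 < C ∧ ∀ L : ℝ, 0 < L →
      lqNorm q (fun k : ℤ => ENNReal.ofReal
        (2 ^ (((k : ℝ) + 1) * s) * min 1 (L * 2 ^ (-((k : ℝ) * α))))) ≤
      ENNReal.ofReal (C * L ^ (s / α)) := by
  have hα : 0 < α := hs.trans_le hsα
  set m := min s (α - s) with hm
  have hm0 : 0 ≤ m := le_min hs.le (sub_nonneg.2 hsα)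
  have hms : m ≤ s := min_le_left _ _
  have hmα : m ≤ α - s := min_le_right _ _
  have hlt := lqNorm_geometric_lt_top hq hm0 (fun h0 => hαq (by
    rcases min_choice s (α - s) with h | h <;> rw [hm, h] at h0 <;> linarith))
  set S := lqNorm q (fun k : ℤ => ENNReal.ofReal (2 ^ (-(m * |(k : ℝ)|)))) with hS
  refine ⟨2 ^ (s + α) * (S.toReal + 1), by positivity, fun L hL => ?_⟩
  set Λ := Real.logb 2 L / α with hΛ
  have hL2 : L = 2 ^ (α * Λ) := by
    rw [hΛ, mul_div_cancel₀ _ hα.ne', Real.rpow_logb (by norm_num) (by norm_num) hL]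
  have hLs : L ^ (s / α) = 2 ^ (Λ * s) := by
    rw [hL2, ← Real.rpow_mul (by norm_num)]
    congr 1; field_simp
  set n := ⌊Λ⌋ with hn
  have hn1 : (n : ℝ) ≤ Λ := Int.floor_le _
  have hn2 : Λ < n + 1 := Int.lt_floor_add_one _
  have hterm : ∀ k : ℤ, ENNReal.ofReal
      (2 ^ (((k : ℝ) + 1) * s) * min 1 (L * 2 ^ (-((k : ℝ) * α)))) ≤
      ENNReal.ofReal (2 ^ (s + α) * 2 ^ (Λ * s)) *
        ENNReal.ofReal (2 ^ (-(m * |((k - n : ℤ) : ℝ)|))) := by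
    intro k
    rw [← ENNReal.ofReal_mul (by positivity), ← Real.rpow_add (by norm_num),
      ← Real.rpow_add (by norm_num)]
    refine ENNReal.ofReal_le_ofReal ?_
    rcases le_or_gt k n with hk | hk
    · have hk' : (k : ℝ) ≤ n := by exact_mod_cast hk
      have habs : |((k - n : ℤ) : ℝ)| = n - k := by
        push_cast; rw [abs_of_nonpos (by linarith)]; ring
      refine (mul_le_of_le_one_right (by positivity) (min_le_left _ _)).trans ?_
      rw [habs]
      refine Real.rpow_le_rpow_of_exponent_le (by norm_num) ?_
      nlinarith
    · have hk' : (n : ℝ) + 1 ≤ k := by exact_mod_cast hk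
      have habs : |((k - n : ℤ) : ℝ)| = k - n := by
        push_cast; rw [abs_of_nonneg (by linarith)]
      refine (mul_le_mul_of_nonneg_left (min_le_right _ _) (by positivity)).trans ?_
      rw [habs, hL2, ← Real.rpow_add (by norm_num), ← Real.rpow_add (by norm_num)]
      refine Real.rpow_le_rpow_of_exponent_le (by norm_num) ?_
      nlinarith
  refine (lqNorm_mono hterm).trans ?_
  rw [lqNorm_mul_left hq, lqNorm_shift (fun k : ℤ => ENNReal.ofReal (2 ^ (-(m * |(k : ℝ)|)))),
    ← hS, ← ENNReal.ofReal_toReal hlt.ne, ← ENNReal.ofReal_mul (by positivity), hLs]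
  refine ENNReal.ofReal_le_ofReal ?_
  have : (0 : ℝ) < 2 ^ (s + α) * 2 ^ (Λ * s) := by positivity
  rw [ENNReal.toReal_ofReal ENNReal.toReal_nonneg]
  nlinarith

/-! ### The two properties of the seminorms that the embeddings depend on -/

variable [MeasurableSpace X]

/-- `g` is a (finite-valued) Hajłasz `s`-gradient of `u` on `E`: the pointwise inequality is not
restricted to a dyadic range of distances. -/
def IsHajlaszGradient (ρ : X → X → ℝ) (μ : Measure X) (s : ℝ) (E : Set X) (u g : X → ℝ) : Prop :=
  (∀ x, 0 ≤ g x) ∧ AEMeasurable g (μ.restrict E) ∧ ∃ N : Set X, μ N = 0 ∧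
    ∀ x ∈ E \ N, ∀ y ∈ E \ N, |u x - u y| ≤ ρ x y ^ s * (g x + g y)

/-- The seminorm `F` controls the `L^p` norm of some Hajłasz `s`-gradient; that is, the space of `F`
embeds into the Hajłasz–Sobolev space `Ṁ^{s,p}`. -/
def ControlsGradient (ρ : X → X → ℝ) (μ : Measure X) (s p : ℝ)
    (F : Set X → (X → ℝ) → ℝ≥0∞) : Prop :=
  ∀ (E : Set X) (u : X → ℝ) (G : ℝ), NullMeasurableSet E μ → 0 < G → F E u < ENNReal.ofReal G →
    ∃ g, IsHajlaszGradient ρ μ s E u g ∧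
      ∫⁻ x in E, ENNReal.ofReal (g x) ^ p ∂μ ≤ ENNReal.ofReal (G ^ p)

/-- The seminorm `F` is bounded on functions of oscillation at most `1`, of `α`-Hölder constant `L`
and supported in `A` by the value `L ^ (s / α) * μ A ^ (1 / p)` that scaling predicts. -/
def BoundsBumps (ρ : X → X → ℝ) (μ : Measure X) (s p α : ℝ)
    (F : Set X → (X → ℝ) → ℝ≥0∞) : Prop :=
  ∃ C : ℝ, 0 < C ∧ ∀ (E : Set X) (u : X → ℝ) (L : ℝ) (A : Set X), 0 < L → MeasurableSet A →
    (∀ y w, |u y - u w| ≤ 1) → (∀ y w, |u y - u w| ≤ L * ρ y w ^ α) → (∀ y, y ∉ A → u y = 0) →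
      F E u ≤ ENNReal.ofReal (C * L ^ (s / α)) * μ A ^ (1 / p)

theorem exists_hajlaszGradient {ρ : X → X → ℝ} (hρ : IsQuasiMetric ρ) {μ : Measure X} {s p G : ℝ}
    (hs : 0 < s) (hp : 0 < p) {E : Set X} (hE : NullMeasurableSet E μ) {u : X → ℝ}
    {g : ℤ → X → ℝ≥0∞} (hg : g ∈ fracGrad ρ μ s E u)
    (hG : ∫⁻ x in E, (⨆ k, g k x) ^ p ∂μ ≤ ENNReal.ofReal (G ^ p)) :
    ∃ f, IsHajlaszGradient ρ μ s E u f ∧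
      ∫⁻ x in E, ENNReal.ofReal (f x) ^ p ∂μ ≤ ENNReal.ofReal (G ^ p) := by
  obtain ⟨hgm, N, hN, hg⟩ := hg
  have hmeas : AEMeasurable (fun x => ⨆ k, g k x) (μ.restrict E) := AEMeasurable.iSup hgm
  have hfin : ∀ᵐ x ∂(μ.restrict E), (⨆ k, g k x) < ∞ := by
    have h1 := ae_lt_top' (hmeas.pow_const p) (hG.trans_lt ENNReal.ofReal_lt_top).ne
    filter_upwards [h1] with x hx
    exact (ENNReal.rpow_lt_top_iff_of_pos hp).1 hx
  refine ⟨fun x => (⨆ k, g k x).toReal, ⟨fun x => ENNReal.toReal_nonneg, hmeas.ennreal_toReal,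
    N ∪ {x | ¬ (x ∈ E → (⨆ k, g k x) < ∞)}, ?_, ?_⟩, ?_⟩
  · refine measure_union_null hN ?_
    exact (ae_restrict_iff'₀ hE).1 hfin
  · rintro x ⟨hxE, hxN⟩ y ⟨hyE, hyN⟩
    rw [mem_union, not_or] at hxN hyN
    have hx : (⨆ k, g k x) < ∞ := not_not.1 hxN.2 hxE
    have hy : (⨆ k, g k y) < ∞ := not_not.1 hyN.2 hyE
    by_cases hxy : x = y
    · subst hxy
      simp [hρ.self, Real.zero_rpow hs.ne']
    obtain ⟨n, hn⟩ := exists_mem_Ico_zpow (hρ.pos hxy) (by norm_num : (1 : ℝ) < 2)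
    have hk := hg (-n - 1) x ⟨hxE, hxN.1⟩ y ⟨hyE, hyN.1⟩
      (by rw [show -(-n - 1) - 1 = n by ring]; exact hn.1)
      (by rw [show -(-n - 1) = n + 1 by ring]; exact hn.2)
    have h2 : ENNReal.ofReal |u x - u y| ≤
        ENNReal.ofReal (ρ x y ^ s * ((⨆ k, g k x).toReal + (⨆ k, g k y).toReal)) := by
      refine hk.trans ?_
      rw [ENNReal.ofReal_mul (Real.rpow_nonneg (hρ.nonneg _ _) _),
        ENNReal.ofReal_add ENNReal.toReal_nonneg ENNReal.toReal_nonneg,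
        ENNReal.ofReal_toReal hx.ne, ENNReal.ofReal_toReal hy.ne]
      gcongr
      · exact le_iSup (fun k => g k x) _
      · exact le_iSup (fun k => g k y) _
    refine (ENNReal.ofReal_le_ofReal_iff ?_).1 h2
    exact mul_nonneg (Real.rpow_nonneg (hρ.nonneg _ _) _) (by positivity)
  · refine le_trans (lintegral_mono fun x => ?_) hG
    exact ENNReal.rpow_le_rpow ENNReal.ofReal_toReal_le hp.le

theorem lebNorm_rpow {μ : Measure X} {p : ℝ} (hp : 0 < p) (E : Set X) (f : X → ℝ≥0∞) :
    lebNorm μ p E f ^ p = ∫⁻ x in E, f x ^ p ∂μ := by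
  rw [lebNorm, ← ENNReal.rpow_mul, one_div_mul_cancel hp.ne', ENNReal.rpow_one]

theorem mNorm_controlsGradient {ρ : X → X → ℝ} (hρ : IsQuasiMetric ρ) (μ : Measure X) {s p : ℝ}
    (hs : 0 < s) (hp : 0 < p) {q : ℝ≥0∞} (hq : 0 < q) :
    ControlsGradient ρ μ s p (mNorm ρ μ s p q) := by
  intro E u G hE hG hF
  obtain ⟨g, hF⟩ := iInf_lt_iff.1 hF
  obtain ⟨hg, hF⟩ := iInf_lt_iff.1 hF
  refine exists_hajlaszGradient hρ hs hp hE hg ?_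
  calc ∫⁻ x in E, (⨆ k, g k x) ^ p ∂μ
      ≤ ∫⁻ x in E, lqNorm q (fun k => g k x) ^ p ∂μ := lintegral_mono fun x =>
        ENNReal.rpow_le_rpow (iSup_le fun k => le_lqNorm hq (fun k => g k x) k) hp.le
    _ = lebNorm μ p E (fun x => lqNorm q fun k => g k x) ^ p := (lebNorm_rpow hp _ _).symm
    _ ≤ ENNReal.ofReal G ^ p := ENNReal.rpow_le_rpow hF.le hp.le
    _ = ENNReal.ofReal (G ^ p) := ENNReal.ofReal_rpow_of_pos hG

theorem nNorm_controlsGradient {ρ : X → X → ℝ} (hρ : IsQuasiMetric ρ) (μ : Measure X) {s p : ℝ}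
    (hs : 0 < s) (hp : 0 < p) {q : ℝ≥0∞} (hq : 0 < q) (hqp : q ≤ ENNReal.ofReal p) :
    ControlsGradient ρ μ s p (nNorm ρ μ s p q) := by
  intro E u G hE hG hF
  obtain ⟨g, hF⟩ := iInf_lt_iff.1 hF
  obtain ⟨hg, hF⟩ := iInf_lt_iff.1 hF
  refine exists_hajlaszGradient hρ hs hp hE hg ?_
  have hsup : ∀ x, (⨆ k, g k x) ^ p ≤ ∑' k, g k x ^ p := by
    intro x
    rw [← ENNReal.le_rpow_inv_iff hp]
    refine iSup_le fun k => ?_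
    rw [ENNReal.le_rpow_inv_iff hp]
    exact ENNReal.le_tsum k
  calc ∫⁻ x in E, (⨆ k, g k x) ^ p ∂μ
      ≤ ∫⁻ x in E, ∑' k, g k x ^ p ∂μ := lintegral_mono hsup
    _ = ∑' k, ∫⁻ x in E, g k x ^ p ∂μ := lintegral_tsum fun k => (hg.1 k).pow_const p
    _ = ∑' k, lebNorm μ p E (g k) ^ p := by simp_rw [lebNorm_rpow hp]
    _ ≤ lqNorm q (fun k => lebNorm μ p E (g k)) ^ p := tsum_rpow_le_lqNorm hq hqp _
    _ ≤ ENNReal.ofReal G ^ p := ENNReal.rpow_le_rpow hF.le hp.le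
    _ = ENNReal.ofReal (G ^ p) := ENNReal.ofReal_rpow_of_pos hG

theorem bump_mem_fracGrad {ρ : X → X → ℝ} (hρ : IsQuasiMetric ρ) (μ : Measure X) {s α L : ℝ}
    (hs : 0 < s) (hα : 0 < α) (hL : 0 < L) (E : Set X) {u : X → ℝ} {A : Set X}
    (hA : MeasurableSet A) (hu1 : ∀ y w, |u y - u w| ≤ 1)
    (huL : ∀ y w, |u y - u w| ≤ L * ρ y w ^ α) (hu0 : ∀ y, y ∉ A → u y = 0) :
    (fun (k : ℤ) x => ENNReal.ofReal (2 ^ (((k : ℝ) + 1) * s) *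
      min 1 (L * 2 ^ (-((k : ℝ) * α)))) * A.indicator 1 x) ∈ fracGrad ρ μ s E u := by
  refine ⟨fun k => ((measurable_one.indicator hA).const_mul _).aemeasurable, ∅, measure_empty, ?_⟩
  intro k x _ y _ hk1 hk2
  by_cases hxy : x ∉ A ∧ y ∉ A
  · simp [hu0 x hxy.1, hu0 y hxy.2]
  have hone : (1 : ℝ≥0∞) ≤ A.indicator 1 x + A.indicator 1 y := by
    by_cases hx : x ∈ A
    · simp [hx]
    · have hy : y ∈ A := by
        by_contra hy; exact hxy ⟨hx, hy⟩
      simp [hy]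
  rw [← mul_add, ← mul_assoc, ← ENNReal.ofReal_mul (Real.rpow_nonneg (hρ.nonneg _ _) _)]
  refine le_trans (ENNReal.ofReal_le_ofReal ?_) (le_mul_of_one_le_right' hone)
  have h1 : (2 : ℝ) ^ (-(((k : ℝ) + 1) * s)) ≤ ρ x y ^ s := by
    have : (2 : ℝ) ^ (-(((k : ℝ) + 1) * s)) = ((2 : ℝ) ^ (-k - 1)) ^ s := by
      rw [← Real.rpow_intCast, ← Real.rpow_mul (by norm_num)]
      congr 1; push_cast; ring
    rw [this]
    exact Real.rpow_le_rpow (by positivity) hk1 hs.le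
  have h2 : ρ x y ^ α ≤ 2 ^ (-((k : ℝ) * α)) := by
    have : (2 : ℝ) ^ (-((k : ℝ) * α)) = ((2 : ℝ) ^ (-k)) ^ α := by
      rw [← Real.rpow_intCast, ← Real.rpow_mul (by norm_num)]
      congr 1; push_cast; ring
    rw [this]
    exact Real.rpow_le_rpow (hρ.nonneg _ _) hk2.le hα.le
  have hmin0 : 0 ≤ min 1 (L * 2 ^ (-((k : ℝ) * α))) := by positivity
  calc |u x - u y| ≤ min 1 (L * 2 ^ (-((k : ℝ) * α))) :=
        le_min (hu1 x y) ((huL x y).trans (mul_le_mul_of_nonneg_left h2 hL.le))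
    _ = 2 ^ (-(((k : ℝ) + 1) * s)) * (2 ^ (((k : ℝ) + 1) * s) *
          min 1 (L * 2 ^ (-((k : ℝ) * α)))) := by
        rw [← mul_assoc, ← Real.rpow_add (by norm_num)]; simp
    _ ≤ ρ x y ^ s * (2 ^ (((k : ℝ) + 1) * s) * min 1 (L * 2 ^ (-((k : ℝ) * α)))) := by
        gcongr

theorem lebNorm_const_indicator_le (μ : Measure X) {p : ℝ} (hp : 0 < p) (E : Set X) {A : Set X}
    (hA : MeasurableSet A) (c : ℝ≥0∞) :
    lebNorm μ p E (fun x => c * A.indicator 1 x) ≤ c * μ A ^ (1 / p) := by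
  have h1 : ∀ x, (c * A.indicator (1 : X → ℝ≥0∞) x) ^ p = A.indicator (fun _ => c ^ p) x := by
    intro x
    by_cases hx : x ∈ A <;> simp [hx, hp]
  rw [lebNorm]
  simp_rw [h1]
  rw [lintegral_indicator_const hA, ENNReal.mul_rpow_of_nonneg _ _ (by positivity),
    ← ENNReal.rpow_mul, mul_one_div_cancel hp.ne', ENNReal.rpow_one]
  gcongr
  exact Measure.restrict_le_self

theorem mNorm_boundsBumps {ρ : X → X → ℝ} (hρ : IsQuasiMetric ρ) (μ : Measure X) {s p α : ℝ}
    (hs : 0 < s) (hp : 0 < p) {q : ℝ≥0∞} (hq : 0 < q) (hsα : s ≤ α) (hαq : s = α → q = ∞) :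
    BoundsBumps ρ μ s p α (mNorm ρ μ s p q) := by
  obtain ⟨C, hC, hCL⟩ := exists_lqNorm_bump_le hq hs hsα hαq
  refine ⟨C, hC, fun E u L A hL hA hu1 huL hu0 => ?_⟩
  refine (iInf₂_le _ (bump_mem_fracGrad hρ μ hs (hs.trans_le hsα) hL E hA hu1 huL hu0)).trans ?_
  simp_rw [mul_comm _ (A.indicator (1 : X → ℝ≥0∞) _)]
  simp_rw [lqNorm_mul_left hq]
  simp_rw [mul_comm (A.indicator (1 : X → ℝ≥0∞) _) _]
  refine (lebNorm_const_indicator_le μ hp E hA _).trans ?_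
  gcongr
  exact hCL L hL

theorem nNorm_boundsBumps {ρ : X → X → ℝ} (hρ : IsQuasiMetric ρ) (μ : Measure X) {s p α : ℝ}
    (hs : 0 < s) (hp : 0 < p) {q : ℝ≥0∞} (hq : 0 < q) (hsα : s ≤ α) (hαq : s = α → q = ∞) :
    BoundsBumps ρ μ s p α (nNorm ρ μ s p q) := by
  obtain ⟨C, hC, hCL⟩ := exists_lqNorm_bump_le hq hs hsα hαq
  refine ⟨C, hC, fun E u L A hL hA hu1 huL hu0 => ?_⟩
  refine (iInf₂_le _ (bump_mem_fracGrad hρ μ hs (hs.trans_le hsα) hL E hA hu1 huL hu0)).trans ?_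
  refine (lqNorm_mono fun k => lebNorm_const_indicator_le μ hp E hA _).trans ?_
  simp_rw [mul_comm _ (μ A ^ (1 / p))]
  rw [lqNorm_mul_left hq]
  gcongr
  exact hCL L hL

/-! ### Chains of good points -/

/-- A ball with `μ B ≥ κ t ^ Q` contains points at which a function with a given `L^p` norm is at
most as large as Chebyshev's inequality predicts. -/
theorem exists_good_point {μ : Measure X} {E B N : Set X} {f : X → ℝ} {κ p Q t M : ℝ}
    (hκ : 0 < κ) (hp : 0 < p) (ht : 0 < t) (hM : 0 < M) (hf : AEMeasurable f (μ.restrict E))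
    (hint : ∫⁻ x in E, ENNReal.ofReal (f x) ^ p ∂μ ≤ ENNReal.ofReal (M ^ p)) (hBE : B ⊆ E)
    (hB : ENNReal.ofReal (κ * t ^ Q) ≤ μ B) (hN : μ N = 0) :
    ∃ z ∈ B, z ∉ N ∧ f z ≤ (2 / κ) ^ (1 / p) * M * t ^ (-(Q / p)) := by
  by_contra! hcon
  set l := (2 / κ) ^ (1 / p) * M * t ^ (-(Q / p)) with hl
  have hl0 : 0 < l := by positivity
  have hlp : l ^ p * (κ * t ^ Q) = 2 * M ^ p := by
    rw [hl, Real.mul_rpow (by positivity) (by positivity), Real.mul_rpow (by positivity) hM.le,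
      ← Real.rpow_mul (by positivity), ← Real.rpow_mul ht.le, one_div_mul_cancel hp.ne',
      Real.rpow_one, neg_mul, div_mul_cancel₀ _ hp.ne', Real.rpow_neg ht.le]
    have : t ^ Q ≠ 0 := by positivity
    field_simp
  have h1 := mul_meas_ge_le_lintegral₀ (hf.ennreal_ofReal.pow_const p) (ENNReal.ofReal (l ^ p))
  have h2 : μ B ≤ μ.restrict E {x | ENNReal.ofReal (l ^ p) ≤ ENNReal.ofReal (f x) ^ p} := by
    calc μ B ≤ μ (B \ N ∪ N) := measure_mono (by rw [sdiff_union_self]; exact subset_union_left)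
      _ ≤ μ (B \ N) + μ N := measure_union_le _ _
      _ = μ (B \ N) := by rw [hN, add_zero]
      _ ≤ μ ({x | ENNReal.ofReal (l ^ p) ≤ ENNReal.ofReal (f x) ^ p} ∩ E) := by
          refine measure_mono fun z hz => ⟨?_, hBE hz.1⟩
          have := hcon z hz.1 hz.2
          show ENNReal.ofReal (l ^ p) ≤ ENNReal.ofReal (f z) ^ p
          rw [← ENNReal.ofReal_rpow_of_pos hl0]
          exact ENNReal.rpow_le_rpow (ENNReal.ofReal_le_ofReal this.le) hp.le
      _ ≤ _ := Measure.le_restrict_apply _ _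
  have h3 : ENNReal.ofReal (l ^ p * (κ * t ^ Q)) ≤ ENNReal.ofReal (M ^ p) := by
    rw [ENNReal.ofReal_mul (by positivity)]
    calc ENNReal.ofReal (l ^ p) * ENNReal.ofReal (κ * t ^ Q) ≤ ENNReal.ofReal (l ^ p) *
          μ.restrict E {x | ENNReal.ofReal (l ^ p) ≤ ENNReal.ofReal (f x) ^ p} := by
          gcongr; exact hB.trans h2
      _ ≤ _ := h1.trans hint
  rw [ENNReal.ofReal_le_ofReal_iff (by positivity), hlp] at h3
  have : 0 < M ^ p := by positivity
  linarith

/-- Chains of good points: from a point `w` of `B(x, 2 ^ (-j) r)` with controlled gradient one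
passes through points of `B(x, 2 ^ (-i) r)`, `i = j - 1, …, 0`, whose gradient is controlled by the
measure of these balls. All points are chosen near the fixed centre `x`, so that the constants of
the quasi-metric do not accumulate. -/
theorem exists_chain_aux {ρ : X → X → ℝ} (hρ : IsQuasiMetric ρ) {μ : Measure X} {K : ℝ}
    (hK1 : 1 ≤ K) (hK : ∀ x y, ρ y x ≤ K * ρ x y)
    (hK' : ∀ x y z, ρ x y ≤ K * max (ρ x z) (ρ z y)) {s p Q κ r G : ℝ} (hs : 0 < s) (hp : 0 < p)
    (hQ : 0 < Q) (hκ : 0 < κ) (hr : 0 < r) (hG : 0 < G) {E N : Set X} {u g : X → ℝ}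
    (hgm : AEMeasurable g (μ.restrict E)) (hN : μ N = 0)
    (hg : ∀ x ∈ E \ N, ∀ y ∈ E \ N, |u x - u y| ≤ ρ x y ^ s * (g x + g y))
    (hint : ∫⁻ x in E, ENNReal.ofReal (g x) ^ p ∂μ ≤ ENNReal.ofReal (G ^ p)) {x : X}
    (hxE : qball ρ x r ⊆ E)
    (hμ : ∀ t, 0 < t → t ≤ r → ENNReal.ofReal (κ * t ^ Q) ≤ μ (qball ρ x t)) {T : ℝ}
    (hT : T = (2 / κ) ^ (1 / p) * G * r ^ (-(Q / p))) (j : ℕ) :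
    ∀ w ∈ qball ρ x (r * 2 ^ (-(j : ℝ))), w ∉ N → g w ≤ T * 2 ^ (j * (Q / p)) →
      ∃ z ∈ qball ρ x r, z ∉ N ∧ g z ≤ T ∧ |u w - u z| ≤
        (K ^ 2 * r) ^ s * (2 * T * 2 ^ (Q / p)) *
          ∑ i ∈ Finset.range j, (2 : ℝ) ^ ((i : ℝ) * (Q / p - s)) := by
  have hT0 : 0 < T := by rw [hT]; positivity
  have hsub : ∀ j : ℕ, qball ρ x (r * 2 ^ (-(j : ℝ))) ⊆ qball ρ x r := fun j w hw =>
    lt_of_lt_of_le hw (mul_le_of_le_one_right hr.le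
      (Real.rpow_le_one_of_one_le_of_nonpos (by norm_num) (by simp)))
  induction j with
  | zero =>
    intro w hw hwN hgw
    exact ⟨w, hsub 0 hw, hwN, by simpa using hgw, by simp⟩
  | succ j ih =>
    intro w hw hwN hgw
    have ht : 0 < r * (2 : ℝ) ^ (-(j : ℝ)) := by positivity
    have htr : r * (2 : ℝ) ^ (-(j : ℝ)) ≤ r := mul_le_of_le_one_right hr.le
      (Real.rpow_le_one_of_one_le_of_nonpos (by norm_num) (by simp))
    obtain ⟨w', hw', hwN', hgw'⟩ := exists_good_point hκ hp ht hG hgm hint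
      ((hsub j).trans hxE) (hμ _ ht htr) hN
    have hgw' : g w' ≤ T * 2 ^ (j * (Q / p)) := by
      refine hgw'.trans (le_of_eq ?_)
      rw [hT, Real.mul_rpow hr.le (by positivity), ← Real.rpow_mul (by norm_num)]
      ring_nf
    obtain ⟨z, hz, hzN, hgz, huz⟩ := ih w' hw' hwN' hgw'
    refine ⟨z, hz, hzN, hgz, ?_⟩
    have hw1 : ρ x w < r * 2 ^ (-(j : ℝ)) := by
      refine lt_of_lt_of_le hw ?_
      gcongr
      · norm_num
      · simp
    have hd : ρ w w' ≤ K ^ 2 * r * 2 ^ (-(j : ℝ)) := by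
      have h1 : ρ w x ≤ K * (r * 2 ^ (-(j : ℝ))) :=
        (hK x w).trans (mul_le_mul_of_nonneg_left hw1.le (by positivity))
      have h2 : ρ x w' ≤ K * (r * 2 ^ (-(j : ℝ))) :=
        (show ρ x w' < _ from hw').le.trans (le_mul_of_one_le_left ht.le hK1)
      calc ρ w w' ≤ K * max (ρ w x) (ρ x w') := hK' w w' x
        _ ≤ K * (K * (r * 2 ^ (-(j : ℝ)))) := by gcongr; exact max_le h1 h2
        _ = _ := by ring
    have hstep : |u w - u w'| ≤ (K ^ 2 * r) ^ s * (2 * T * 2 ^ (Q / p)) *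
        (2 : ℝ) ^ ((j : ℝ) * (Q / p - s)) := by
      have h1 := hg w ⟨hxE (hsub _ hw), hwN⟩ w' ⟨hxE (hsub _ hw'), hwN'⟩
      have h2 : ρ w w' ^ s ≤ (K ^ 2 * r) ^ s * 2 ^ (-(j * s)) := by
        calc ρ w w' ^ s ≤ (K ^ 2 * r * 2 ^ (-(j : ℝ))) ^ s :=
              Real.rpow_le_rpow (hρ.nonneg _ _) hd hs.le
          _ = _ := by
            rw [Real.mul_rpow (by positivity) (by positivity), ← Real.rpow_mul (by norm_num),
              neg_mul]
      have e1 : (2 : ℝ) ^ (((j + 1 : ℕ) : ℝ) * (Q / p)) = 2 ^ (Q / p) * 2 ^ (j * (Q / p)) := by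
        rw [← Real.rpow_add (by norm_num)]; congr 1; push_cast; ring
      have e2 : (2 : ℝ) ^ ((j : ℝ) * (Q / p - s)) = 2 ^ (-(j * s)) * 2 ^ (j * (Q / p)) := by
        rw [← Real.rpow_add (by norm_num)]; congr 1; ring
      have e3 : (1 : ℝ) ≤ 2 ^ (Q / p) := Real.one_le_rpow (by norm_num) (by positivity)
      have h3 : g w + g w' ≤ 2 * T * 2 ^ (Q / p) * 2 ^ (j * (Q / p)) := by
        rw [e1] at hgw
        have : T * 2 ^ (j * (Q / p)) ≤ T * 2 ^ (j * (Q / p)) * 2 ^ (Q / p) :=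
          le_mul_of_one_le_right (by positivity) e3
        nlinarith
      calc |u w - u w'| ≤ ρ w w' ^ s * (g w + g w') := h1
        _ ≤ ρ w w' ^ s * (2 * T * 2 ^ (Q / p) * 2 ^ (j * (Q / p))) :=
            mul_le_mul_of_nonneg_left h3 (Real.rpow_nonneg (hρ.nonneg _ _) _)
        _ ≤ (K ^ 2 * r) ^ s * 2 ^ (-(j * s)) * (2 * T * 2 ^ (Q / p) * 2 ^ (j * (Q / p))) := by
            gcongr
        _ = _ := by rw [e2]; ring
    rw [Finset.sum_range_succ, mul_add]
    have := abs_sub_le (u w) (u w') (u z)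
    linarith

/-- The pointwise estimate behind all embeddings. A point `x` is joined to a point `z` at which the
gradient is at most `T = (2 / κ) ^ (1 / p) G r ^ (-Q / p)`, and the number `J` of the dyadic scales
that are needed is controlled by the value of the gradient at `x`. -/
theorem exists_chain {ρ : X → X → ℝ} (hρ : IsQuasiMetric ρ) {μ : Measure X} {K : ℝ}
    (hK1 : 1 ≤ K) (hK : ∀ x y, ρ y x ≤ K * ρ x y)
    (hK' : ∀ x y z, ρ x y ≤ K * max (ρ x z) (ρ z y)) {s p Q κ r G : ℝ} (hs : 0 < s) (hp : 0 < p)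
    (hQ : 0 < Q) (hκ : 0 < κ) (hr : 0 < r) (hG : 0 < G) {E N : Set X} {u g : X → ℝ}
    (hg0 : ∀ x, 0 ≤ g x) (hgm : AEMeasurable g (μ.restrict E)) (hN : μ N = 0)
    (hg : ∀ x ∈ E \ N, ∀ y ∈ E \ N, |u x - u y| ≤ ρ x y ^ s * (g x + g y))
    (hint : ∫⁻ x in E, ENNReal.ofReal (g x) ^ p ∂μ ≤ ENNReal.ofReal (G ^ p)) {x : X}
    (hxN : x ∉ N) (hxE : qball ρ x r ⊆ E)
    (hμ : ∀ t, 0 < t → t ≤ r → ENNReal.ofReal (κ * t ^ Q) ≤ μ (qball ρ x t)) {T : ℝ}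
    (hT : T = (2 / κ) ^ (1 / p) * G * r ^ (-(Q / p))) :
    ∃ J : ℕ, (2 : ℝ) ^ (J * Q) ≤ 2 ^ Q * (1 + (g x / T) ^ p) ∧
      ∃ z ∈ qball ρ x r, z ∉ N ∧ g z ≤ T ∧ |u x - u z| ≤
        (K ^ 2 * r) ^ s * (2 * T * 2 ^ (Q / p)) *
          ∑ i ∈ Finset.range J, (2 : ℝ) ^ ((i : ℝ) * (Q / p - s)) := by
  have hT0 : 0 < T := by rw [hT]; positivity
  have hex : ∃ J : ℕ, g x ≤ T * 2 ^ (J * (Q / p)) := by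
    obtain ⟨n, hn⟩ := pow_unbounded_of_one_lt (g x / T)
      (Real.one_lt_rpow (by norm_num : (1 : ℝ) < 2) (by positivity : 0 < Q / p))
    refine ⟨n, ?_⟩
    rw [div_lt_iff₀ hT0, ← Real.rpow_natCast, ← Real.rpow_mul (by norm_num)] at hn
    rw [mul_comm (n : ℝ), mul_comm T]
    exact hn.le
  classical
  refine ⟨Nat.find hex, ?_, exists_chain_aux hρ hK1 hK hK' hs hp hQ hκ hr hG hgm hN hg hint hxE hμ
    hT _ x ?_ hxN (Nat.find_spec hex)⟩
  · have h0 : 0 ≤ (g x / T) ^ p := Real.rpow_nonneg (div_nonneg (hg0 x) hT0.le) _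
    have h1 : (1 : ℝ) ≤ 2 ^ Q := Real.one_le_rpow (by norm_num) hQ.le
    rcases hJ : Nat.find hex with _ | j
    · simp only [Nat.cast_zero, zero_mul, Real.rpow_zero]
      nlinarith
    · have hj : ¬ g x ≤ T * 2 ^ (j * (Q / p)) := Nat.find_min hex (by omega)
      have h2 : (2 : ℝ) ^ (j * Q) ≤ (g x / T) ^ p := by
        calc (2 : ℝ) ^ (j * Q) = (2 ^ (j * (Q / p))) ^ p := by
              rw [← Real.rpow_mul (by norm_num)]; congr 1; field_simp
          _ ≤ (g x / T) ^ p := by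
              refine Real.rpow_le_rpow (by positivity) ?_ hp.le
              rw [le_div_iff₀ hT0]
              linarith
      calc (2 : ℝ) ^ (((j + 1 : ℕ) : ℝ) * Q) = 2 ^ Q * 2 ^ (j * Q) := by
            rw [← Real.rpow_add (by norm_num)]; congr 1; push_cast; ring
        _ ≤ 2 ^ Q * (1 + (g x / T) ^ p) := by gcongr; linarith
  · show ρ x x < _
    rw [hρ.self]; positivity

/-- The chain estimate on a ball `B(x₀, r)`, relative to the value of `u` at a point `y₀` of the
ball at which the gradient is of the expected size. -/
theorem exists_ball_estimate {ρ : X → X → ℝ} (hρ : IsQuasiMetric ρ) (μ : Measure X) {σ : ℝ}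
    (hσ : 1 ≤ σ) (hσ' : ∀ x y z, ρ x y ≤ σ * max (ρ x z) (ρ z y)) {s p Q κ : ℝ} (hs : 0 < s)
    (hp : 0 < p) (hQ : 0 < Q) (hκ : 0 < κ) {b : ℝ} (hb : 0 < b) :
    ∃ C : ℝ, 0 < C ∧ ∀ (x₀ : X) (r G T : ℝ) (u g : X → ℝ) (N : Set X) (y₀ : X), 0 < r → 0 < G →
      (∀ x t, 0 < t → t ≤ r → ENNReal.ofReal (κ * t ^ Q) ≤ μ (qball ρ x t)) →
      (∀ x, 0 ≤ g x) → AEMeasurable g (μ.restrict (qball ρ x₀ (σ * r))) → μ N = 0 →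
      (∀ x ∈ qball ρ x₀ (σ * r) \ N, ∀ y ∈ qball ρ x₀ (σ * r) \ N,
        |u x - u y| ≤ ρ x y ^ s * (g x + g y)) →
      ∫⁻ x in qball ρ x₀ (σ * r), ENNReal.ofReal (g x) ^ p ∂μ ≤ ENNReal.ofReal (G ^ p) →
      T = (2 / κ) ^ (1 / p) * G * r ^ (-(Q / p)) →
      y₀ ∈ qball ρ x₀ r → y₀ ∉ N → g y₀ ≤ b * T → ∀ x ∈ qball ρ x₀ r, x ∉ N →
      ∃ J : ℕ, (2 : ℝ) ^ (J * Q) ≤ 2 ^ Q * (1 + (g x / T) ^ p) ∧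
        |u x - u y₀| ≤ C * G * r ^ (s - Q / p) *
          (1 + ∑ i ∈ Finset.range J, (2 : ℝ) ^ ((i : ℝ) * (Q / p - s))) := by
  obtain ⟨K, hK1, hK, hK'⟩ := hρ.exists_const
  have hK0 : 0 < K := by positivity
  set a := (2 / κ) ^ (1 / p) with ha
  have ha0 : 0 < a := by positivity
  refine ⟨(K ^ 2) ^ s * (2 * a * 2 ^ (Q / p)) + (K ^ 3) ^ s * ((1 + b) * a), by positivity, ?_⟩
  intro x₀ r G T u g N y₀ hr hG hμ hg0 hgm hN hg hint hT hy₀ hyN hgy x hx hxN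
  have hxE : qball ρ x r ⊆ qball ρ x₀ (σ * r) := by
    intro w hw
    calc ρ x₀ w ≤ σ * max (ρ x₀ x) (ρ x w) := hσ' x₀ w x
      _ < σ * r := by gcongr; exact max_lt hx hw
  have hsub : qball ρ x₀ r ⊆ qball ρ x₀ (σ * r) := fun w hw =>
    lt_of_lt_of_le hw (le_mul_of_one_le_left hr.le hσ)
  obtain ⟨J, hJ, z, hz, hzN, hgz, huz⟩ := exists_chain hρ hK1 hK hK' hs hp hQ hκ hr hG hg0 hgm hN hg
    hint hxN hxE (hμ x) hT
  refine ⟨J, hJ, ?_⟩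
  have hT0 : 0 < T := by rw [hT]; positivity
  have hrT : r ^ s * T = a * G * r ^ (s - Q / p) := by
    rw [hT, sub_eq_add_neg, Real.rpow_add hr]; ring
  have hd : ρ z y₀ ≤ K ^ 3 * r := by
    have h1 : ρ z x ≤ K * r := (hK x z).trans (mul_le_mul_of_nonneg_left (le_of_lt hz) hK0.le)
    have h2 : ρ x x₀ ≤ K * r := (hK x₀ x).trans (mul_le_mul_of_nonneg_left (le_of_lt hx) hK0.le)
    have h3 : ρ x₀ y₀ ≤ K * r := (le_of_lt hy₀).trans (le_mul_of_one_le_left hr.le hK1)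
    have h4 : ρ x y₀ ≤ K * (K * r) :=
      (hK' x y₀ x₀).trans (mul_le_mul_of_nonneg_left (max_le h2 h3) hK0.le)
    have h5 : ρ z x ≤ K * (K * r) := h1.trans (le_mul_of_one_le_left (by positivity) hK1)
    calc ρ z y₀ ≤ K * max (ρ z x) (ρ x y₀) := hK' z y₀ x
      _ ≤ K * (K * (K * r)) := by gcongr; exact max_le h5 h4
      _ = _ := by ring
  have huy : |u z - u y₀| ≤ (K ^ 3 * r) ^ s * ((1 + b) * T) := by
    refine (hg z ⟨hxE hz, hzN⟩ y₀ ⟨hsub hy₀, hyN⟩).trans ?_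
    have h1 : ρ z y₀ ^ s ≤ (K ^ 3 * r) ^ s := Real.rpow_le_rpow (hρ.nonneg _ _) hd hs.le
    have h2 : g z + g y₀ ≤ (1 + b) * T := by linarith
    have h3 : 0 ≤ g z + g y₀ := add_nonneg (hg0 _) (hg0 _)
    gcongr
  have hS : 0 ≤ ∑ i ∈ Finset.range J, (2 : ℝ) ^ ((i : ℝ) * (Q / p - s)) :=
    Finset.sum_nonneg fun i _ => by positivity
  set S := ∑ i ∈ Finset.range J, (2 : ℝ) ^ ((i : ℝ) * (Q / p - s)) with hSdef
  have hfin : |u x - u y₀| ≤ (K ^ 2 * r) ^ s * (2 * T * 2 ^ (Q / p)) * S +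
      (K ^ 3 * r) ^ s * ((1 + b) * T) := (abs_sub_le _ (u z) _).trans (add_le_add huz huy)
  refine hfin.trans ?_
  rw [Real.mul_rpow (by positivity) hr.le, Real.mul_rpow (by positivity) hr.le]
  have e1 : (K ^ 2) ^ s * r ^ s * (2 * T * 2 ^ (Q / p)) * S +
      (K ^ 3) ^ s * r ^ s * ((1 + b) * T) =
      ((K ^ 2) ^ s * (2 * 2 ^ (Q / p)) * S + (K ^ 3) ^ s * (1 + b)) * (r ^ s * T) := by ring
  rw [e1, hrT]
  have h1 : 0 ≤ (K ^ 2) ^ s * (2 * 2 ^ (Q / p)) := by positivity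
  have h2 : 0 ≤ (K ^ 3) ^ s * (1 + b) * S := by positivity
  have h3 : 0 ≤ a * G * r ^ (s - Q / p) := by positivity
  calc _ ≤ (((K ^ 2) ^ s * (2 * 2 ^ (Q / p)) + (K ^ 3) ^ s * (1 + b)) * (1 + S)) *
        (a * G * r ^ (s - Q / p)) := by
        refine mul_le_mul_of_nonneg_right ?_ h3
        linarith
    _ = _ := by ring

/-! ### Averages over balls -/

/-- The average of `1 + (g / T) ^ p` over a ball is at most `2`; this is the reason for the choice
of `T`. -/
theorem laverage_le_of_gradient {μ : Measure X} {B E : Set X} {g f : X → ℝ} {κ p Q r G T : ℝ}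
    (hκ : 0 < κ) (hp : 0 < p) (hr : 0 < r) (hG : 0 < G) (hg0 : ∀ x, 0 ≤ g x) (hBE : B ⊆ E)
    (hint : ∫⁻ x in E, ENNReal.ofReal (g x) ^ p ∂μ ≤ ENNReal.ofReal (G ^ p))
    (hT : T = (2 / κ) ^ (1 / p) * G * r ^ (-(Q / p)))
    (hB : ENNReal.ofReal (κ * r ^ Q) ≤ μ B) (hB' : μ B < ∞) {c : ℝ} (hc : 0 ≤ c)
    (hf : ∀ᵐ x ∂(μ.restrict B), f x ≤ c * (1 + (g x / T) ^ p)) :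
    ⨍⁻ x in B, ENNReal.ofReal (f x) ∂μ ≤ ENNReal.ofReal (c * 2) := by
  have hT0 : 0 < T := by rw [hT]; positivity
  have hB0 : μ B ≠ 0 := by
    intro h0
    rw [h0, nonpos_iff_eq_zero, ENNReal.ofReal_eq_zero] at hB
    exact absurd hB (not_le.2 (by positivity))
  have hTp : (T⁻¹) ^ p * G ^ p = κ * r ^ Q / 2 := by
    rw [Real.inv_rpow hT0.le, hT, Real.mul_rpow (by positivity) (by positivity),
      Real.mul_rpow (by positivity) hG.le, ← Real.rpow_mul (by positivity), ← Real.rpow_mul hr.le,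
      one_div_mul_cancel hp.ne', Real.rpow_one, neg_mul, div_mul_cancel₀ _ hp.ne',
      Real.rpow_neg hr.le]
    have : G ^ p ≠ 0 := by positivity
    field_simp
  have h1 : ∫⁻ x in B, ENNReal.ofReal ((g x / T) ^ p) ∂μ ≤ μ B := by
    have e : ∀ x, ENNReal.ofReal ((g x / T) ^ p) =
        ENNReal.ofReal ((T⁻¹) ^ p) * ENNReal.ofReal (g x) ^ p := by
      intro x
      rw [ENNReal.ofReal_rpow_of_nonneg (hg0 x) hp.le, ← ENNReal.ofReal_mul (by positivity),
        ← Real.mul_rpow (by positivity) (hg0 x), div_eq_inv_mul]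
    simp_rw [e]
    rw [lintegral_const_mul' _ _ ENNReal.ofReal_ne_top]
    calc ENNReal.ofReal ((T⁻¹) ^ p) * ∫⁻ x in B, ENNReal.ofReal (g x) ^ p ∂μ
        ≤ ENNReal.ofReal ((T⁻¹) ^ p) * ENNReal.ofReal (G ^ p) := by
          gcongr
          exact (lintegral_mono_set hBE).trans hint
      _ = ENNReal.ofReal (κ * r ^ Q / 2) := by rw [← ENNReal.ofReal_mul (by positivity), hTp]
      _ ≤ ENNReal.ofReal (κ * r ^ Q) :=
          ENNReal.ofReal_le_ofReal (half_le_self (by positivity))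
      _ ≤ μ B := hB
  rw [setLAverage_eq, ENNReal.div_le_iff hB0 hB'.ne]
  have h0 : ∀ x, 0 ≤ (g x / T) ^ p := fun x => Real.rpow_nonneg (div_nonneg (hg0 x) hT0.le) _
  calc ∫⁻ x in B, ENNReal.ofReal (f x) ∂μ
      ≤ ∫⁻ x in B, ENNReal.ofReal c * (1 + ENNReal.ofReal ((g x / T) ^ p)) ∂μ := by
        refine lintegral_mono_ae ?_
        filter_upwards [hf] with x hx
        rw [← ENNReal.ofReal_one, ← ENNReal.ofReal_add zero_le_one (h0 x),
          ← ENNReal.ofReal_mul hc]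
        exact ENNReal.ofReal_le_ofReal hx
    _ = ENNReal.ofReal c * (μ B + ∫⁻ x in B, ENNReal.ofReal ((g x / T) ^ p) ∂μ) := by
        rw [lintegral_const_mul' _ _ ENNReal.ofReal_ne_top, lintegral_add_left measurable_const,
          setLIntegral_one]
    _ ≤ ENNReal.ofReal c * (μ B + μ B) := by gcongr
    _ = ENNReal.ofReal (c * 2) * μ B := by
        rw [ENNReal.ofReal_mul hc, ENNReal.ofReal_ofNat, ← two_mul, mul_assoc]

theorem one_add_sum_geometric_le {δ : ℝ} (hδ : 0 < δ) (J : ℕ) :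
    1 + ∑ i ∈ Finset.range J, (2 : ℝ) ^ ((i : ℝ) * δ) ≤
      (1 + 1 / (2 ^ δ - 1)) * 2 ^ ((J : ℝ) * δ) := by
  have h1 : (1 : ℝ) < 2 ^ δ := Real.one_lt_rpow (by norm_num) hδ
  have e : ∀ i : ℕ, (2 : ℝ) ^ ((i : ℝ) * δ) = (2 ^ δ) ^ i := fun i => by
    rw [← Real.rpow_natCast, ← Real.rpow_mul (by norm_num), mul_comm]
  simp_rw [e]
  rw [geom_sum_eq h1.ne']
  have h2 : (1 : ℝ) ≤ (2 ^ δ) ^ J := one_le_pow₀ h1.le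
  have h3 : 0 < (2 : ℝ) ^ δ - 1 := sub_pos.2 h1
  have h4 : (((2 : ℝ) ^ δ) ^ J - 1) / (2 ^ δ - 1) ≤ 1 / (2 ^ δ - 1) * (2 ^ δ) ^ J := by
    rw [one_div_mul_eq_div]
    gcongr
    linarith
  linarith

theorem sum_geometric_le {δ : ℝ} (hδ : δ < 0) (J : ℕ) :
    ∑ i ∈ Finset.range J, (2 : ℝ) ^ ((i : ℝ) * δ) ≤ 1 / (1 - 2 ^ δ) := by
  have h1 : (2 : ℝ) ^ δ < 1 := Real.rpow_lt_one_of_one_lt_of_neg (by norm_num) hδ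
  have h0 : (0 : ℝ) < 2 ^ δ := by positivity
  have e : ∀ i : ℕ, (2 : ℝ) ^ ((i : ℝ) * δ) = (2 ^ δ) ^ i := fun i => by
    rw [← Real.rpow_natCast, ← Real.rpow_mul (by norm_num), mul_comm]
  simp_rw [e]
  rw [one_div, ← tsum_geometric_of_lt_one h0.le h1]
  exact (summable_geometric_of_lt_one h0.le h1).sum_le_tsum _ fun i _ => by positivity

/-- The chain estimate bounds the `L^{p^*}` average, since the power `p^*` of the geometric factor
`2 ^ (J (Q / p - s))` is `2 ^ (JQ)`. -/
theorem exists_laverage_rpow_le {s p Q : ℝ} (hp : 0 < p) (hs : 0 < s) (hQ : 0 < Q)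
    (hpQ : p < Q / s) :
    ∃ C : ℝ, 0 < C ∧ ∀ (μ : Measure X) (B E : Set X) (g f : X → ℝ) (κ r G T H : ℝ),
      0 < κ → 0 < r → 0 < G → (∀ x, 0 ≤ g x) → B ⊆ E →
      ∫⁻ x in E, ENNReal.ofReal (g x) ^ p ∂μ ≤ ENNReal.ofReal (G ^ p) →
      T = (2 / κ) ^ (1 / p) * G * r ^ (-(Q / p)) → ENNReal.ofReal (κ * r ^ Q) ≤ μ B → μ B < ∞ →
      0 < H → (∀ᵐ x ∂(μ.restrict B), ∃ J : ℕ, (2 : ℝ) ^ (J * Q) ≤ 2 ^ Q * (1 + (g x / T) ^ p) ∧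
        |f x| ≤ H * (1 + ∑ i ∈ Finset.range J, (2 : ℝ) ^ ((i : ℝ) * (Q / p - s)))) →
      (⨍⁻ y in B, ENNReal.ofReal |f y| ^ (Q * p / (Q - s * p)) ∂μ) ^ (1 / (Q * p / (Q - s * p))) ≤
        ENNReal.ofReal (C * H) := by
  have hsp : s * p < Q := by rwa [lt_div_iff₀ hs, mul_comm] at hpQ
  set P := Q * p / (Q - s * p) with hP
  have hP0 : 0 < P := div_pos (by positivity) (by linarith)
  have hδ : 0 < Q / p - s := by rw [sub_pos, lt_div_iff₀ hp]; exact hsp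
  have hδP : (Q / p - s) * P = Q := by
    have h1 : Q - s * p ≠ 0 := by linarith
    rw [hP, div_sub' hp.ne', div_mul_div_comm, mul_comm p s, mul_comm p, mul_div_mul_comm,
      mul_comm Q p, div_self h1, one_mul, mul_div_cancel_left₀ _ hp.ne']
  set c := 1 + 1 / ((2 : ℝ) ^ (Q / p - s) - 1) with hc
  have hc0 : 0 < c := by
    have : (1 : ℝ) < 2 ^ (Q / p - s) := Real.one_lt_rpow (by norm_num) hδ
    have : 0 < 1 / ((2 : ℝ) ^ (Q / p - s) - 1) := by
      apply one_div_pos.2; linarith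
    linarith
  refine ⟨c * (2 ^ Q * 2) ^ (1 / P), by positivity, ?_⟩
  intro μ B E g f κ r G T H hκ hr hG hg0 hBE hint hT hB hB' hH hf
  have h1 : ⨍⁻ y in B, ENNReal.ofReal (|f y| ^ P) ∂μ ≤
      ENNReal.ofReal ((c * H) ^ P * 2 ^ Q * 2) := by
    refine laverage_le_of_gradient hκ hp hr hG hg0 hBE hint hT hB hB' (by positivity) ?_
    filter_upwards [hf] with x hx
    obtain ⟨J, hJ, hfx⟩ := hx
    have h2 : |f x| ≤ c * H * 2 ^ ((J : ℝ) * (Q / p - s)) := by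
      refine hfx.trans ?_
      have := mul_le_mul_of_nonneg_left (one_add_sum_geometric_le hδ J) hH.le
      linarith
    calc |f x| ^ P ≤ (c * H * 2 ^ ((J : ℝ) * (Q / p - s))) ^ P :=
          Real.rpow_le_rpow (abs_nonneg _) h2 hP0.le
      _ = (c * H) ^ P * 2 ^ (J * Q) := by
          rw [Real.mul_rpow (by positivity) (by positivity), ← Real.rpow_mul (by norm_num),
            mul_assoc (J : ℝ), hδP]
      _ ≤ (c * H) ^ P * (2 ^ Q * (1 + (g x / T) ^ p)) := by gcongr
      _ = _ := by ring
  have h2 : ∀ y, ENNReal.ofReal |f y| ^ P = ENNReal.ofReal (|f y| ^ P) := fun y =>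
    ENNReal.ofReal_rpow_of_nonneg (abs_nonneg _) hP0.le
  simp_rw [h2]
  calc _ ≤ ENNReal.ofReal ((c * H) ^ P * 2 ^ Q * 2) ^ (1 / P) :=
        ENNReal.rpow_le_rpow h1 (by positivity)
    _ = ENNReal.ofReal (c * (2 ^ Q * 2) ^ (1 / P) * H) := by
        rw [ENNReal.ofReal_rpow_of_pos (by positivity), mul_assoc,
          Real.mul_rpow (by positivity) (by positivity), ← Real.rpow_mul (by positivity),
          mul_one_div_cancel hP0.ne', Real.rpow_one]
        ring_nf

theorem le_mul_of_forall_lt {I c F : ℝ≥0∞} (hc : c ≠ 0) (hc' : c ≠ ∞)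
    (h : ∀ G : ℝ, 0 < G → F < ENNReal.ofReal G → I ≤ c * ENNReal.ofReal G) : I ≤ c * F := by
  rw [mul_comm, ← ENNReal.div_le_iff_le_mul (Or.inl hc) (Or.inl hc')]
  refine le_of_forall_gt_imp_ge_of_dense fun a ha => ?_
  rcases eq_or_ne a ∞ with rfl | ha'
  · exact le_top
  rw [ENNReal.div_le_iff_le_mul (Or.inl hc) (Or.inl hc'), mul_comm, ← ENNReal.ofReal_toReal ha']
  have ha0 : 0 < a := lt_of_le_of_lt zero_le ha
  exact h _ (ENNReal.toReal_pos ha0.ne' ha') (by rwa [ENNReal.ofReal_toReal ha'])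

/-! ### The embeddings on lower Ahlfors-regular spaces -/

theorem lower_bound_of_le {ρ : X → X → ℝ} {μ : Measure X} {κ Q : ℝ}
    (h : ∀ (x : X) (r : ℝ), 0 < r → ENNReal.ofReal r ≤ qdiam ρ →
      ENNReal.ofReal (κ * r ^ Q) ≤ μ (qball ρ x r)) {r : ℝ} (hr : ENNReal.ofReal r ≤ qdiam ρ) :
    ∀ x t, 0 < t → t ≤ r → ENNReal.ofReal (κ * t ^ Q) ≤ μ (qball ρ x t) :=
  fun x t ht htr => h x t ht ((ENNReal.ofReal_le_ofReal htr).trans hr)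

theorem ae_restrict_mem_and_notMem {μ : Measure X} {B N : Set X} (hB : NullMeasurableSet B μ)
    (hN : μ N = 0) : ∀ᵐ x ∂(μ.restrict B), x ∈ B ∧ x ∉ N :=
  (ae_restrict_mem₀ hB).and (ae_restrict_of_ae (measure_eq_zero_iff_ae_notMem.1 hN))

theorem LowerAhlforsRegular.sobolevPoincareIneq [Nontrivial X] {ρ : X → X → ℝ} {μ : Measure X}
    (hX : IsQuasiMetricMeasureSpace ρ μ) {Q σ s p : ℝ} (hQ : 0 < Q) (hσ : quasiConst ρ ≤ σ)
    (hs : 0 < s) (hp : 0 < p) (hpQ : p < Q / s) {F : Set X → (X → ℝ) → ℝ≥0∞}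
    (hF : ControlsGradient ρ μ s p F) (h : LowerAhlforsRegular ρ μ Q) :
    SobolevPoincareIneq ρ μ Q σ s p F := by
  have hρ := hX.quasiMetric
  have hσ1 : 1 ≤ σ := hρ.one_le_quasiConst.trans hσ
  have hσ' : ∀ x y z, ρ x y ≤ σ * max (ρ x z) (ρ z y) := fun x y z =>
    (hρ.le_quasiConst_mul x y z).trans (mul_le_mul_of_nonneg_right hσ
      ((hρ.nonneg _ _).trans (le_max_left _ _)))
  obtain ⟨κ, hκ, hμ⟩ := h
  obtain ⟨C₁, hC₁, hball⟩ := exists_ball_estimate hρ μ hσ1 hσ' hs hp hQ hκ one_pos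
  obtain ⟨C₂, hC₂, havg⟩ := exists_laverage_rpow_le (X := X) hp hs hQ hpQ
  refine ⟨C₂ * C₁, by positivity, fun x₀ r hr hrd u hu => ?_⟩
  refine le_mul_of_forall_lt (by simp only [ne_eq, ENNReal.ofReal_eq_zero, not_le]; positivity)
    ENNReal.ofReal_ne_top fun G hG hFG => ?_
  obtain ⟨g, ⟨hg0, hgm, N, hN, hg⟩, hint⟩ :=
    hF _ u G (hX.ball_measurable x₀ (σ * r) (by positivity)) hG hFG
  obtain ⟨y₀, hy₀, hyN, hgy⟩ := exists_good_point hκ hp hr hG hgm hint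
    (qball_subset_mul hσ1 x₀ hr) (hμ x₀ r hr hrd) hN
  have hest := hball x₀ r G _ u g N y₀ hr hG (lower_bound_of_le hμ hrd) hg0 hgm hN hg hint rfl
    hy₀ hyN (by rw [one_mul]; exact hgy)
  refine (iInf_le _ (u y₀)).trans ?_
  have hav := havg μ (qball ρ x₀ r) _ g (fun y => u y - u y₀) κ r G _
    (C₁ * G * r ^ (s - Q / p)) hκ hr hG hg0 (qball_subset_mul hσ1 x₀ hr) hint rfl
    (hμ x₀ r hr hrd) (hX.ball_lt_top x₀ r hr)
    (by positivity) (by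
      filter_upwards [ae_restrict_mem_and_notMem (hX.ball_measurable x₀ r hr) hN] with x hx
      exact hest x hx.1 hx.2)
  refine hav.trans (le_of_eq ?_)
  rw [← ENNReal.ofReal_mul (by positivity)]
  ring_nf

theorem lintegral_max_div_rpow_le {μ : Measure X} {E : Set X} {g u : X → ℝ} {p G V : ℝ}
    (hp : 0 < p) (hG : 0 < G) (hV : 0 < V) (hg0 : ∀ x, 0 ≤ g x)
    (hgm : AEMeasurable g (μ.restrict E))
    (hg : ∫⁻ x in E, ENNReal.ofReal (g x) ^ p ∂μ ≤ ENNReal.ofReal (G ^ p))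
    (hu : ∫⁻ x in E, ENNReal.ofReal |u x| ^ p ∂μ ≤ ENNReal.ofReal (V ^ p)) :
    ∫⁻ x in E, ENNReal.ofReal (max (g x / G) (|u x| / V)) ^ p ∂μ ≤
      ENNReal.ofReal (((2 : ℝ) ^ (1 / p)) ^ p) := by
  have e1 : ∀ x, ENNReal.ofReal (max (g x / G) (|u x| / V)) ^ p ≤
      ENNReal.ofReal (g x) ^ p * ENNReal.ofReal (G ^ p)⁻¹ +
        ENNReal.ofReal |u x| ^ p * ENNReal.ofReal (V ^ p)⁻¹ := by
    intro x
    have e2 : ∀ {c d : ℝ}, 0 ≤ c → 0 < d → ENNReal.ofReal (c / d) ^ p =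
        ENNReal.ofReal c ^ p * ENNReal.ofReal (d ^ p)⁻¹ := by
      intro c d hc hd
      rw [ENNReal.ofReal_rpow_of_nonneg hc hp.le, ← ENNReal.ofReal_mul (by positivity),
        ENNReal.ofReal_rpow_of_nonneg (by positivity) hp.le, Real.div_rpow hc hd.le,
        div_eq_mul_inv]
    rcases le_total (g x / G) (|u x| / V) with hm | hm
    · rw [max_eq_right hm, e2 (abs_nonneg _) hV]; exact le_add_self
    · rw [max_eq_left hm, e2 (hg0 x) hG]; exact le_self_add
  have hbp : ((2 : ℝ) ^ (1 / p)) ^ p = 2 := by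
    rw [← Real.rpow_mul (by norm_num), one_div_mul_cancel hp.ne', Real.rpow_one]
  have e3 : ∀ {c : ℝ}, 0 < c → ENNReal.ofReal (c ^ p) * ENNReal.ofReal (c ^ p)⁻¹ = 1 := by
    intro c hc
    rw [← ENNReal.ofReal_mul (by positivity), mul_inv_cancel₀ (by positivity), ENNReal.ofReal_one]
  calc _ ≤ ∫⁻ x in E, (ENNReal.ofReal (g x) ^ p * ENNReal.ofReal (G ^ p)⁻¹ +
        ENNReal.ofReal |u x| ^ p * ENNReal.ofReal (V ^ p)⁻¹) ∂μ := lintegral_mono e1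
    _ = (∫⁻ x in E, ENNReal.ofReal (g x) ^ p ∂μ) * ENNReal.ofReal (G ^ p)⁻¹ +
        (∫⁻ x in E, ENNReal.ofReal |u x| ^ p ∂μ) * ENNReal.ofReal (V ^ p)⁻¹ := by
        rw [lintegral_add_left' ((hgm.ennreal_ofReal.pow_const p).mul_const _),
          lintegral_mul_const' _ _ ENNReal.ofReal_ne_top,
          lintegral_mul_const' _ _ ENNReal.ofReal_ne_top]
    _ ≤ ENNReal.ofReal (G ^ p) * ENNReal.ofReal (G ^ p)⁻¹ +
        ENNReal.ofReal (V ^ p) * ENNReal.ofReal (V ^ p)⁻¹ := by gcongr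
    _ = _ := by rw [e3 hG, e3 hV, hbp, ENNReal.ofReal_ofNat, one_add_one_eq_two]

theorem LowerAhlforsRegular.sobolevIneq [Nontrivial X] {ρ : X → X → ℝ} {μ : Measure X}
    (hX : IsQuasiMetricMeasureSpace ρ μ) {Q σ s p : ℝ} (hQ : 0 < Q) (hσ : quasiConst ρ ≤ σ)
    (hs : 0 < s) (hp : 0 < p) (hpQ : p < Q / s) {F : Set X → (X → ℝ) → ℝ≥0∞}
    (hF : ControlsGradient ρ μ s p F) (h : LowerAhlforsRegular ρ μ Q) :
    SobolevIneq ρ μ Q σ s p F := by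
  have hρ := hX.quasiMetric
  have hσ1 : 1 ≤ σ := hρ.one_le_quasiConst.trans hσ
  have hσ' : ∀ x y z, ρ x y ≤ σ * max (ρ x z) (ρ z y) := fun x y z =>
    (hρ.le_quasiConst_mul x y z).trans (mul_le_mul_of_nonneg_right hσ
      ((hρ.nonneg _ _).trans (le_max_left _ _)))
  obtain ⟨κ, hκ, hμ⟩ := h
  set b : ℝ := 2 ^ (1 / p) with hb
  have hb0 : 0 < b := by positivity
  obtain ⟨C₁, hC₁, hball⟩ := exists_ball_estimate hρ μ hσ1 hσ' hs hp hQ hκ hb0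
  obtain ⟨C₂, hC₂, havg⟩ := exists_laverage_rpow_le (X := X) hp hs hQ hpQ
  set a := (2 / κ) ^ (1 / p) with ha
  have ha0 : 0 < a := by positivity
  refine ⟨C₂ * (C₁ + a * b), by positivity, fun x₀ r hr hrd u hu => ?_⟩
  refine le_mul_of_forall_lt (by simp only [ne_eq, ENNReal.ofReal_eq_zero, not_le]; positivity)
    ENNReal.ofReal_ne_top fun V hV hFV => ?_
  have hrs : 0 < r ^ s := by positivity
  set G := V / r ^ s with hGdef
  have hG : 0 < G := by positivity
  have hFG : F (qball ρ x₀ (σ * r)) u < ENNReal.ofReal G := by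
    rw [hGdef, ENNReal.ofReal_div_of_pos hrs, ENNReal.lt_div_iff_mul_lt
      (Or.inl (by simpa using hrs)) (Or.inl ENNReal.ofReal_ne_top), mul_comm]
    exact lt_of_le_of_lt le_self_add hFV
  have huV : ∫⁻ x in qball ρ x₀ (σ * r), ENNReal.ofReal |u x| ^ p ∂μ ≤ ENNReal.ofReal (V ^ p) := by
    rw [← lebNorm_rpow hp, ← ENNReal.ofReal_rpow_of_pos hV]
    exact ENNReal.rpow_le_rpow (le_of_lt (lt_of_le_of_lt le_add_self hFV)) hp.le
  obtain ⟨g, ⟨hg0, hgm, N, hN, hg⟩, hint⟩ :=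
    hF _ u G (hX.ball_measurable x₀ (σ * r) (by positivity)) hG hFG
  have hmaxint := lintegral_max_div_rpow_le hp hG hV hg0 hgm hint huV
  -- a point at which both `g` and `u` have the expected size
  obtain ⟨y₀, hy₀, hyN, hy⟩ := exists_good_point hκ hp hr hb0
    ((hgm.div_const G).max (hu.1.abs.div_const V)) hmaxint
    (qball_subset_mul hσ1 x₀ hr) (hμ x₀ r hr hrd) hN
  have hgy : g y₀ ≤ b * (a * G * r ^ (-(Q / p))) := by
    have := (le_max_left _ _).trans hy
    rw [div_le_iff₀ hG] at this
    linarith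
  have huy : |u y₀| ≤ a * b * V * r ^ (-(Q / p)) := by
    have := (le_max_right _ _).trans hy
    rw [div_le_iff₀ hV] at this
    linarith
  have hest := hball x₀ r G _ u g N y₀ hr hG (lower_bound_of_le hμ hrd) hg0 hgm hN hg hint rfl
    hy₀ hyN hgy
  have hGr : G * r ^ (s - Q / p) = V * r ^ (-(Q / p)) := by
    rw [hGdef, sub_eq_add_neg, Real.rpow_add hr]; field_simp
  have hav := havg μ (qball ρ x₀ r) _ g u κ r G _ ((C₁ + a * b) * V * r ^ (-(Q / p))) hκ hr
    hG hg0 (qball_subset_mul hσ1 x₀ hr) hint rfl (hμ x₀ r hr hrd) (hX.ball_lt_top x₀ r hr)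
    (by positivity) (by
      filter_upwards [ae_restrict_mem_and_notMem (hX.ball_measurable x₀ r hr) hN] with x hx
      obtain ⟨J, hJ, hux⟩ := hest x hx.1 hx.2
      refine ⟨J, hJ, ?_⟩
      have hS : 0 ≤ ∑ i ∈ Finset.range J, (2 : ℝ) ^ ((i : ℝ) * (Q / p - s)) :=
        Finset.sum_nonneg fun i _ => by positivity
      rw [mul_assoc C₁, hGr] at hux
      have h1 : |u x| ≤ |u x - u y₀| + |u y₀| := by
        have := abs_add_le (u x - u y₀) (u y₀); rwa [sub_add_cancel] at this
      have h2 : 0 ≤ a * b * V * r ^ (-(Q / p)) *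
          ∑ i ∈ Finset.range J, (2 : ℝ) ^ ((i : ℝ) * (Q / p - s)) :=
        mul_nonneg (by positivity) hS
      linarith)
  refine hav.trans (le_of_eq ?_)
  rw [← ENNReal.ofReal_mul (by positivity)]
  ring_nf

theorem LowerAhlforsRegular.trudingerIneq [Nontrivial X] {ρ : X → X → ℝ} {μ : Measure X}
    (hX : IsQuasiMetricMeasureSpace ρ μ) {Q σ s : ℝ} (hQ : 0 < Q) (hσ : quasiConst ρ ≤ σ)
    (hs : 0 < s) {F : Set X → (X → ℝ) → ℝ≥0∞}
    (hF : ControlsGradient ρ μ s (Q / s) F) (h : LowerAhlforsRegular ρ μ Q) :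
    TrudingerIneq ρ μ σ F := by
  have hρ := hX.quasiMetric
  have hσ1 : 1 ≤ σ := hρ.one_le_quasiConst.trans hσ
  have hσ' : ∀ x y z, ρ x y ≤ σ * max (ρ x z) (ρ z y) := fun x y z =>
    (hρ.le_quasiConst_mul x y z).trans (mul_le_mul_of_nonneg_right hσ
      ((hρ.nonneg _ _).trans (le_max_left _ _)))
  have hp : 0 < Q / s := by positivity
  obtain ⟨κ, hκ, hμ⟩ := h
  obtain ⟨C, hC, hball⟩ := exists_ball_estimate hρ μ hσ1 hσ' hs hp hQ hκ one_pos
  have hδ : Q / (Q / s) - s = 0 := by field_simp; ring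
  have hδ' : s - Q / (Q / s) = 0 := by linarith
  -- with this choice `exp (η C (1 + J)) = 2 ^ (Q (1 + J))`
  set η := Q * Real.log 2 / C with hη
  have hlog : 0 < Real.log 2 := Real.log_pos (by norm_num)
  have hη0 : 0 < η := by positivity
  set D : ℝ := 2 ^ Q * 2 ^ Q * 2 with hD
  have hD0 : 0 < D := by positivity
  refine ⟨η / 2, Real.exp D * D, 1, by positivity, by positivity, one_pos, ?_⟩
  intro x₀ r hr hrd u hu hu0
  set Fr := (F (qball ρ x₀ (σ * r)) u).toReal with hFr
  have hFr0 : 0 < Fr := ENNReal.toReal_pos hu0.ne' hu.2.ne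
  set G := 2 * Fr with hGdef
  have hG : 0 < G := by positivity
  have hFG : F (qball ρ x₀ (σ * r)) u < ENNReal.ofReal G := by
    rw [← ENNReal.ofReal_toReal hu.2.ne, ← hFr]
    exact (ENNReal.ofReal_lt_ofReal_iff hG).2 (by linarith)
  obtain ⟨g, ⟨hg0, hgm, N, hN, hg⟩, hint⟩ :=
    hF _ u G (hX.ball_measurable x₀ (σ * r) (by positivity)) hG hFG
  set B := qball ρ x₀ r with hB
  have hBm : NullMeasurableSet B μ := hX.ball_measurable x₀ r hr
  have hBE : B ⊆ qball ρ x₀ (σ * r) := qball_subset_mul hσ1 x₀ hr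
  have hB0 : μ B ≠ 0 := (hX.ball_pos x₀ r hr).ne'
  have hBt : μ B ≠ ∞ := (hX.ball_lt_top x₀ r hr).ne
  obtain ⟨y₀, hy₀, hyN, hgy⟩ := exists_good_point hκ hp hr hG hgm hint hBE (hμ x₀ r hr hrd) hN
  have hest := hball x₀ r G _ u g N y₀ hr hG (lower_bound_of_le hμ hrd) hg0 hgm hN hg hint rfl
    hy₀ hyN (by rw [one_mul]; exact hgy)
  have hexp : ⨍⁻ y in B, ENNReal.ofReal (Real.exp (η * |u y - u y₀| / G)) ∂μ ≤
      ENNReal.ofReal D := by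
    refine laverage_le_of_gradient hκ hp hr hG hg0 hBE hint rfl (hμ x₀ r hr hrd)
      hBt.lt_top (by positivity) ?_
    filter_upwards [ae_restrict_mem_and_notMem hBm hN] with x hx
    obtain ⟨J, hJ, hux⟩ := hest x hx.1 hx.2
    rw [hδ, hδ'] at hux
    simp only [mul_zero, Real.rpow_zero, Finset.sum_const, Finset.card_range, nsmul_eq_mul,
      mul_one] at hux
    calc Real.exp (η * |u x - u y₀| / G) ≤ Real.exp (Real.log 2 * (Q * (1 + J))) := by
          refine Real.exp_le_exp.2 ?_
          rw [div_le_iff₀ hG]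
          calc η * |u x - u y₀| ≤ η * (C * G * (1 + J)) := by gcongr
            _ = _ := by rw [hη]; field_simp
      _ = 2 ^ Q * 2 ^ (J * Q) := by
          rw [← Real.rpow_def_of_pos (by norm_num), ← Real.rpow_add (by norm_num)]
          congr 1; ring
      _ ≤ 2 ^ Q * (2 ^ Q * (1 + _)) := by gcongr
      _ = _ := by ring
  have huB : AEMeasurable u (μ.restrict B) := hu.1.mono_measure (Measure.restrict_mono_set μ hBE)
  have hlin : ∫⁻ y in B, ENNReal.ofReal |u y - u y₀| ∂μ ≤ ENNReal.ofReal (G / η * D) * μ B := by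
    calc ∫⁻ y in B, ENNReal.ofReal |u y - u y₀| ∂μ
        ≤ ∫⁻ y in B, ENNReal.ofReal (G / η) *
            ENNReal.ofReal (Real.exp (η * |u y - u y₀| / G)) ∂μ := by
          refine lintegral_mono fun y => ?_
          rw [← ENNReal.ofReal_mul (by positivity)]
          refine ENNReal.ofReal_le_ofReal ?_
          have := Real.add_one_le_exp (η * |u y - u y₀| / G)
          calc |u y - u y₀| = G / η * (η * |u y - u y₀| / G) := by field_simp
            _ ≤ _ := by gcongr; linarith
      _ = ENNReal.ofReal (G / η) * ∫⁻ y in B,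
            ENNReal.ofReal (Real.exp (η * |u y - u y₀| / G)) ∂μ :=
          lintegral_const_mul' _ _ ENNReal.ofReal_ne_top
      _ ≤ ENNReal.ofReal (G / η) * (ENNReal.ofReal D * μ B) := by
          rw [setLAverage_eq, ENNReal.div_le_iff hB0 hBt] at hexp
          gcongr
      _ = _ := by rw [← mul_assoc, ← ENNReal.ofReal_mul (by positivity)]
  have hint' : IntegrableOn (fun y => u y - u y₀) B μ := by
    refine ⟨(huB.sub_const _).aestronglyMeasurable, ?_⟩
    rw [hasFiniteIntegral_iff_norm]
    simp only [Real.norm_eq_abs]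
    exact hlin.trans_lt (ENNReal.mul_lt_top ENNReal.ofReal_lt_top hBt.lt_top)
  have hconst : IntegrableOn (fun _ => u y₀) B μ := integrableOn_const hBt
  have hintu : IntegrableOn u B μ := by
    have := hint'.add hconst
    exact this.congr_fun_ae (Filter.Eventually.of_forall fun y => by simp)
  refine ⟨hintu, ?_⟩
  have hBr : 0 < μ.real B := ENNReal.toReal_pos hB0 hBt
  have havg : |⨍ z in B, u z ∂μ - u y₀| ≤ G / η * D := by
    have e1 : ⨍ z in B, u z ∂μ - u y₀ = (μ.real B)⁻¹ * ∫ z in B, (u z - u y₀) ∂μ := by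
      rw [integral_sub hintu hconst, setAverage_eq, setIntegral_const, smul_eq_mul, smul_eq_mul,
        mul_sub, inv_mul_cancel_left₀ hBr.ne']
    rw [e1, abs_mul, abs_of_pos (inv_pos.2 hBr), inv_mul_le_iff₀ hBr]
    calc |∫ z in B, (u z - u y₀) ∂μ| ≤ ∫ z in B, |u z - u y₀| ∂μ := abs_integral_le_integral_abs
      _ = (∫⁻ z in B, ENNReal.ofReal |u z - u y₀| ∂μ).toReal :=
          integral_eq_lintegral_of_nonneg_ae (Filter.Eventually.of_forall fun _ => abs_nonneg _)
            hint'.1.norm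
      _ ≤ (ENNReal.ofReal (G / η * D) * μ B).toReal :=
          ENNReal.toReal_mono (ENNReal.mul_ne_top ENNReal.ofReal_ne_top hBt) hlin
      _ = μ.real B * (G / η * D) := by
          rw [ENNReal.toReal_mul, ENNReal.toReal_ofReal (by positivity), mul_comm]; rfl
  simp only [Real.rpow_one]
  have hpt : ∀ y, ENNReal.ofReal (Real.exp (η / 2 * (|u y - ⨍ z in B, u z ∂μ| / Fr))) ≤
      ENNReal.ofReal (Real.exp D) * ENNReal.ofReal (Real.exp (η * |u y - u y₀| / G)) := by
    intro y
    rw [← ENNReal.ofReal_mul (by positivity), ← Real.exp_add]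
    refine ENNReal.ofReal_le_ofReal (Real.exp_le_exp.2 ?_)
    have h1 : |u y - ⨍ z in B, u z ∂μ| ≤ |u y - u y₀| + G / η * D := by
      have := abs_sub_le (u y) (u y₀) (⨍ z in B, u z ∂μ)
      rw [abs_sub_comm (u y₀)] at this
      linarith
    calc η / 2 * (|u y - ⨍ z in B, u z ∂μ| / Fr) = η / G * |u y - ⨍ z in B, u z ∂μ| := by
          rw [hGdef]; field_simp
      _ ≤ η / G * (|u y - u y₀| + G / η * D) := by gcongr
      _ = D + η * |u y - u y₀| / G := by field_simp; ring
  rw [setLAverage_eq, ENNReal.div_le_iff hB0 hBt] at hexp ⊢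
  calc _ ≤ ∫⁻ y in B, ENNReal.ofReal (Real.exp D) *
        ENNReal.ofReal (Real.exp (η * |u y - u y₀| / G)) ∂μ := lintegral_mono hpt
    _ = ENNReal.ofReal (Real.exp D) *
        ∫⁻ y in B, ENNReal.ofReal (Real.exp (η * |u y - u y₀| / G)) ∂μ :=
        lintegral_const_mul' _ _ ENNReal.ofReal_ne_top
    _ ≤ ENNReal.ofReal (Real.exp D) * (ENNReal.ofReal D * μ B) := by gcongr
    _ = _ := by rw [← mul_assoc, ← ENNReal.ofReal_mul (by positivity)]

/-- For `p > Q / s`, chains starting at both `x` and `y` with initial radius `ρ x y` give the Hölder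
estimate off a null set. -/
theorem exists_holder_off_null {ρ : X → X → ℝ} (hρ : IsQuasiMetric ρ) {μ : Measure X}
    {Q s p κ : ℝ} (hQ : 0 < Q) (hs : 0 < s) (hp : 0 < p) (hpQ : Q / s < p)
    {F : Set X → (X → ℝ) → ℝ≥0∞} (hF : ControlsGradient ρ μ s p F) (hκ : 0 < κ)
    (hμ : ∀ (x : X) (r : ℝ), 0 < r → ENNReal.ofReal r ≤ qdiam ρ →
      ENNReal.ofReal (κ * r ^ Q) ≤ μ (qball ρ x r)) :
    ∃ C : ℝ, 0 < C ∧ ∀ (u : X → ℝ) (G : ℝ), 0 < G → F univ u < ENNReal.ofReal G →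
      ∃ N : Set X, μ N = 0 ∧ ∀ x, x ∉ N → ∀ y, y ∉ N →
        |u x - u y| ≤ C * G * ρ x y ^ (s - Q / p) := by
  obtain ⟨K, hK1, hK, hK'⟩ := hρ.exists_const
  have hK0 : 0 < K := by positivity
  have hδ : Q / p - s < 0 := by
    rw [sub_neg, div_lt_iff₀ hp]
    rwa [div_lt_iff₀ hs, mul_comm] at hpQ
  have hδ1 : (2 : ℝ) ^ (Q / p - s) < 1 := Real.rpow_lt_one_of_one_lt_of_neg (by norm_num) hδ
  set S := 1 / (1 - (2 : ℝ) ^ (Q / p - s)) with hS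
  have hS0 : 0 < S := one_div_pos.2 (sub_pos.2 hδ1)
  set a := (2 / κ) ^ (1 / p) with ha
  have ha0 : 0 < a := by positivity
  refine ⟨(K ^ 2) ^ s * (2 * 2 ^ (Q / p)) * S * a + (K ^ 2) ^ s * (2 * a) +
    (K ^ 2) ^ s * (2 * 2 ^ (Q / p)) * S * a, by positivity, fun u G hG hFG => ?_⟩
  obtain ⟨g, ⟨hg0, hgm, N, hN, hg⟩, hint⟩ := hF univ u G nullMeasurableSet_univ hG hFG
  refine ⟨N, hN, fun x hx y hy => ?_⟩
  by_cases hxy : x = y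
  · subst hxy
    simp only [sub_self, abs_zero, hρ.self]
    have : (0 : ℝ) ≤ 0 ^ (s - Q / p) := Real.rpow_nonneg le_rfl _
    positivity
  set r := ρ x y with hr
  have hr0 : 0 < r := hρ.pos hxy
  have hlow := lower_bound_of_le hμ (ofReal_le_qdiam ρ x y)
  have hchain : ∀ w, w ∉ N → ∃ z ∈ qball ρ w r, z ∉ N ∧ g z ≤ a * G * r ^ (-(Q / p)) ∧
      |u w - u z| ≤ (K ^ 2) ^ s * (2 * 2 ^ (Q / p)) * S * a * G * r ^ (s - Q / p) := by
    intro w hw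
    obtain ⟨J, -, z, hz, hzN, hgz, huz⟩ := exists_chain hρ hK1 hK hK' hs hp hQ hκ hr0 hG hg0 hgm hN
      hg hint hw (subset_univ _) (hlow w) rfl
    refine ⟨z, hz, hzN, hgz, huz.trans ?_⟩
    calc _ ≤ (K ^ 2 * r) ^ s * (2 * (a * G * r ^ (-(Q / p))) * 2 ^ (Q / p)) * S := by
          gcongr
          exact sum_geometric_le hδ J
      _ = _ := by
          rw [Real.mul_rpow (by positivity) hr0.le, sub_eq_add_neg, Real.rpow_add hr0]
          ring
  obtain ⟨z, hz, hzN, hgz, huz⟩ := hchain x hx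
  obtain ⟨w, hw, hwN, hgw, huw⟩ := hchain y hy
  have hzw : ρ z w ≤ K ^ 2 * r := by
    have h1 : ρ z x ≤ K * r := (hK x z).trans (mul_le_mul_of_nonneg_left (le_of_lt hz) hK0.le)
    have h2 : ρ x w ≤ K * r :=
      (hK' x w y).trans (mul_le_mul_of_nonneg_left (max_le le_rfl (le_of_lt hw)) hK0.le)
    calc ρ z w ≤ K * max (ρ z x) (ρ x w) := hK' z w x
      _ ≤ K * (K * r) := by gcongr; exact max_le h1 h2
      _ = _ := by ring
  have hmid : |u z - u w| ≤ (K ^ 2) ^ s * (2 * a) * G * r ^ (s - Q / p) := by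
    calc |u z - u w| ≤ ρ z w ^ s * (g z + g w) := hg z ⟨trivial, hzN⟩ w ⟨trivial, hwN⟩
      _ ≤ (K ^ 2 * r) ^ s * (a * G * r ^ (-(Q / p)) + a * G * r ^ (-(Q / p))) := by
          have h1 := Real.rpow_le_rpow (hρ.nonneg _ _) hzw hs.le
          have h2 := hg0 z
          have h3 := hg0 w
          gcongr
      _ = _ := by
          rw [Real.mul_rpow (by positivity) hr0.le, sub_eq_add_neg, Real.rpow_add hr0]
          ring
  have h1 := abs_sub_le (u x) (u z) (u y)
  have h2 := abs_sub_le (u z) (u w) (u y)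
  rw [abs_sub_comm] at huw
  linarith

/-- A function that is Hölder continuous off a null set agrees almost everywhere with a function
that is Hölder continuous everywhere: null sets have dense complement, and the values at the
missing points are limits along sequences. -/
theorem exists_holder_extension {ρ : X → X → ℝ} {μ : Measure X}
    (hX : IsQuasiMetricMeasureSpace ρ μ) {α : ℝ} (hα : 0 < α) :
    ∃ C : ℝ, 0 < C ∧ ∀ (u : X → ℝ) (N : Set X) (A : ℝ), μ N = 0 → 0 ≤ A →
      (∀ x, x ∉ N → ∀ y, y ∉ N → |u x - u y| ≤ A * ρ x y ^ α) →
      ∃ v : X → ℝ, v =ᵐ[μ] u ∧ ∀ x y, |v x - v y| ≤ C * A * ρ x y ^ α := by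
  have hρ := hX.quasiMetric
  obtain ⟨K, hK1, hK, hK'⟩ := hρ.exists_const
  have hK0 : 0 < K := by positivity
  refine ⟨(K ^ 2) ^ α, by positivity, fun u N A hN hA hu => ?_⟩
  have happrox : ∀ (x : X) (n : ℕ), ∃ y, y ∉ N ∧ ρ x y < (1 / 2) ^ n ∧ (x ∉ N → y = x) := by
    intro x n
    by_cases hx : x ∈ N
    · by_contra! hcon
      have hsub : qball ρ x ((1 / 2) ^ n) ⊆ N := by
        intro y hy
        by_contra hyN
        exact (hcon y hyN hy).1 hx
      exact (hX.ball_pos x ((1 / 2) ^ n) (by positivity)).ne' (measure_mono_null hsub hN)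
    · exact ⟨x, hx, by rw [hρ.self]; positivity, fun _ => rfl⟩
  choose y hyN hyd hyx using happrox
  have hpow : ∀ {n m : ℕ}, n ≤ m → ((1 : ℝ) / 2) ^ m ≤ (1 / 2) ^ n := fun h =>
    pow_le_pow_of_le_one (by norm_num) (by norm_num) h
  have htend : Filter.Tendsto (fun n : ℕ => A * (K ^ 2 * (1 / 2 : ℝ) ^ n) ^ α) Filter.atTop
      (nhds 0) := by
    have h1 : Filter.Tendsto (fun n : ℕ => K ^ 2 * (1 / 2 : ℝ) ^ n) Filter.atTop (nhds 0) := by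
      simpa using (tendsto_pow_atTop_nhds_zero_of_lt_one (by norm_num : (0 : ℝ) ≤ 1 / 2)
        (by norm_num)).const_mul (K ^ 2)
    simpa [Real.zero_rpow hα.ne'] using (h1.rpow_const (Or.inr hα.le)).const_mul A
  have hcauchy : ∀ x, CauchySeq fun n => u (y x n) := by
    intro x
    refine cauchySeq_of_le_tendsto_0 (fun n => A * (K ^ 2 * (1 / 2 : ℝ) ^ n) ^ α)
      (fun n m l hn hm => ?_) htend
    rw [Real.dist_eq]
    refine (hu _ (hyN x n) _ (hyN x m)).trans ?_
    have h1 : ρ (y x n) x ≤ K * (1 / 2) ^ l :=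
      (hK _ _).trans (mul_le_mul_of_nonneg_left ((hyd x n).le.trans (hpow hn)) hK0.le)
    have h2 : ρ x (y x m) ≤ K * (1 / 2) ^ l :=
      ((hyd x m).le.trans (hpow hm)).trans (le_mul_of_one_le_left (by positivity) hK1)
    have h3 : ρ (y x n) (y x m) ≤ K ^ 2 * (1 / 2) ^ l := by
      calc ρ (y x n) (y x m) ≤ K * max (ρ (y x n) x) (ρ x (y x m)) := hK' _ _ x
        _ ≤ K * (K * (1 / 2) ^ l) := by gcongr; exact max_le h1 h2
        _ = _ := by ring
    have h4 := Real.rpow_le_rpow (hρ.nonneg _ _) h3 hα.le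
    gcongr
  choose v hv using fun x => cauchySeq_tendsto_of_complete (hcauchy x)
  refine ⟨v, ?_, fun x w => ?_⟩
  · filter_upwards [measure_eq_zero_iff_ae_notMem.1 hN] with x hx
    refine tendsto_nhds_unique (hv x) ?_
    simp_rw [fun n => hyx x n hx]
    exact tendsto_const_nhds
  · by_cases hxw : x = w
    · subst hxw
      simp [hρ.self, Real.zero_rpow hα.ne']
    have hpos := hρ.pos hxw
    have hlim : Filter.Tendsto (fun n => |u (y x n) - u (y w n)|) Filter.atTop
        (nhds |v x - v w|) := ((hv x).sub (hv w)).abs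
    refine le_of_tendsto hlim ?_
    have hev : ∀ᶠ n : ℕ in Filter.atTop, (1 / 2 : ℝ) ^ n < ρ x w :=
      (tendsto_pow_atTop_nhds_zero_of_lt_one (by norm_num : (0 : ℝ) ≤ 1 / 2)
        (by norm_num)).eventually_lt_const hpos
    filter_upwards [hev] with n hn
    have h1 : ρ (y x n) x ≤ K * ρ x w :=
      (hK _ _).trans (mul_le_mul_of_nonneg_left ((hyd x n).le.trans hn.le) hK0.le)
    have h2 : ρ x (y w n) ≤ K * ρ x w := (hK' x _ w).trans
      (mul_le_mul_of_nonneg_left (max_le le_rfl ((hyd w n).le.trans hn.le)) hK0.le)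
    have h3 : ρ (y x n) (y w n) ≤ K ^ 2 * ρ x w := by
      calc ρ (y x n) (y w n) ≤ K * max (ρ (y x n) x) (ρ x (y w n)) := hK' _ _ x
        _ ≤ K * (K * ρ x w) := by gcongr; exact max_le h1 h2
        _ = _ := by ring
    calc |u (y x n) - u (y w n)| ≤ A * ρ (y x n) (y w n) ^ α := hu _ (hyN x n) _ (hyN w n)
      _ ≤ A * (K ^ 2 * ρ x w) ^ α := by
          have h4 := Real.rpow_le_rpow (hρ.nonneg _ _) h3 hα.le
          gcongr
      _ = _ := by rw [Real.mul_rpow (by positivity) hpos.le]; ring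

theorem LowerAhlforsRegular.holderEst {ρ : X → X → ℝ} {μ : Measure X}
    (hX : IsQuasiMetricMeasureSpace ρ μ) {Q s p : ℝ} (hQ : 0 < Q)
    (hs : 0 < s) (hpQ : Q / s < p) {F : Set X → (X → ℝ) → ℝ≥0∞}
    (hF : ControlsGradient ρ μ s p F) (h : LowerAhlforsRegular ρ μ Q) :
    HolderEst ρ μ Q s p F := by
  have hp : 0 < p := lt_trans (by positivity) hpQ
  obtain ⟨κ, hκ, hμ⟩ := h
  have hα : 0 < s - Q / p := by
    rw [sub_pos, div_lt_iff₀ hp]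
    rwa [div_lt_iff₀ hs, mul_comm] at hpQ
  obtain ⟨C₁, hC₁, hoff⟩ := exists_holder_off_null hX.quasiMetric hQ hs hp hpQ hF hκ hμ
  obtain ⟨C₂, hC₂, hext⟩ := exists_holder_extension hX hα
  refine ⟨C₂ * C₁, by positivity, fun u hu => ?_⟩
  set Fr := (F univ u).toReal with hFr
  have hFr' : F univ u = ENNReal.ofReal Fr := (ENNReal.ofReal_toReal hu.2.ne).symm
  have hFr0 : 0 ≤ Fr := ENNReal.toReal_nonneg
  -- the null set depends on the gradient; a countable union serves for a minimising sequence
  have hG : ∀ n : ℕ, 0 < Fr + 1 / ((n : ℝ) + 1) := fun n => by positivity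
  choose N hN hNu using fun n : ℕ => hoff u (Fr + 1 / ((n : ℝ) + 1)) (hG n) (by
    rw [hFr']
    refine (ENNReal.ofReal_lt_ofReal_iff (hG n)).2 ?_
    have : 0 < 1 / ((n : ℝ) + 1) := by positivity
    linarith)
  obtain ⟨v, hvu, hv⟩ := hext u (⋃ n, N n) (C₁ * Fr) (measure_iUnion_null hN) (by positivity) (by
    intro x hx y hy
    rw [mem_iUnion, not_exists] at hx hy
    have hlim : Filter.Tendsto (fun n : ℕ => C₁ * (Fr + 1 / ((n : ℝ) + 1)) * ρ x y ^ (s - Q / p))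
        Filter.atTop (nhds (C₁ * (Fr + 0) * ρ x y ^ (s - Q / p))) :=
      ((tendsto_one_div_add_atTop_nhds_zero_nat.const_add Fr).const_mul C₁).mul_const _
    rw [add_zero] at hlim
    exact ge_of_tendsto' hlim fun n => hNu n x (hx n) y (hy n))
  refine ⟨v, hvu, fun x y => ?_⟩
  have := Real.rpow_nonneg (hX.quasiMetric.nonneg x y) (s - Q / p)
  rw [hFr', ← ENNReal.ofReal_mul (by positivity)]
  refine ENNReal.ofReal_le_ofReal ((hv x y).trans (le_of_eq ?_))
  ring

end Hajlasz

namespace Hajlasz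

variable {X : Type*}

/-! ### Test functions and the growth of measure -/

/-- The De Giorgi type iteration behind the necessity of lower regularity: a superlinear recursive
inequality would force the sequence to tend to zero if `m` were small compared to `r ^ Q`. -/
theorem exists_le_of_iteration {C D θ : ℝ} (Q : ℝ) (hC : 0 < C) (hD : 1 ≤ D) (hθ : 1 < θ) :
    ∃ ε : ℝ, 0 < ε ∧ ∀ (r m η : ℝ) (a : ℕ → ℝ), 0 < r → 0 < η → (∀ j, η ≤ a j) → a 0 ≤ m →
      (∀ j, a (j + 1) ≤ C * m * r ^ (-(Q * θ)) * D ^ j * a j ^ θ) → ε * r ^ Q ≤ m := by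
  have hθ1 : 0 < θ - 1 := sub_pos.2 hθ
  have hθ0 : 0 < θ := by linarith
  set l := (2 * D) ^ (-(1 / (θ - 1))) with hl
  have hl0 : 0 < l := by positivity
  have hl1 : l < 1 := Real.rpow_lt_one_of_one_lt_of_neg (by linarith)
    (neg_neg_of_pos (by positivity))
  have hDl : D * l ^ (θ - 1) ≤ 1 := by
    rw [hl, ← Real.rpow_mul (by positivity), neg_mul, one_div_mul_cancel hθ1.ne',
      Real.rpow_neg_one]
    have : D ≠ 0 := by positivity
    field_simp
    norm_num
  refine ⟨(l / C) ^ (1 / θ), by positivity, fun r m η a hr hη ha ha0 hstep => ?_⟩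
  by_contra! hm
  have hm0 : 0 < m := (hη.trans_le (ha 0)).trans_le ha0
  have hrQ : 0 < r ^ Q := by positivity
  have hsmall : C * (m ^ θ * r ^ (-(Q * θ))) ≤ l := by
    have h1 : (m / r ^ Q) ^ θ ≤ l / C := by
      calc (m / r ^ Q) ^ θ ≤ ((l / C) ^ (1 / θ)) ^ θ :=
            Real.rpow_le_rpow (by positivity) ((div_le_iff₀ hrQ).2 hm.le) hθ0.le
        _ = l / C := by
            rw [← Real.rpow_mul (by positivity), one_div_mul_cancel hθ0.ne', Real.rpow_one]
    rw [le_div_iff₀ hC, Real.div_rpow hm0.le hrQ.le, ← Real.rpow_mul hr.le] at h1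
    rw [Real.rpow_neg hr.le, ← div_eq_mul_inv]
    linarith
  have hbound : ∀ j, a j ≤ m * l ^ j := by
    intro j
    induction j with
    | zero => simpa using ha0
    | succ j ih =>
      have hpos : 0 ≤ a j := hη.le.trans (ha j)
      have h1 : a j ^ θ ≤ m ^ θ * (l ^ j * (l ^ (θ - 1)) ^ j) := by
        calc a j ^ θ ≤ (m * l ^ j) ^ θ := Real.rpow_le_rpow hpos ih hθ0.le
          _ = m ^ θ * (l ^ θ) ^ j := by
              rw [Real.mul_rpow hm0.le (by positivity), Real.rpow_pow_comm hl0.le]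
          _ = _ := by
              rw [← mul_pow, ← Real.rpow_one_add' hl0.le (by linarith)]
              congr 3; ring
      have h2 : (D * l ^ (θ - 1)) ^ j ≤ 1 := pow_le_one₀ (by positivity) hDl
      calc a (j + 1) ≤ C * m * r ^ (-(Q * θ)) * D ^ j * a j ^ θ := hstep j
        _ ≤ C * m * r ^ (-(Q * θ)) * D ^ j * (m ^ θ * (l ^ j * (l ^ (θ - 1)) ^ j)) := by gcongr
        _ = m * l ^ j * (C * (m ^ θ * r ^ (-(Q * θ)))) * (D * l ^ (θ - 1)) ^ j := by
            rw [mul_pow]; ring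
        _ ≤ m * l ^ j * l * 1 := by gcongr
        _ = m * l ^ (j + 1) := by ring
  have hlim : Filter.Tendsto (fun j : ℕ => m * l ^ j) Filter.atTop (nhds (m * 0)) :=
    (tendsto_pow_atTop_nhds_zero_of_lt_one hl0.le hl1).const_mul m
  rw [mul_zero] at hlim
  exact absurd (ge_of_tendsto' hlim fun j => (ha j).trans (hbound j)) (not_le.2 hη)

/-- The composition of `h` with the piecewise linear cutoff that is `1` below level `a` and `0`
above level `b`. -/
noncomputable def cutoff (a b : ℝ) (h : X → ℝ) (y : X) : ℝ := max 0 (min 1 ((b - h y) / (b - a)))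

theorem cutoff_nonneg (a b : ℝ) (h : X → ℝ) (y : X) : 0 ≤ cutoff a b h y := le_max_left _ _

theorem cutoff_le_one (a b : ℝ) (h : X → ℝ) (y : X) : cutoff a b h y ≤ 1 :=
  max_le zero_le_one (min_le_left _ _)

theorem cutoff_eq_one {a b : ℝ} (hab : a < b) {h : X → ℝ} {y : X} (hy : h y ≤ a) :
    cutoff a b h y = 1 := by
  have : 1 ≤ (b - h y) / (b - a) := by
    rw [le_div_iff₀ (sub_pos.2 hab)]; linarith
  rw [cutoff, min_eq_left this, max_eq_right zero_le_one]

theorem cutoff_eq_zero {a b : ℝ} (hab : a < b) {h : X → ℝ} {y : X} (hy : b ≤ h y) :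
    cutoff a b h y = 0 := by
  have : (b - h y) / (b - a) ≤ 0 := div_nonpos_of_nonpos_of_nonneg (by linarith) (by linarith)
  exact max_eq_left ((min_le_right _ _).trans this)

theorem abs_cutoff_sub_le {a b : ℝ} (hab : a < b) (h : X → ℝ) (y w : X) :
    |cutoff a b h y - cutoff a b h w| ≤ |h y - h w| / (b - a) := by
  unfold cutoff
  refine (abs_max_sub_max_le_max _ _ _ _).trans ?_
  have hpos : 0 ≤ |h y - h w| / (b - a) := div_nonneg (abs_nonneg _) (sub_nonneg.2 hab.le)
  refine max_le (by simpa using hpos) ?_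
  refine (abs_min_sub_min_le_max _ _ _ _).trans (max_le (by simpa using hpos) ?_)
  rw [← sub_div, abs_div, abs_of_pos (sub_pos.2 hab), sub_sub_sub_cancel_left, abs_sub_comm]

variable [MeasurableSpace X]

/-- A sequence of test functions for the ball `B(x, r)`: `u j` is `1` on `A (j + 1)` and vanishes
off `A j`, where the sets `A j` decrease, have measures bounded below, and leave room in the ball;
the seminorm of `u j` grows at most geometrically relative to the size of `A j`. -/
structure IsBumpSequence (ρ : X → X → ℝ) (μ : Measure X) (F : Set X → (X → ℝ) → ℝ≥0∞)
    (s p C D : ℝ) (x : X) (r : ℝ) (u : ℕ → X → ℝ) (A : ℕ → Set X) : Prop where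
  measurableSet : ∀ j, MeasurableSet (A j)
  measurable : ∀ j, Measurable (u j)
  antitone : ∀ j, A (j + 1) ⊆ A j
  subset : ∀ j, A j ⊆ qball ρ x r
  lower : ∃ η : ℝ, 0 < η ∧ ∀ j, ENNReal.ofReal η ≤ μ (A j)
  le_diff : ∀ j, μ (A (j + 1)) ≤ μ (qball ρ x r \ A j)
  nonneg : ∀ j y, 0 ≤ u j y
  le_one : ∀ j y, u j y ≤ 1
  eq_one : ∀ j, ∀ y ∈ A (j + 1), u j y = 1
  eq_zero : ∀ j, ∀ y, y ∉ A j → u j y = 0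
  norm_le : ∀ j E, F E (u j) ≤ ENNReal.ofReal (C * r ^ (-s) * D ^ j) * μ (A j) ^ (1 / p)

theorem exists_bumpSequence {ρ : X → X → ℝ} {μ : Measure X}
    (hX : IsQuasiMetricMeasureSpace ρ μ) (hup : UniformlyPerfect ρ) {q : ℝ≥0∞} {s p : ℝ}
    (hs : 0 < s) (hind : PrecIndex ρ q s) {F : Set X → (X → ℝ) → ℝ≥0∞}
    (hF : ∀ α, s ≤ α → (s = α → q = ∞) → BoundsBumps ρ μ s p α F) :
    ∃ C D : ℝ, 0 < C ∧ 1 ≤ D ∧ ∀ (x : X) (r : ℝ), 0 < r → ENNReal.ofReal r ≤ qdiam ρ →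
      ∃ u A, IsBumpSequence ρ μ F s p C D x r u A := by
  obtain ⟨α, c, hsα, hαq, hc, hbump⟩ := exists_bump_gauge hX hup hs hind
  obtain ⟨C, hC, hCF⟩ := hF α hsα hαq
  have hα : 0 < α := hs.trans_le hsα
  refine ⟨C * (4 * c) ^ (s / α), 2 ^ (s / α), by positivity,
    Real.one_le_rpow (by norm_num) (by positivity), fun x r hr hrd => ?_⟩
  obtain ⟨h, hm, hh, hsub, hpos, hle⟩ := hbump x r hr hrd
  set τ : ℕ → ℝ := fun j => (1 + (1 / 2) ^ j) / 2 with hτ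
  have hτsub : ∀ j, τ j - τ (j + 1) = (4 * 2 ^ j)⁻¹ := by
    intro j; simp only [hτ, pow_succ, one_div, inv_pow]; field_simp; ring
  have hτlt : ∀ j, τ (j + 1) < τ j := fun j => by
    rw [← sub_pos, hτsub]; positivity
  have hτ1 : ∀ j, τ j ≤ 1 := fun j => by
    have : ((1 : ℝ) / 2) ^ j ≤ 1 := pow_le_one₀ (by norm_num) (by norm_num)
    simp only [hτ]; linarith
  have hτ2 : ∀ j, 1 / 2 ≤ τ j := fun j => by
    have : (0 : ℝ) ≤ (1 / 2) ^ j := by positivity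
    simp only [hτ]; linarith
  have hAsub : ∀ j, {y | h y < τ j} ⊆ {y | h y < 1} := fun j y hy => lt_of_lt_of_le hy (hτ1 j)
  have hfin : μ {y | h y < 1 / 2} < ∞ := (measure_mono (fun y (hy : h y < 1 / 2) => hsub
    (show h y < 1 by linarith))).trans_lt (hX.ball_lt_top x r hr)
  have hAm : ∀ j, MeasurableSet {y | h y < τ j} := fun j => measurableSet_lt hm measurable_const
  refine ⟨fun j => cutoff (τ (j + 1)) (τ j) h, fun j => {y | h y < τ j}, hAm, fun j => ?_,
    fun j y hy => lt_trans hy (hτlt j), fun j => (hAsub j).trans hsub,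
    ⟨(μ {y | h y < 1 / 2}).toReal, ENNReal.toReal_pos hpos.ne' hfin.ne, fun j => ?_⟩, fun j => ?_,
    fun j => cutoff_nonneg _ _ _, fun j => cutoff_le_one _ _ _,
    fun j y hy => cutoff_eq_one (hτlt j) (le_of_lt hy),
    fun j y hy => cutoff_eq_zero (hτlt j) (not_lt.1 hy), fun j E => ?_⟩
  · exact measurable_const.max (measurable_const.min ((measurable_const.sub hm).div_const _))
  · rw [ENNReal.ofReal_toReal hfin.ne]
    exact measure_mono fun y (hy : h y < 1 / 2) => lt_of_lt_of_le hy (hτ2 j)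
  · exact ((measure_mono (hAsub _)).trans hle).trans
      (measure_mono (sdiff_subset_sdiff_right (hAsub j)))
  · have hL : 0 < c * r ^ (-α) * (4 * 2 ^ j) := by positivity
    refine (hCF E _ _ _ hL (hAm j) (fun y w => ?_) (fun y w => ?_)
      (fun y hy => cutoff_eq_zero (hτlt j) (not_lt.1 hy))).trans (le_of_eq ?_)
    · rw [abs_le]
      constructor <;> linarith [cutoff_nonneg (τ (j + 1)) (τ j) h y,
        cutoff_nonneg (τ (j + 1)) (τ j) h w, cutoff_le_one (τ (j + 1)) (τ j) h y,
        cutoff_le_one (τ (j + 1)) (τ j) h w]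
    · refine (abs_cutoff_sub_le (hτlt j) h y w).trans ?_
      rw [hτsub, div_inv_eq_mul]
      have := hh y w
      calc |h y - h w| * (4 * 2 ^ j) ≤ c * r ^ (-α) * ρ y w ^ α * (4 * 2 ^ j) := by gcongr
        _ = _ := by ring
    · have e : (c * r ^ (-α) * (4 * 2 ^ j)) ^ (s / α) =
          (4 * c) ^ (s / α) * r ^ (-s) * (2 ^ (s / α)) ^ j := by
        rw [show c * r ^ (-α) * (4 * 2 ^ j) = 4 * c * r ^ (-α) * 2 ^ j by ring,
          Real.mul_rpow (by positivity) (by positivity),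
          Real.mul_rpow (by positivity) (by positivity), ← Real.rpow_mul hr.le,
          Real.rpow_pow_comm (by norm_num), neg_mul, mul_div_cancel₀ _ hα.ne']
      rw [e]; congr 2; ring

namespace IsBumpSequence

variable {ρ : X → X → ℝ} {μ : Measure X} {F : Set X → (X → ℝ) → ℝ≥0∞} {s p C D r : ℝ} {x : X}
  {u : ℕ → X → ℝ} {A : ℕ → Set X}

theorem measure_ne_zero (h : IsBumpSequence ρ μ F s p C D x r u A) (j : ℕ) : μ (A j) ≠ 0 := by
  obtain ⟨η, hη, hηA⟩ := h.lower
  exact (lt_of_lt_of_le (ENNReal.ofReal_pos.2 hη) (hηA j)).ne'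

theorem measure_ne_top (h : IsBumpSequence ρ μ F s p C D x r u A) (hB : μ (qball ρ x r) < ∞)
    (j : ℕ) : μ (A j) ≠ ∞ :=
  ((measure_mono (h.subset j)).trans_lt hB).ne

theorem memSpace (h : IsBumpSequence ρ μ F s p C D x r u A) (hp : 0 < p)
    (hB : μ (qball ρ x r) < ∞) (j : ℕ) (E : Set X) : MemSpace μ F E (u j) :=
  ⟨(h.measurable j).aemeasurable, (h.norm_le j E).trans_lt (ENNReal.mul_lt_top
    ENNReal.ofReal_lt_top (ENNReal.rpow_lt_top_of_nonneg (by positivity)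
      (h.measure_ne_top hB j)))⟩

/-- Whatever constant `γ` is subtracted from `u j`, the difference is at least `1 / 2` on a set of
measure at least `μ (A (j + 1))`. -/
theorem le_laverage (h : IsBumpSequence ρ μ F s p C D x r u A)
    (hBm : NullMeasurableSet (qball ρ x r) μ) (j : ℕ) (γ : ℝ) {c : ℝ≥0∞} {f : X → ℝ≥0∞}
    (hf : ∀ y, 1 / 2 ≤ |u j y - γ| → c ≤ f y) :
    c * (μ (A (j + 1)) / μ (qball ρ x r)) ≤ ⨍⁻ y in qball ρ x r, f y ∂μ := by
  obtain ⟨S, hSB, hSm, hS, hSγ⟩ : ∃ S ⊆ qball ρ x r, NullMeasurableSet S μ ∧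
      μ (A (j + 1)) ≤ μ S ∧ ∀ y ∈ S, 1 / 2 ≤ |u j y - γ| := by
    rcases le_total γ (1 / 2) with hγ | hγ
    · refine ⟨A (j + 1), h.subset _, (h.measurableSet _).nullMeasurableSet, le_rfl, fun y hy => ?_⟩
      rw [h.eq_one j y hy]
      exact le_trans (by linarith) (le_abs_self _)
    · refine ⟨qball ρ x r \ A j, sdiff_subset, hBm.diff (h.measurableSet _).nullMeasurableSet,
        h.le_diff j, fun y hy => ?_⟩
      rw [h.eq_zero j y hy.2]
      exact le_trans (by linarith) (neg_le_abs _)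
  rw [setLAverage_eq, ← mul_div_assoc]
  gcongr
  calc c * μ (A (j + 1)) ≤ c * μ S := by gcongr
    _ = ∫⁻ _ in S, c ∂μ := (setLIntegral_const _ _).symm
    _ ≤ ∫⁻ y in S, f y ∂μ := lintegral_mono_ae (by
        filter_upwards [ae_restrict_mem₀ hSm] with y hy
        exact hf y (hSγ y hy))
    _ ≤ ∫⁻ y in qball ρ x r, f y ∂μ := lintegral_mono_set hSB

theorem lebNorm_le (h : IsBumpSequence ρ μ F s p C D x r u A) (hp : 0 < p) (j : ℕ) (E : Set X) :
    lebNorm μ p E (fun y => ENNReal.ofReal |u j y|) ≤ μ (A j) ^ (1 / p) := by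
  have h1 : lebNorm μ p E (fun y => ENNReal.ofReal |u j y|) ≤
      lebNorm μ p E (fun y => 1 * (A j).indicator 1 y) := by
    refine ENNReal.rpow_le_rpow (lintegral_mono fun y => ENNReal.rpow_le_rpow ?_ hp.le)
      (by positivity)
    by_cases hy : y ∈ A j
    · simp only [hy, indicator_of_mem, Pi.one_apply, mul_one]
      rw [← ENNReal.ofReal_one, abs_of_nonneg (h.nonneg j y)]
      exact ENNReal.ofReal_le_ofReal (h.le_one j y)
    · simp [h.eq_zero j y hy]
  refine h1.trans ((lebNorm_const_indicator_le μ hp E (h.measurableSet j) 1).trans ?_)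
  rw [one_mul]

/-- A seminorm that controls Hajłasz gradients cannot vanish on a test function: gradients of
arbitrarily small norm are small at some points of both level sets `{u j = 1}` and `{u j = 0}`. -/
theorem norm_pos (h : IsBumpSequence ρ μ F s p C D x r u A) (hρ : IsQuasiMetric ρ) (hp : 0 < p)
    (hs : 0 < s) (hr : 0 < r) (hF : ControlsGradient ρ μ s p F)
    (hB : μ (qball ρ x r) < ∞) {E : Set X} (hE : NullMeasurableSet E μ)
    (hBE : qball ρ x r ⊆ E) (j : ℕ) : 0 < F E (u j) := by
  rw [pos_iff_ne_zero]
  intro h0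
  obtain ⟨K, hK1, hK, hK'⟩ := hρ.exists_const
  have hK0 : 0 < K := by positivity
  set m := (μ (A (j + 1))).toReal with hm
  have hm0 : 0 < m := ENNReal.toReal_pos (h.measure_ne_zero _) (h.measure_ne_top hB _)
  have hmA : ENNReal.ofReal (m * 1 ^ (1 : ℝ)) ≤ μ (A (j + 1)) := by
    rw [Real.one_rpow, mul_one, ENNReal.ofReal_toReal (h.measure_ne_top hB _)]
  set R := (K * (K * r)) ^ s with hR
  have hR0 : 0 < R := by positivity
  set a := (2 / m) ^ (1 / p) with ha
  have ha0 : 0 < a := by positivity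
  set G := 1 / (4 * R * a) with hG
  have hG0 : 0 < G := by positivity
  obtain ⟨g, ⟨hg0, hgm, N, hN, hg⟩, hint⟩ := hF E (u j) G hE hG0 (by
    rw [h0]; exact ENNReal.ofReal_pos.2 hG0)
  obtain ⟨y, hy, hyN, hgy⟩ := exists_good_point hm0 hp one_pos hG0 hgm hint
    ((h.subset _).trans hBE) hmA hN
  obtain ⟨w, hw, hwN, hgw⟩ := exists_good_point hm0 hp one_pos hG0 hgm hint
    (sdiff_subset.trans hBE) (hmA.trans (h.le_diff j)) hN
  rw [Real.one_rpow, mul_one, ← ha] at hgy hgw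
  have hyB := h.subset _ hy
  have h1 : ρ y x ≤ K * r := (hK x y).trans (mul_le_mul_of_nonneg_left (le_of_lt hyB) hK0.le)
  have h2 : ρ x w ≤ K * r := (le_of_lt hw.1).trans (le_mul_of_one_le_left hr.le hK1)
  have h3 : ρ y w ≤ K * (K * r) :=
    (hK' y w x).trans (mul_le_mul_of_nonneg_left (max_le h1 h2) hK0.le)
  have h4 : ρ y w ^ s ≤ R := Real.rpow_le_rpow (hρ.nonneg _ _) h3 hs.le
  have h5 := hg y ⟨hBE hyB, hyN⟩ w ⟨hBE hw.1, hwN⟩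
  rw [h.eq_one j y hy, h.eq_zero j w hw.2, sub_zero, abs_one] at h5
  have h6 : ρ y w ^ s * (g y + g w) ≤ R * (a * G + a * G) := by
    have h7 := hg0 y
    have h8 := hg0 w
    gcongr
  have h9 : R * (a * G + a * G) = 1 / 2 := by rw [hG]; field_simp; norm_num
  linarith

end IsBumpSequence

/-! ### Lower Ahlfors regularity from the embeddings -/

/-- A Sobolev type lower bound along bump sequences is a recursive inequality of exponent
`P / p > 1` for the measures of their supports, and hence implies lower regularity. -/
theorem lowerAhlforsRegular_of_bumps {ρ : X → X → ℝ} {μ : Measure X}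
    (hX : IsQuasiMetricMeasureSpace ρ μ) {F : Set X → (X → ℝ) → ℝ≥0∞} {s p C D C' Q P : ℝ}
    (hp : 0 < p) (hpP : p < P) (hC' : 0 < C') (hD : 1 ≤ D)
    (hseq : ∀ (x : X) (r : ℝ), 0 < r → ENNReal.ofReal r ≤ qdiam ρ →
      ∃ u A, IsBumpSequence ρ μ F s p C D x r u A ∧
        ∀ j, (ENNReal.ofReal ((1 / 2) ^ P) * (μ (A (j + 1)) / μ (qball ρ x r))) ^ (1 / P) ≤
          ENNReal.ofReal (C' * r ^ (-(Q / p)) * D ^ j) * μ (A j) ^ (1 / p)) :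
    LowerAhlforsRegular ρ μ Q := by
  have hP : 0 < P := hp.trans hpP
  obtain ⟨ε, hε, hit⟩ := exists_le_of_iteration (C := (2 * C') ^ P) (D := D ^ P) (θ := P / p) Q
    (by positivity) (Real.one_le_rpow hD hP.le) (by rwa [one_lt_div hp])
  refine ⟨ε, hε, fun x r hr hrd => ?_⟩
  obtain ⟨u, A, h, hstep⟩ := hseq x r hr hrd
  have hBt := hX.ball_lt_top x r hr
  have hAt := h.measure_ne_top hBt
  set m := (μ (qball ρ x r)).toReal with hm
  have hm0 : 0 < m := ENNReal.toReal_pos (hX.ball_pos x r hr).ne' hBt.ne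
  have hmB : μ (qball ρ x r) = ENNReal.ofReal m := (ENNReal.ofReal_toReal hBt.ne).symm
  set a : ℕ → ℝ := fun j => (μ (A j)).toReal with ha
  have haA : ∀ j, μ (A j) = ENNReal.ofReal (a j) := fun j => (ENNReal.ofReal_toReal (hAt j)).symm
  have ha0 : ∀ j, 0 < a j := fun j => ENNReal.toReal_pos (h.measure_ne_zero j) (hAt j)
  obtain ⟨η, hη, hηA⟩ := h.lower
  rw [hmB]
  refine ENNReal.ofReal_le_ofReal (hit r m η a hr hη (fun j => ?_) ?_ fun j => ?_)
  · have := hηA j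
    rwa [haA, ENNReal.ofReal_le_ofReal_iff (ha0 j).le] at this
  · exact ENNReal.toReal_mono hBt.ne (measure_mono (h.subset 0))
  · have h1 := hstep j
    have ha1 := ha0 (j + 1)
    have ha2 := ha0 j
    rw [haA, haA, hmB, ← ENNReal.ofReal_div_of_pos hm0, ← ENNReal.ofReal_mul (by positivity),
      ENNReal.ofReal_rpow_of_pos (by positivity), ENNReal.ofReal_rpow_of_pos ha2,
      ← ENNReal.ofReal_mul (by positivity), ENNReal.ofReal_le_ofReal_iff (by positivity)] at h1
    have h2 := Real.rpow_le_rpow (by positivity) h1 hP.le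
    rw [← Real.rpow_mul (by positivity), one_div_mul_cancel hP.ne', Real.rpow_one,
      Real.mul_rpow (by positivity) (by positivity), Real.mul_rpow (by positivity) (by positivity),
      Real.mul_rpow (by positivity) (by positivity), ← Real.rpow_mul hr.le, ← Real.rpow_mul ha2.le,
      ← Real.rpow_pow_comm (by positivity)] at h2
    have e1 : -(Q / p) * P = -(Q * (P / p)) := by ring
    have e2 : 1 / p * P = P / p := by ring
    rw [e1, e2, Real.div_rpow zero_le_one zero_le_two, Real.one_rpow, div_mul_div_comm, one_mul,
      div_le_iff₀ (by positivity)] at h2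
    rw [Real.mul_rpow zero_le_two hC'.le]
    refine h2.trans (le_of_eq ?_)
    ring

theorem sobolevExponent_gt {Q s p : ℝ} (hs : 0 < s) (hp : 0 < p) (hpQ : p < Q / s) :
    p < Q * p / (Q - s * p) := by
  have hsp : s * p < Q := by rwa [lt_div_iff₀ hs, mul_comm] at hpQ
  rw [lt_div_iff₀ (by linarith)]
  have : 0 < p * (s * p) := by positivity
  linarith

theorem SobolevPoincareIneq.lowerAhlforsRegular {ρ : X → X → ℝ} {μ : Measure X}
    (hX : IsQuasiMetricMeasureSpace ρ μ) (hup : UniformlyPerfect ρ) {q : ℝ≥0∞} {Q σ s p : ℝ}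
    (hs : 0 < s) (hp : 0 < p) (hpQ : p < Q / s) (hind : PrecIndex ρ q s)
    {F : Set X → (X → ℝ) → ℝ≥0∞} (hF : ∀ α, s ≤ α → (s = α → q = ∞) → BoundsBumps ρ μ s p α F)
    (h : SobolevPoincareIneq ρ μ Q σ s p F) : LowerAhlforsRegular ρ μ Q := by
  obtain ⟨C, D, hC, hD, hseq⟩ := exists_bumpSequence hX hup hs hind hF
  obtain ⟨C', hC', h⟩ := h
  have hpP := sobolevExponent_gt hs hp hpQ
  set P := Q * p / (Q - s * p) with hPdef
  have hP : 0 < P := hp.trans hpP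
  refine lowerAhlforsRegular_of_bumps (F := F) (s := s) (C := C) hX hp hpP
    (by positivity : 0 < C' * C) hD (fun x r hr hrd => ?_)
  obtain ⟨u, A, hu⟩ := hseq x r hr hrd
  refine ⟨u, A, hu, fun j => ?_⟩
  have hBt := hX.ball_lt_top x r hr
  have h1 := h x r hr hrd (u j) (hu.memSpace hp hBt j _)
  calc _ ≤ _ := le_iInf fun γ => ENNReal.rpow_le_rpow
        (hu.le_laverage (hX.ball_measurable x r hr) j γ fun y hy => by
          rw [ENNReal.ofReal_rpow_of_nonneg (abs_nonneg _) hP.le]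
          exact ENNReal.ofReal_le_ofReal (Real.rpow_le_rpow (by norm_num) hy hP.le)) (by positivity)
    _ ≤ _ := h1
    _ ≤ ENNReal.ofReal (C' * r ^ (s - Q / p)) *
        (ENNReal.ofReal (C * r ^ (-s) * D ^ j) * μ (A j) ^ (1 / p)) := by
        gcongr; exact hu.norm_le j _
    _ = _ := by
        rw [← mul_assoc, ← ENNReal.ofReal_mul (by positivity)]
        congr 2
        rw [show -(Q / p) = s - Q / p + -s by ring, Real.rpow_add hr (s - Q / p)]
        ring

theorem SobolevIneq.lowerAhlforsRegular {ρ : X → X → ℝ} {μ : Measure X}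
    (hX : IsQuasiMetricMeasureSpace ρ μ) (hup : UniformlyPerfect ρ) {q : ℝ≥0∞} {Q σ s p : ℝ}
    (hs : 0 < s) (hp : 0 < p) (hpQ : p < Q / s) (hind : PrecIndex ρ q s)
    {F : Set X → (X → ℝ) → ℝ≥0∞} (hF : ∀ α, s ≤ α → (s = α → q = ∞) → BoundsBumps ρ μ s p α F)
    (h : SobolevIneq ρ μ Q σ s p F) : LowerAhlforsRegular ρ μ Q := by
  obtain ⟨C, D, hC, hD, hseq⟩ := exists_bumpSequence hX hup hs hind hF
  obtain ⟨C', hC', h⟩ := h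
  have hpP := sobolevExponent_gt hs hp hpQ
  set P := Q * p / (Q - s * p) with hPdef
  have hP : 0 < P := hp.trans hpP
  refine lowerAhlforsRegular_of_bumps (F := F) (s := s) (C := C) hX hp hpP
    (by positivity : 0 < C' * (C + 1)) hD (fun x r hr hrd => ?_)
  obtain ⟨u, A, hu⟩ := hseq x r hr hrd
  refine ⟨u, A, hu, fun j => ?_⟩
  have hBt := hX.ball_lt_top x r hr
  have h1 := h x r hr hrd (u j) (hu.memSpace hp hBt j _)
  have hDj : 1 ≤ D ^ j := one_le_pow₀ hD
  calc _ ≤ _ := ENNReal.rpow_le_rpow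
        (hu.le_laverage (hX.ball_measurable x r hr) j 0
          (f := fun y => ENNReal.ofReal |u j y| ^ P) fun y hy => by
          rw [sub_zero] at hy
          rw [ENNReal.ofReal_rpow_of_nonneg (abs_nonneg _) hP.le]
          exact ENNReal.ofReal_le_ofReal (Real.rpow_le_rpow (by norm_num) hy hP.le)) (by positivity)
    _ ≤ _ := h1
    _ ≤ ENNReal.ofReal (C' * r ^ (-(Q / p))) *
        (ENNReal.ofReal (r ^ s) * (ENNReal.ofReal (C * r ^ (-s) * D ^ j) * μ (A j) ^ (1 / p)) +
          ENNReal.ofReal (D ^ j) * μ (A j) ^ (1 / p)) := by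
        gcongr
        · exact hu.norm_le j _
        · refine (hu.lebNorm_le hp j _).trans (le_mul_of_one_le_left' ?_)
          rw [← ENNReal.ofReal_one]
          exact ENNReal.ofReal_le_ofReal hDj
    _ = _ := by
        rw [← mul_assoc (ENNReal.ofReal (r ^ s)), ← ENNReal.ofReal_mul (by positivity), ← add_mul,
          ← ENNReal.ofReal_add (by positivity) (by positivity), ← mul_assoc,
          ← ENNReal.ofReal_mul (by positivity)]
        congr 2
        have : r ^ s * r ^ (-s) = 1 := by rw [← Real.rpow_add hr, add_neg_cancel, Real.rpow_zero]
        rw [show r ^ s * (C * r ^ (-s) * D ^ j) = r ^ s * r ^ (-s) * (C * D ^ j) by ring, this]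
        ring

/-- The exponential dominates every power. -/
theorem exists_rpow_le_exp_rpow {ω M : ℝ} (hω : 0 < ω) (hM : 0 < M) :
    ∃ k : ℝ, 0 < k ∧ ∀ t : ℝ, 0 ≤ t → t ^ M ≤ k * Real.exp (t ^ ω) := by
  have hb : 0 < M / ω := by positivity
  refine ⟨(M / ω) ^ (M / ω), by positivity, fun t ht => ?_⟩
  have h0 : 0 ≤ t ^ ω := Real.rpow_nonneg ht _
  have h1 : t ^ ω ≤ M / ω * Real.exp (t ^ ω / (M / ω)) := by
    have := Real.add_one_le_exp (t ^ ω / (M / ω))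
    rw [← div_le_iff₀' hb]
    linarith
  calc t ^ M = (t ^ ω) ^ (M / ω) := by
        rw [← Real.rpow_mul ht, mul_div_cancel₀ _ hω.ne']
    _ ≤ (M / ω * Real.exp (t ^ ω / (M / ω))) ^ (M / ω) := Real.rpow_le_rpow h0 h1 hb.le
    _ = _ := by
        rw [Real.mul_rpow hb.le (Real.exp_pos _).le, ← Real.exp_mul, div_mul_cancel₀ _ hb.ne']

theorem TrudingerIneq.lowerAhlforsRegular [Nontrivial X] {ρ : X → X → ℝ} {μ : Measure X}
    (hX : IsQuasiMetricMeasureSpace ρ μ) (hup : UniformlyPerfect ρ) {q : ℝ≥0∞} {Q σ s : ℝ}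
    (hQ : 0 < Q) (hσ : quasiConst ρ ≤ σ) (hs : 0 < s) (hind : PrecIndex ρ q s)
    {F : Set X → (X → ℝ) → ℝ≥0∞} (hF : ControlsGradient ρ μ s (Q / s) F)
    (hF' : ∀ α, s ≤ α → (s = α → q = ∞) → BoundsBumps ρ μ s (Q / s) α F)
    (h : TrudingerIneq ρ μ σ F) : LowerAhlforsRegular ρ μ Q := by
  have hρ := hX.quasiMetric
  have hσ1 : 1 ≤ σ := hρ.one_le_quasiConst.trans hσ
  have hp : 0 < Q / s := by positivity
  obtain ⟨C, D, hC, hD, hseq⟩ := exists_bumpSequence hX hup hs hind hF'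
  obtain ⟨c₁, c₂, ω, hc₁, hc₂, hω, h⟩ := h
  -- the power `2 Q / s` turns the factor `μ (A j) ^ (s / Q)` into a square
  set M := 2 * (Q / s) with hMdef
  have hM : 0 < M := by positivity
  obtain ⟨k, hk, hexp⟩ := exists_rpow_le_exp_rpow hω hM
  obtain ⟨ε, hε, hit⟩ := exists_le_of_iteration (C := c₂ * k * (2 * C / c₁) ^ M) (D := D ^ M)
    (θ := 2) Q (by positivity) (Real.one_le_rpow hD hM.le) one_lt_two
  refine ⟨ε, hε, fun x r hr hrd => ?_⟩
  obtain ⟨u, A, hu⟩ := hseq x r hr hrd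
  have hBt := hX.ball_lt_top x r hr
  have hAt := hu.measure_ne_top hBt
  set m := (μ (qball ρ x r)).toReal with hm
  have hm0 : 0 < m := ENNReal.toReal_pos (hX.ball_pos x r hr).ne' hBt.ne
  have hmB : μ (qball ρ x r) = ENNReal.ofReal m := (ENNReal.ofReal_toReal hBt.ne).symm
  set a : ℕ → ℝ := fun j => (μ (A j)).toReal with ha
  have haA : ∀ j, μ (A j) = ENNReal.ofReal (a j) := fun j => (ENNReal.ofReal_toReal (hAt j)).symm
  have ha0 : ∀ j, 0 < a j := fun j => ENNReal.toReal_pos (hu.measure_ne_zero j) (hAt j)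
  obtain ⟨η, hη, hηA⟩ := hu.lower
  rw [hmB]
  refine ENNReal.ofReal_le_ofReal (hit r m η a hr hη (fun j => ?_) ?_ fun j => ?_)
  · have := hηA j
    rwa [haA, ENNReal.ofReal_le_ofReal_iff (ha0 j).le] at this
  · exact ENNReal.toReal_mono hBt.ne (measure_mono (hu.subset 0))
  have hmem := hu.memSpace hp hBt j (qball ρ x (σ * r))
  have hpos := hu.norm_pos hρ hp hs hr hF hBt (hX.ball_measurable x (σ * r) (by positivity))
    (qball_subset_mul hσ1 x hr) j
  obtain ⟨-, h1⟩ := h x r hr hrd (u j) hmem hpos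
  set Fr := (F (qball ρ x (σ * r)) (u j)).toReal with hFr
  have hFr0 : 0 < Fr := ENNReal.toReal_pos hpos.ne' hmem.2.ne
  set Φ := C * r ^ (-s) * D ^ j * a j ^ (1 / (Q / s)) with hΦ
  have ha2 := ha0 j
  have hΦ0 : 0 < Φ := by positivity
  have hFΦ : Fr ≤ Φ := by
    have h2 := hu.norm_le j (qball ρ x (σ * r))
    rw [haA, ENNReal.ofReal_rpow_of_pos ha2, ← ENNReal.ofReal_mul (by positivity)] at h2
    exact ENNReal.toReal_le_of_le_ofReal hΦ0.le h2
  have h2 := (hu.le_laverage (hX.ball_measurable x r hr) j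
    (⨍ z in qball ρ x r, u j z ∂μ) (c := ENNReal.ofReal (Real.exp ((c₁ / (2 * Φ)) ^ ω)))
    (f := fun y => ENNReal.ofReal (Real.exp
      ((c₁ * (|u j y - ⨍ z in qball ρ x r, u j z ∂μ| / Fr)) ^ ω))) fun y hy => by
      refine ENNReal.ofReal_le_ofReal
        (Real.exp_le_exp.2 (Real.rpow_le_rpow (by positivity) ?_ hω.le))
      calc c₁ / (2 * Φ) = c₁ * (1 / 2 / Φ) := by field_simp
        _ ≤ c₁ * (|u j y - ⨍ z in qball ρ x r, u j z ∂μ| / Fr) := by gcongr).trans h1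
  have ha1 := ha0 (j + 1)
  rw [haA, hmB, ← ENNReal.ofReal_div_of_pos hm0, ← ENNReal.ofReal_mul (by positivity),
    ENNReal.ofReal_le_ofReal_iff hc₂.le, ← mul_div_assoc, div_le_iff₀ hm0] at h2
  have h3 := hexp (c₁ / (2 * Φ)) (by positivity)
  have h4 : (c₁ / (2 * Φ)) ^ M * a (j + 1) ≤ k * (c₂ * m) := by
    calc (c₁ / (2 * Φ)) ^ M * a (j + 1) ≤ k * Real.exp ((c₁ / (2 * Φ)) ^ ω) * a (j + 1) := by
          gcongr
      _ = k * (Real.exp ((c₁ / (2 * Φ)) ^ ω) * a (j + 1)) := by ring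
      _ ≤ _ := by gcongr
  have e1 : (c₁ / (2 * Φ)) ^ M = ((2 * Φ / c₁) ^ M)⁻¹ := by
    rw [← Real.inv_rpow (by positivity), inv_div]
  rw [e1, inv_mul_le_iff₀ (by positivity)] at h4
  have e2 : (2 * Φ / c₁) ^ M =
      (2 * C / c₁) ^ M * r ^ (-(Q * 2)) * (D ^ M) ^ j * a j ^ (2 : ℝ) := by
    rw [show 2 * Φ / c₁ = 2 * C / c₁ * r ^ (-s) * D ^ j * a j ^ (1 / (Q / s)) by rw [hΦ]; ring,
      Real.mul_rpow (by positivity) (by positivity), Real.mul_rpow (by positivity) (by positivity),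
      Real.mul_rpow (by positivity) (by positivity), ← Real.rpow_mul hr.le, ← Real.rpow_mul ha2.le,
      Real.rpow_pow_comm (by positivity)]
    congr 3
    · congr 2
      rw [hMdef]; field_simp
    · rw [hMdef]; field_simp
  rw [e2] at h4
  refine h4.trans (le_of_eq ?_)
  ring

theorem HolderEst.lowerAhlforsRegular {ρ : X → X → ℝ} {μ : Measure X}
    (hX : IsQuasiMetricMeasureSpace ρ μ) (hup : UniformlyPerfect ρ) {q : ℝ≥0∞} {Q s p : ℝ}
    (hQ : 0 < Q) (hs : 0 < s) (hpQ : Q / s < p) (hind : PrecIndex ρ q s)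
    {F : Set X → (X → ℝ) → ℝ≥0∞} (hF : ∀ α, s ≤ α → (s = α → q = ∞) → BoundsBumps ρ μ s p α F)
    (h : HolderEst ρ μ Q s p F) : LowerAhlforsRegular ρ μ Q := by
  have hρ := hX.quasiMetric
  have hp : 0 < p := lt_trans (by positivity) hpQ
  have hδ : 0 < s - Q / p := by
    rw [sub_pos, div_lt_iff₀ hp]
    rwa [div_lt_iff₀ hs, mul_comm] at hpQ
  obtain ⟨K, hK1, hK, hK'⟩ := hρ.exists_const
  have hK0 : 0 < K := by positivity
  obtain ⟨C, D, hC, hD, hseq⟩ := exists_bumpSequence hX hup hs hind hF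
  obtain ⟨C', hC', h⟩ := h
  set k := C' * (K ^ 2) ^ (s - Q / p) * C with hk
  have hk0 : 0 < k := by positivity
  refine ⟨(k ^ p)⁻¹, by positivity, fun x r hr hrd => ?_⟩
  obtain ⟨u, A, hu⟩ := hseq x r hr hrd
  have hBt := hX.ball_lt_top x r hr
  set m := (μ (qball ρ x r)).toReal with hm
  have hm0 : 0 < m := ENNReal.toReal_pos (hX.ball_pos x r hr).ne' hBt.ne
  have hmB : μ (qball ρ x r) = ENNReal.ofReal m := (ENNReal.ofReal_toReal hBt.ne).symm
  obtain ⟨v, hvu, hv⟩ := h (u 0) (hu.memSpace hp hBt 0 univ)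
  have hex : ∀ S : Set X, μ S ≠ 0 → ∃ y ∈ S, v y = u 0 y := by
    intro S hS
    by_contra! hcon
    exact hS (measure_mono_null hcon (ae_iff.1 hvu))
  obtain ⟨y, hy, hvy⟩ := hex (A 1) (hu.measure_ne_zero 1)
  obtain ⟨w, hw, hvw⟩ := hex (qball ρ x r \ A 0) (ne_of_gt
    (lt_of_lt_of_le (pos_iff_ne_zero.2 (hu.measure_ne_zero 1)) (hu.le_diff 0)))
  have h1 : ρ y x ≤ K * r :=
    (hK x y).trans (mul_le_mul_of_nonneg_left (le_of_lt (hu.subset _ hy)) hK0.le)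
  have h2 : ρ x w ≤ K * r := (le_of_lt hw.1).trans (le_mul_of_one_le_left hr.le hK1)
  have h3 : ρ y w ≤ K ^ 2 * r := by
    calc ρ y w ≤ K * max (ρ y x) (ρ x w) := hK' y w x
      _ ≤ K * (K * r) := by gcongr; exact max_le h1 h2
      _ = _ := by ring
  have h4 := hv y w
  rw [hvy, hvw, hu.eq_one 0 y hy, hu.eq_zero 0 w hw.2, sub_zero, abs_one] at h4
  have h5 : ENNReal.ofReal 1 ≤ ENNReal.ofReal (k * r ^ (-(Q / p)) * m ^ (1 / p)) := by
    calc ENNReal.ofReal 1 ≤ _ := h4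
      _ ≤ ENNReal.ofReal (C' * (K ^ 2 * r) ^ (s - Q / p)) *
          (ENNReal.ofReal (C * r ^ (-s) * D ^ 0) * ENNReal.ofReal m ^ (1 / p)) := by
          have h6 := Real.rpow_le_rpow (hρ.nonneg _ _) h3 hδ.le
          gcongr
          refine (hu.norm_le 0 univ).trans ?_
          gcongr
          rw [← hmB]
          exact measure_mono (hu.subset 0)
      _ = _ := by
          rw [ENNReal.ofReal_rpow_of_pos hm0, ← mul_assoc, ← ENNReal.ofReal_mul (by positivity),
            ← ENNReal.ofReal_mul (by positivity), Real.mul_rpow (by positivity) hr.le, hk,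
            show -(Q / p) = s - Q / p + -s by ring, Real.rpow_add hr (s - Q / p)]
          congr 1
          ring
  rw [ENNReal.ofReal_le_ofReal_iff (by positivity)] at h5
  have h6 := Real.rpow_le_rpow zero_le_one h5 hp.le
  rw [Real.one_rpow, Real.mul_rpow (by positivity) (by positivity),
    Real.mul_rpow (by positivity) (by positivity), ← Real.rpow_mul hr.le, ← Real.rpow_mul hm0.le,
    one_div_mul_cancel hp.ne', Real.rpow_one, neg_mul, div_mul_cancel₀ _ hp.ne',
    Real.rpow_neg hr.le] at h6
  rw [hmB]
  refine ENNReal.ofReal_le_ofReal ?_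
  rw [inv_mul_le_iff₀ (by positivity)]
  have hrQ : 0 < r ^ Q := by positivity
  calc r ^ Q = r ^ Q * 1 := (mul_one _).symm
    _ ≤ r ^ Q * (k ^ p * (r ^ Q)⁻¹ * m) := by gcongr
    _ = _ := by field_simp

end Hajlasz

theorem theorem1p1 {X : Type*} [MeasurableSpace X] [Nontrivial X]
    (ρ : X → X → ℝ) (μ : Measure X) (hX : IsQuasiMetricMeasureSpace ρ μ)
    (hup : UniformlyPerfect ρ) (q : ℝ≥0∞) (hq : 0 < q) (Q : ℝ) (hQ : 0 < Q)
    (σ : ℝ) (hσ : quasiConst ρ ≤ σ) (s : ℝ) (hs : 0 < s) (hind : PrecIndex ρ q s) :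
    -- the equivalences for the Triebel-Lizorkin scale
    List.TFAE [
      LowerAhlforsRegular ρ μ Q,
      ∃ p : ℝ, 0 < p ∧ p < Q / s ∧ SobolevIneq ρ μ Q σ s p (mNorm ρ μ s p q),
      ∃ p : ℝ, 0 < p ∧ p < Q / s ∧ SobolevPoincareIneq ρ μ Q σ s p (mNorm ρ μ s p q),
      TrudingerIneq ρ μ σ (mNorm ρ μ s (Q / s) q),
      ∃ p : ℝ, Q / s < p ∧ HolderEst ρ μ Q s p (mNorm ρ μ s p q)] ∧
    -- the equivalences for the Besov scale with `q ≤ p`, for all items that admit such a `p`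
    (q < ENNReal.ofReal (Q / s) → List.TFAE [
      LowerAhlforsRegular ρ μ Q,
      ∃ p : ℝ, 0 < p ∧ p < Q / s ∧ q ≤ ENNReal.ofReal p ∧
        SobolevIneq ρ μ Q σ s p (nNorm ρ μ s p q),
      ∃ p : ℝ, 0 < p ∧ p < Q / s ∧ q ≤ ENNReal.ofReal p ∧
        SobolevPoincareIneq ρ μ Q σ s p (nNorm ρ μ s p q),
      TrudingerIneq ρ μ σ (nNorm ρ μ s (Q / s) q),
      ∃ p : ℝ, Q / s < p ∧ q ≤ ENNReal.ofReal p ∧ HolderEst ρ μ Q s p (nNorm ρ μ s p q)]) ∧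
    (q ≤ ENNReal.ofReal (Q / s) → List.TFAE [
      LowerAhlforsRegular ρ μ Q,
      TrudingerIneq ρ μ σ (nNorm ρ μ s (Q / s) q),
      ∃ p : ℝ, Q / s < p ∧ q ≤ ENNReal.ofReal p ∧ HolderEst ρ μ Q s p (nNorm ρ μ s p q)]) ∧
    (q < ∞ → List.TFAE [
      LowerAhlforsRegular ρ μ Q,
      ∃ p : ℝ, Q / s < p ∧ q ≤ ENNReal.ofReal p ∧ HolderEst ρ μ Q s p (nNorm ρ μ s p q)]) := by
  have hρ := hX.quasiMetric
  have hQs : 0 < Q / s := by positivity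
  have hM : ∀ {p : ℝ}, 0 < p → ControlsGradient ρ μ s p (mNorm ρ μ s p q) := fun hp =>
    mNorm_controlsGradient hρ μ hs hp hq
  have hM' : ∀ {p : ℝ}, 0 < p → ∀ α, s ≤ α → (s = α → q = ∞) →
      BoundsBumps ρ μ s p α (mNorm ρ μ s p q) := fun hp _ => mNorm_boundsBumps hρ μ hs hp hq
  have hN : ∀ {p : ℝ}, 0 < p → q ≤ ENNReal.ofReal p →
      ControlsGradient ρ μ s p (nNorm ρ μ s p q) := fun hp =>
    nNorm_controlsGradient hρ μ hs hp hq
  have hN' : ∀ {p : ℝ}, 0 < p → ∀ α, s ≤ α → (s = α → q = ∞) →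
      BoundsBumps ρ μ s p α (nNorm ρ μ s p q) := fun hp _ => nNorm_boundsBumps hρ μ hs hp hq
  have hHolder : q < ∞ → (LowerAhlforsRegular ρ μ Q ↔ ∃ p : ℝ, Q / s < p ∧
      q ≤ ENNReal.ofReal p ∧ HolderEst ρ μ Q s p (nNorm ρ μ s p q)) := by
    intro hq'
    constructor
    · intro h
      have hpQ : Q / s < max (Q / s) q.toReal + 1 := (le_max_left _ _).trans_lt (lt_add_one _)
      have hqp : q ≤ ENNReal.ofReal (max (Q / s) q.toReal + 1) := by
        rw [← ENNReal.ofReal_toReal hq'.ne]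
        refine ENNReal.ofReal_le_ofReal ?_
        rw [ENNReal.toReal_ofReal ENNReal.toReal_nonneg]
        exact (le_max_right _ _).trans (lt_add_one _).le
      exact ⟨_, hpQ, hqp, h.holderEst hX hQ hs hpQ (hN (hQs.trans hpQ) hqp)⟩
    · rintro ⟨p, hpQ, -, h⟩
      exact h.lowerAhlforsRegular hX hup hQ hs hpQ hind (hN' (hQs.trans hpQ))
  have hTrudinger : q ≤ ENNReal.ofReal (Q / s) → (LowerAhlforsRegular ρ μ Q ↔
      TrudingerIneq ρ μ σ (nNorm ρ μ s (Q / s) q)) := fun hqQ =>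
    ⟨fun h => h.trudingerIneq hX hQ hσ hs (hN hQs hqQ),
      fun h => h.lowerAhlforsRegular hX hup hQ hσ hs hind (hN hQs hqQ) (hN' hQs)⟩
  refine ⟨?_, fun hqQ => ?_, fun hqQ => ?_, fun hq' => ?_⟩
  · tfae_have 1 → 2 := fun h => ⟨Q / s / 2, by positivity, half_lt_self hQs,
      h.sobolevIneq hX hQ hσ hs (by positivity) (half_lt_self hQs) (hM (by positivity))⟩
    tfae_have 2 → 1 := fun ⟨p, hp, hpQ, h⟩ =>
      h.lowerAhlforsRegular hX hup hs hp hpQ hind (hM' hp)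
    tfae_have 1 → 3 := fun h => ⟨Q / s / 2, by positivity, half_lt_self hQs,
      h.sobolevPoincareIneq hX hQ hσ hs (by positivity) (half_lt_self hQs) (hM (by positivity))⟩
    tfae_have 3 → 1 := fun ⟨p, hp, hpQ, h⟩ =>
      h.lowerAhlforsRegular hX hup hs hp hpQ hind (hM' hp)
    tfae_have 1 → 4 := fun h => h.trudingerIneq hX hQ hσ hs (hM hQs)
    tfae_have 4 → 1 := fun h => h.lowerAhlforsRegular hX hup hQ hσ hs hind (hM hQs) (hM' hQs)
    tfae_have 1 → 5 := fun h => ⟨Q / s + 1, lt_add_one _,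
      h.holderEst hX hQ hs (lt_add_one _) (hM (by positivity))⟩
    tfae_have 5 → 1 := fun ⟨p, hpQ, h⟩ =>
      h.lowerAhlforsRegular hX hup hQ hs hpQ hind (hM' (hQs.trans hpQ))
    tfae_finish
  · have hqt : q ≠ ∞ := hqQ.ne_top
    have hp0 : 0 < q.toReal := ENNReal.toReal_pos hq.ne' hqt
    have hpQ : q.toReal < Q / s := by
      rw [← ENNReal.ofReal_toReal hqt] at hqQ
      exact (ENNReal.ofReal_lt_ofReal_iff hQs).1 hqQ
    have hqp : q ≤ ENNReal.ofReal q.toReal := (ENNReal.ofReal_toReal hqt).ge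
    tfae_have 1 → 2 := fun h => ⟨q.toReal, hp0, hpQ, hqp,
      h.sobolevIneq hX hQ hσ hs hp0 hpQ (hN hp0 hqp)⟩
    tfae_have 2 → 1 := fun ⟨p, hp, hpQ, _, h⟩ =>
      h.lowerAhlforsRegular hX hup hs hp hpQ hind (hN' hp)
    tfae_have 1 → 3 := fun h => ⟨q.toReal, hp0, hpQ, hqp,
      h.sobolevPoincareIneq hX hQ hσ hs hp0 hpQ (hN hp0 hqp)⟩
    tfae_have 3 → 1 := fun ⟨p, hp, hpQ, _, h⟩ =>
      h.lowerAhlforsRegular hX hup hs hp hpQ hind (hN' hp)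
    tfae_have 1 ↔ 4 := hTrudinger hqQ.le
    tfae_have 1 ↔ 5 := hHolder hqt.lt_top
    tfae_finish
  · tfae_have 1 ↔ 2 := hTrudinger hqQ
    tfae_have 1 ↔ 3 := hHolder (hqQ.trans_lt ENNReal.ofReal_lt_top)
    tfae_finish
  · tfae_have 1 ↔ 2 := hHolder hq'
    tfae_finish
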